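/- Let $X(t)$, $t\in T$, be a centered jointly Gaussian family of real random variables on a probability space, $T\neq\emptyset$, with canonical distance $d(s,t)=(\mathbb E(X(s)-X(t))^2)^{1/2}$. Assume that $(T,d)$ is compact and that the process is separable: there are a countable set $D\subset T$ and a null set of $\omega$ outside which, for every $t\in T$ and $\varepsilon>0$, $X(t,\omega)$ lies in the closure of $\{X(s,\omega): s\in D,\ d(s,t)<\varepsilon\}$. Let $B(t,\varepsilon)=\{x\in T: d(x,t)\le\varepsilon\}$, let $N(T,d,\delta)$ be the least number of balls $B(t,\delta)$, $t\in T$, that cover $T$, and for $\delta>0$ and a Borel probability measure $\mu$ on $T$ put $$\mathcal M(\mu,\mu,\delta)=\int_T\int_0^\delta\sqrt{\log_2\frac1{\mu(B(t,\varepsilon))}}\,d\varepsilon\,\mu(dt)\in[0,\infty],\qquad S(\delta)=\mathbb E\sup_{s,t\in T,\ d(s,t)\le\delta}|X(s)-X(t)|\in[0,\infty].$$ Then there is a universal constant $K\in(0,\infty)$, depending neither on $T$ nor on $X$, such that for every $\delta>0$ $$K^{-1}\sup_{c>0}\sup_\mu\Bigl(\mathcal M(\mu,\mu,c)-c\sqrt{\log_2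 N(T,d,\delta)}\Bigr)\le S(\delta)\le K\sup_\mu\mathcal M(\mu,\mu,2\delta),$$ where the suprema are over all Borel probability measures $\mu$ on $T$. In particular, $t\mapsto X(t,\omega)$ is continuous on $(T,d)$ for almost every $\omega$ if and only if $\lim_{\delta\to0^+}\sup_\mu\mathcal M(\mu,\mu,\delta)=0$. -/

import Mathlib

open MeasureTheory ProbabilityTheory Filter Topology
open scoped ENNReal NNReal

universe u v

namespace GaussianModulus

/-- The function `p ↦ √(log₂ (1 / p))` for `p ∈ [0, 1]`, with the value `∞` at `p = 0`. -/
noncomputable def sqrtLogInv (p : ℝ≥0∞) : ℝ≥0∞ :=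
  if p = 0 then ∞ else ENNReal.ofReal (Real.sqrt (Real.logb 2 (p.toReal)⁻¹))

/-- `M(μ, ν, δ) = ∫_T ∫_0^δ √(log₂ (μ(B(t, ε))⁻¹)) dε ν(dt)`, where `B(t, ε)` is the closed ball;
it takes values in `[0, ∞]`. -/
noncomputable def mmFunctional {T : Type u} [PseudoMetricSpace T] [MeasurableSpace T]
    (μ ν : Measure T) (δ : ℝ) : ℝ≥0∞ :=
  ∫⁻ t, ∫⁻ ε in Set.Ioc 0 δ, sqrtLogInv (μ (Metric.closedBall t ε)) ∂volume ∂ν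

/-- `sup_μ M(μ, μ, δ)` over all Borel probability measures `μ` on `T`. -/
noncomputable def supMM (T : Type u) [PseudoMetricSpace T] [MeasurableSpace T] (δ : ℝ) : ℝ≥0∞ :=
  ⨆ μ : ProbabilityMeasure T, mmFunctional (μ : Measure T) (μ : Measure T) δ

/-- `√(log₂ N(T, d, δ))`, where `N(T, d, δ)` is the least number of closed balls of radius `δ`
(with centers in `T`) that cover `T`. It is meant for compact `T` and `δ > 0`, where
`N(T, d, δ)` is finite. -/
noncomputable def sqrtLogCovering (T : Type u) [PseudoMetricSpace T] (δ : ℝ) : ℝ :=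
  Real.sqrt (Real.logb 2
    ((Metric.coveringNumber δ.toNNReal (Set.univ : Set T)).toNat : ℝ))

/-- `sup_{c > 0} sup_μ (M(μ, μ, c) - c √(log₂ N(T, d, δ)))`, over all Borel probability measures `μ`
on `T`. The subtraction is the one of `[0, ∞]`, truncated at `0`. This does not change the supremum:
the differences with small `c` show that it is nonnegative. -/
noncomputable def lowerBoundMM (T : Type u) [PseudoMetricSpace T] [MeasurableSpace T]
    (δ : ℝ) : ℝ≥0∞ :=
  ⨆ (c : ℝ) (_ : 0 < c) (μ : ProbabilityMeasure T),
    mmFunctional (μ : Measure T) (μ : Measure T) c - ENNReal.ofReal (c * sqrtLogCovering T δ)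

/-- The modulus `S(δ) = E sup_{d(s, t) ≤ δ} |X(s) - X(t)|`, with values in `[0, ∞]`. -/
noncomputable def modulus {T : Type u} [PseudoMetricSpace T] {Ω : Type v} [MeasurableSpace Ω]
    (P : Measure Ω) (X : T → Ω → ℝ) (δ : ℝ) : ℝ≥0∞ :=
  ∫⁻ ω, ⨆ (s : T) (t : T) (_ : dist s t ≤ δ), ENNReal.ofReal |X s ω - X t ω| ∂P

/-- The process `X` is separable: there are a countable set `D ⊆ T` and a null set outside which,
for every `t`, the value `X(t)` is a cluster value of `X(s)`, `s ∈ D`, as `s` tends to `t`. -/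
def IsSeparableProcess {T : Type u} [PseudoMetricSpace T] {Ω : Type v} [MeasurableSpace Ω]
    (P : Measure Ω) (X : T → Ω → ℝ) : Prop :=
  ∃ D : Set T, D.Countable ∧ ∀ᵐ ω ∂P, ∀ t : T, ∀ ε > 0,
    X t ω ∈ closure ((fun s => X s ω) '' (D ∩ Metric.ball t ε))

/-- `X` is a centered Gaussian process on `T`, and the (pseudo)metric of `T` is its canonical
distance `d(s, t) = (E (X(s) - X(t))²)^{1/2}`. -/
structure IsCanonicalGaussian {T : Type u} [PseudoMetricSpace T] {Ω : Type v} [MeasurableSpace Ω]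
    (P : Measure Ω) (X : T → Ω → ℝ) : Prop where
  gaussian : IsGaussianProcess X P
  centered : ∀ t, ∫ ω, X t ω ∂P = 0
  dist_eq : ∀ s t, dist s t = Real.sqrt (∫ ω, (X s ω - X t ω) ^ 2 ∂P)

end GaussianModulus

/-! Both bounds reduce to finitely many points, that is, to a centered Gaussian measure on `V → ℝ`
and a system of weights on `V`.

Lower bound. The engine is Talagrand's growth condition (`le_meanSup_of_separated`): if small sets
surround `n` centers at mutual distance at least `a`, the expected supremum over their union exceeds
the least expected supremum over one of them by order `a √(log n)`, up to a multiple of `a`. It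
comes from the Sudakov–Fernique inequality, applied to independent copies of the process near the
centers, each lifted by an independent Gaussian variable. Sudakov–Fernique itself is obtained by
smoothing the maximum with `lse` and exchanging one Gaussian vector for the other in many small
steps. A greedy partition turns growth into a bound on entropy integrals: refining a set costs the
entropy of the partition, and the drop of the expected supremum between scales pays for it
(`sum_ballEntropy_le_of_radius`). For a measure on a ball of radius `δ`, the relevant supremum is
over increments from the center, which `S(δ)` controls, whatever the upper limit `c` of the entropy
integral (`mmFunctional_le_modulus`). A general measure is cut along a minimal cover by `δ`-balls;
cutting costs at most `c √(log₂ N)` (`mmFunctional_le_add`).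

Upper bound. Chaining through averages over shrinking balls bounds an increment by the entropy
integrals at its two endpoints and a random energy of mean at most `2`
(`ofReal_abs_sub_le_ballEntropy`). The weights are free, so, following Fernique, they are taken to
be the law of a random endpoint of the pair with the largest increment. The expected entropy at the
endpoints is then the entropy of the weights integrated against the weights themselves, which is why
one measure plays both roles in `M(μ, μ, r)` (`exists_weights_lintegral_iSup_le`). Separability
extends the bound to all pairs after enlarging the radius.

Continuity. If `supMM` vanishes at `0`, so does the mean oscillation, and paths are continuous.
Conversely, continuous paths on a compact space are bounded, Fernique's theorem makes the increments
integrable, dominated convergence sends the mean oscillation to `0`, and the lower bound with `δ`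
fixed and `c → 0` concludes. -/

namespace GaussianModulus

/-! ### The smooth maximum `lse` and its second-order expansion -/

section LogSumExp

variable {ι : Type*} [Fintype ι]

/-- The function `x ↦ log (∑ i, exp (x i))`. -/
noncomputable def lse (x : ι → ℝ) : ℝ := Real.log (∑ i, Real.exp (x i))

/-- The weights `exp (x i) / ∑ j, exp (x j)`. -/
noncomputable def softmax (x : ι → ℝ) (i : ι) : ℝ := Real.exp (x i) / ∑ j, Real.exp (x j)

lemma sum_exp_pos [Nonempty ι] (x : ι → ℝ) : 0 < ∑ i, Real.exp (x i) :=
  Finset.sum_pos (fun _ _ => Real.exp_pos _) Finset.univ_nonempty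

lemma softmax_nonneg (x : ι → ℝ) (i : ι) : 0 ≤ softmax x i := by
  unfold softmax; positivity

lemma sum_softmax [Nonempty ι] (x : ι → ℝ) : ∑ i, softmax x i = 1 := by
  unfold softmax
  rw [← Finset.sum_div, div_self (sum_exp_pos x).ne']

lemma lse_add [Nonempty ι] (x v : ι → ℝ) :
    lse (x + v) = lse x + Real.log (∑ i, softmax x i * Real.exp (v i)) := by
  have h := sum_exp_pos x
  have h2 : ∑ i, Real.exp ((x + v) i) =
      (∑ i, Real.exp (x i)) * ∑ i, softmax x i * Real.exp (v i) := by
    rw [Finset.mul_sum]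
    refine Finset.sum_congr rfl fun i _ => ?_
    rw [softmax, Pi.add_apply, Real.exp_add]
    field_simp
  have h3 : 0 < ∑ i, softmax x i * Real.exp (v i) := by
    have h4 := sum_exp_pos (x + v)
    rw [h2] at h4
    exact pos_of_mul_pos_right h4 h.le
  rw [lse, h2, Real.log_mul h.ne' h3.ne', lse]

/-- The second-order term of `lse` is a variance under the softmax weights. In this form it depends
only on increments, so the comparison below needs no hypothesis on the individual variances. -/
lemma sum_mul_sub_sq {p v : ι → ℝ} (h1 : ∑ i, p i = 1) :
    ∑ i, ∑ j, p i * p j * (v i - v j) ^ 2 = 2 * ∑ i, p i * (v i - ∑ j, p j * v j) ^ 2 := by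
  set m := ∑ j, p j * v j with hm
  have e1 : ∑ i, ∑ j, p i * p j * (v i - v j) ^ 2 =
      2 * ∑ i, p i * v i ^ 2 - 2 * m ^ 2 := by
    have : ∀ i, ∑ j, p i * p j * (v i - v j) ^ 2
        = p i * v i ^ 2 - 2 * (p i * v i) * m + p i * ∑ j, p j * v j ^ 2 := by
      intro i
      have : ∀ j, p i * p j * (v i - v j) ^ 2 =
          p i * v i ^ 2 * p j - 2 * (p i * v i) * (p j * v j) + p i * (p j * v j ^ 2) := by
        intro j; ring
      simp_rw [this, Finset.sum_add_distrib, Finset.sum_sub_distrib, ← Finset.mul_sum, h1]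
      ring
    simp_rw [this, Finset.sum_add_distrib, Finset.sum_sub_distrib, ← Finset.sum_mul,
      ← Finset.mul_sum, h1, ← hm]
    ring
  have e2 : ∑ i, p i * (v i - m) ^ 2 = ∑ i, p i * v i ^ 2 - m ^ 2 := by
    have : ∀ i, p i * (v i - m) ^ 2 = p i * v i ^ 2 - 2 * m * (p i * v i) + m ^ 2 * p i := by
      intro i; ring
    simp_rw [this, Finset.sum_add_distrib, Finset.sum_sub_distrib, ← Finset.mul_sum, h1, ← hm]
    ring
  rw [e1, e2]; ring

lemma abs_weighted_sum_le {p f : ι → ℝ} (h0 : ∀ i, 0 ≤ p i) (h1 : ∑ i, p i = 1) {b : ℝ}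
    (hf : ∀ i, |f i| ≤ b) : |∑ i, p i * f i| ≤ b := by
  calc |∑ i, p i * f i| ≤ ∑ i, |p i * f i| := Finset.abs_sum_le_sum_abs _ _
    _ ≤ ∑ i, p i * b := by
        refine Finset.sum_le_sum fun i _ => ?_
        rw [abs_mul, abs_of_nonneg (h0 i)]
        exact mul_le_mul_of_nonneg_left (hf i) (h0 i)
    _ = b := by rw [← Finset.sum_mul, h1, one_mul]

/-- Third order Taylor bound for the cumulant generating function of a bounded variable. -/
lemma abs_log_sum_exp_sub_le {p v : ι → ℝ} (h0 : ∀ i, 0 ≤ p i) (h1 : ∑ i, p i = 1) {a : ℝ}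
    (ha : 0 ≤ a) (hv : ∀ i, |v i| ≤ a) :
    |Real.log (∑ i, p i * Real.exp (v i)) - ∑ i, p i * v i
      - 1 / 4 * ∑ i, ∑ j, p i * p j * (v i - v j) ^ 2| ≤ 12 * a ^ 3 := by
  rw [sum_mul_sub_sq h1]
  set m := ∑ j, p j * v j with hm
  have hm_le : |m| ≤ a := abs_weighted_sum_le h0 h1 hv
  set q := ∑ i, p i * (v i - m) ^ 2 with hq
  have hw : ∀ i, |v i - m| ≤ 2 * a := fun i => by
    have := hv i
    rw [abs_le] at *
    constructor <;> linarith [this.1, this.2, hm_le.1, hm_le.2]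
  have hq0 : 0 ≤ q := Finset.sum_nonneg fun i _ => mul_nonneg (h0 i) (sq_nonneg _)
  have hq1 : q ≤ 4 * a ^ 2 := by
    have : |q| ≤ 4 * a ^ 2 := by
      refine abs_weighted_sum_le h0 h1 fun i => ?_
      rw [abs_of_nonneg (sq_nonneg _), ← sq_abs]
      nlinarith [hw i, abs_nonneg (v i - m)]
    exact (le_abs_self q).trans this
  -- For `a ≥ 1/2` every term is at most a multiple of `a` or `a²`, hence of `a³`. For `a ≤ 1/2` the
  -- centered values are at most `1` in size, so the exponential series applies.
  rcases le_total (1 / 2) a with ha2 | ha2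
  · have hs1 : Real.exp (-a) ≤ ∑ i, p i * Real.exp (v i) := by
      calc Real.exp (-a) = ∑ i, p i * Real.exp (-a) := by rw [← Finset.sum_mul, h1, one_mul]
        _ ≤ _ := Finset.sum_le_sum fun i _ => mul_le_mul_of_nonneg_left
            (Real.exp_le_exp.2 (abs_le.1 (hv i)).1) (h0 i)
    have hs2 : ∑ i, p i * Real.exp (v i) ≤ Real.exp a := by
      calc _ ≤ ∑ i, p i * Real.exp a := Finset.sum_le_sum fun i _ => mul_le_mul_of_nonneg_left
            (Real.exp_le_exp.2 (abs_le.1 (hv i)).2) (h0 i)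
        _ = _ := by rw [← Finset.sum_mul, h1, one_mul]
    have hpos := (Real.exp_pos _).trans_le hs1
    have hl1 := (Real.le_log_iff_exp_le hpos).2 hs1
    have hl2 := (Real.log_le_iff_le_exp hpos).2 hs2
    rw [abs_le] at hm_le ⊢
    have k2 : a ^ 2 ≤ 2 * a ^ 3 := by nlinarith [sq_nonneg a]
    have k1 : a ≤ 4 * a ^ 3 := by nlinarith
    constructor <;> linarith [hm_le.1, hm_le.2, pow_nonneg ha 3]
  · have hr : ∀ i, |Real.exp (v i - m) - (1 + (v i - m) + (v i - m) ^ 2 / 2)| ≤ 2 * a ^ 3 := by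
      intro i
      have hle1 : |v i - m| ≤ 1 := (hw i).trans (by linarith)
      have := Real.exp_bound (x := v i - m) hle1 (n := 3) (by norm_num)
      simp only [Finset.sum_range_succ, Finset.sum_range_zero] at this
      norm_num [Nat.factorial] at this
      refine this.trans ?_
      have h3 : |v i - m| ^ 3 ≤ (2 * a) ^ 3 := pow_le_pow_left₀ (abs_nonneg _) (hw i) 3
      nlinarith [pow_nonneg ha 3]
    set r : ι → ℝ := fun i => Real.exp (v i - m) - (1 + (v i - m) + (v i - m) ^ 2 / 2) with hrdef
    have hsr := abs_weighted_sum_le h0 h1 hr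
    have hwm : ∑ i, p i * (v i - m) = 0 := by
      simp_rw [mul_sub, Finset.sum_sub_distrib, ← Finset.sum_mul, h1, ← hm]; ring
    have hsum : ∑ i, p i * Real.exp (v i - m) = 1 + q / 2 + ∑ i, p i * r i := by
      have : ∀ i, p i * Real.exp (v i - m) = p i + p i * (v i - m) +
          (p i * (v i - m) ^ 2) / 2 + p i * r i := by
        intro i; simp only [hrdef]; ring
      simp_rw [this, Finset.sum_add_distrib, h1, hwm, ← Finset.sum_div, ← hq]; ring
    set R := ∑ i, p i * r i with hR
    -- After centering at the mean, Jensen's inequality places the argument of the logarithm at `1 +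
    -- u` with `u ≥ 0`, where `u - u² ≤ log (1 + u) ≤ u`.
    have hge : 1 ≤ ∑ i, p i * Real.exp (v i - m) := by
      calc (1 : ℝ) = ∑ i, (p i + p i * (v i - m)) := by
            rw [Finset.sum_add_distrib, h1, hwm, add_zero]
        _ ≤ _ := Finset.sum_le_sum fun i _ => by
            nlinarith [h0 i, Real.add_one_le_exp (v i - m)]
    have hlog : Real.log (∑ i, p i * Real.exp (v i)) = m + Real.log (1 + (q / 2 + R)) := by
      have : ∑ i, p i * Real.exp (v i) = Real.exp m * (1 + (q / 2 + R)) := by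
        rw [← add_assoc, ← hsum, Finset.mul_sum]
        refine Finset.sum_congr rfl fun i _ => ?_
        rw [mul_left_comm, ← Real.exp_add]; congr 2; ring
      rw [this, Real.log_mul (Real.exp_pos _).ne' (by linarith), Real.log_exp]
    set u := q / 2 + R with hu
    have hu0 : 0 ≤ u := by linarith
    have hl1 : Real.log (1 + u) ≤ u := by
      have := Real.log_le_sub_one_of_pos (show 0 < 1 + u by linarith); linarith
    have hl2 : u - u ^ 2 ≤ Real.log (1 + u) := by
      have := Real.one_sub_inv_le_log_of_pos (show 0 < 1 + u by linarith)
      refine le_trans ?_ this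
      rw [← sub_nonneg]
      have : 1 - (1 + u)⁻¹ - (u - u ^ 2) = u ^ 3 / (1 + u) := by field_simp; ring
      rw [this]; positivity
    rw [hlog]
    rw [abs_le] at hsr ⊢
    have k3 : a ^ 3 ≤ a ^ 2 / 2 := by nlinarith [sq_nonneg a]
    have hu1 : u ≤ 3 * a ^ 2 := by linarith [hsr.2]
    have hu2 : u ^ 2 ≤ 5 * a ^ 3 := by
      have : u ^ 2 ≤ (3 * a ^ 2) ^ 2 := pow_le_pow_left₀ hu0 hu1 2
      nlinarith [pow_nonneg ha 3]
    have k4 := pow_nonneg ha 3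
    constructor <;> linarith [hsr.1, hsr.2]

lemma abs_lse_add_sub_le [Nonempty ι] (x v : ι → ℝ) {a : ℝ} (ha : 0 ≤ a) (hv : ∀ i, |v i| ≤ a) :
    |lse (x + v) - (lse x + ∑ i, softmax x i * v i
      + 1 / 4 * ∑ i, ∑ j, softmax x i * softmax x j * (v i - v j) ^ 2)| ≤ 12 * a ^ 3 := by
  rw [lse_add]
  convert abs_log_sum_exp_sub_le (softmax_nonneg x) (sum_softmax x) ha hv using 2
  ring

lemma ciSup_le_lse [Nonempty ι] (x : ι → ℝ) : ⨆ i, x i ≤ lse x := by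
  refine ciSup_le fun i => ?_
  rw [lse, Real.le_log_iff_exp_le (sum_exp_pos x)]
  exact Finset.single_le_sum (f := fun i => Real.exp (x i)) (fun j _ => (Real.exp_pos _).le)
    (Finset.mem_univ i)

lemma lse_le_ciSup_add [Nonempty ι] (x : ι → ℝ) :
    lse x ≤ (⨆ i, x i) + Real.log (Fintype.card ι) := by
  have hc : (0 : ℝ) < Fintype.card ι := by exact_mod_cast Fintype.card_pos
  rw [lse, Real.log_le_iff_le_exp (sum_exp_pos x), Real.exp_add, Real.exp_log hc]
  calc ∑ i, Real.exp (x i) ≤ ∑ _i : ι, Real.exp (⨆ i, x i) :=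
        Finset.sum_le_sum fun i _ => Real.exp_le_exp.2 (le_ciSup (Finite.bddAbove_range x) i)
    _ = _ := by simp [mul_comm]

lemma abs_ciSup_le_norm [Nonempty ι] (x : ι → ℝ) : |⨆ i, x i| ≤ ‖x‖ := by
  obtain ⟨i₀⟩ := ‹Nonempty ι›
  have h : ∀ i, |x i| ≤ ‖x‖ := fun i => norm_le_pi_norm x i
  rw [abs_le]
  constructor
  · exact (abs_le.1 (h i₀)).1.trans (le_ciSup (Finite.bddAbove_range x) i₀)
  · have : Nonempty ι := ⟨i₀⟩
    exact ciSup_le fun i => (abs_le.1 (h i)).2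

lemma abs_lse_le [Nonempty ι] (x : ι → ℝ) : |lse x| ≤ Real.log (Fintype.card ι) + ‖x‖ := by
  have h1 := ciSup_le_lse x
  have h2 := lse_le_ciSup_add x
  have h3 := abs_le.1 (abs_ciSup_le_norm x)
  have h4 : 0 ≤ Real.log (Fintype.card ι) := Real.log_natCast_nonneg _
  rw [abs_le]; constructor <;> linarith [h3.1, h3.2]

lemma continuous_lse [Nonempty ι] : Continuous (lse (ι := ι)) := by
  unfold lse
  exact Continuous.log (by fun_prop) fun x => (sum_exp_pos x).ne'

end LogSumExp

/-! ### The Sudakov–Fernique inequality by an exchange argument -/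

section SudakovFernique

variable {ι : Type*} [Fintype ι]

lemma _root_.MeasureTheory.Integrable.const_add {α : Type*} [MeasurableSpace α] {μ : Measure α}
    [IsFiniteMeasure μ] {f : α → ℝ} (hf : Integrable f μ) (c : ℝ) :
    Integrable (fun x => c + f x) μ :=
  (integrable_const c).add hf

lemma IsGaussian.integrable_norm_pow (μ : Measure (ι → ℝ)) [IsGaussian μ] (k : ℕ) :
    Integrable (fun x => ‖x‖ ^ k) μ := by
  have := IsGaussian.memLp_id μ (k : ℝ≥0∞) (by simp)
  exact this.integrable_norm_pow'

lemma IsGaussian.integrable_norm (μ : Measure (ι → ℝ)) [IsGaussian μ] :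
    Integrable (fun x => ‖x‖) μ := by
  simpa using IsGaussian.integrable_norm_pow μ 1

lemma IsGaussian.integrable_eval (μ : Measure (ι → ℝ)) [IsGaussian μ] (i : ι) :
    Integrable (fun x : ι → ℝ => x i) μ :=
  (IsGaussian.integrable_norm μ).mono' (continuous_apply i).aestronglyMeasurable
    (ae_of_all _ fun x => norm_le_pi_norm x i)

lemma IsGaussian.integrable_eval_sub_sq (μ : Measure (ι → ℝ)) [IsGaussian μ] (i j : ι) :
    Integrable (fun x : ι → ℝ => (x i - x j) ^ 2) μ := by
  refine ((IsGaussian.integrable_norm_pow μ 2).const_mul 4).mono' (by fun_prop)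
    (ae_of_all _ fun x => ?_)
  have h1 := abs_le.1 (norm_le_pi_norm x i)
  have h2 := abs_le.1 (norm_le_pi_norm x j)
  rw [Real.norm_eq_abs, abs_of_nonneg (sq_nonneg _)]
  nlinarith [norm_nonneg x, h1.1, h1.2, h2.1, h2.2]

lemma integral_id_eq_zero_of_forall_eval {μ : Measure (ι → ℝ)} [IsGaussian μ]
    (h : ∀ i, ∫ x : ι → ℝ, x i ∂μ = 0) : μ[id] = 0 := by
  ext i
  have := (ContinuousLinearMap.proj (R := ℝ) (φ := fun _ : ι => ℝ) i).integral_comp_comm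
    (IsGaussian.integrable_id (μ := μ))
  simp only [ContinuousLinearMap.proj_apply, id_eq] at this
  rw [h i] at this
  simpa using this.symm

/-- Stability of centered Gaussian measures. -/
lemma IsGaussian.integral_smul_eq {μ : Measure (ι → ℝ)} [IsGaussian μ] (hμ : μ[id] = 0)
    {a b c : ℝ} (hb : 0 ≤ b) (hc : 0 ≤ c) (h : a ^ 2 + b ^ 2 = c ^ 2)
    {g : (ι → ℝ) → ℝ} (hg : Continuous g) :
    ∫ x, g (c • x) ∂μ = ∫ p, g (a • p.1 + b • p.2) ∂(μ.prod μ) := by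
  rcases hc.eq_or_lt with rfl | hc
  · have ha : a = 0 := by nlinarith [sq_nonneg a, sq_nonneg b]
    have hb : b = 0 := by nlinarith [sq_nonneg a, sq_nonneg b]
    simp [ha, hb]
  · have hac : a ^ 2 ≤ c ^ 2 := by nlinarith [sq_nonneg b]
    have habs := abs_le.1 (abs_le_of_sq_le_sq hac hc.le)
    -- The point `(a / c, b / c)` lies on the upper unit semicircle because `0 ≤ b`, so `arccos`
    -- gives its angle; invariance of `μ.prod μ` under rotation does the rest.
    have h1 : Real.cos (Real.arccos (a / c)) = a / c := by
      apply Real.cos_arccos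
      · rw [le_div_iff₀ hc]; linarith [habs.1]
      · rw [div_le_iff₀ hc]; linarith [habs.2]
    have h2 : Real.sin (Real.arccos (a / c)) = b / c := by
      rw [Real.sin_arccos, show 1 - (a / c) ^ 2 = (b / c) ^ 2 by field_simp; linarith,
        Real.sqrt_sq (by positivity)]
    set θ := Real.arccos (a / c)
    have e : ∀ p : (ι → ℝ) × (ι → ℝ), a • p.1 + b • p.2 =
        c • (ContinuousLinearMap.rotation θ p).1 := by
      intro p
      rw [ContinuousLinearMap.rotation_apply, h1, h2]
      simp only [smul_add, smul_smul]
      rw [mul_div_cancel₀ _ hc.ne', mul_div_cancel₀ _ hc.ne']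
    simp_rw [e]
    have h3 : ∫ p, g (c • p.1) ∂((μ.prod μ).map (ContinuousLinearMap.rotation θ)) =
        ∫ p, g (c • (ContinuousLinearMap.rotation θ p).1) ∂(μ.prod μ) := by
      rw [integral_map (by fun_prop)]
      exact Continuous.aestronglyMeasurable (by fun_prop)
    rw [← h3, IsGaussian.map_rotation_eq_self hμ, integral_fun_fst (f := fun x => g (c • x))]
    simp

lemma measurable_ciSup_pi : Measurable fun x : ι → ℝ => ⨆ i, x i :=
  Measurable.iSup fun i => measurable_pi_apply i

variable [Nonempty ι]

lemma IsGaussian.integrable_lse_affine (μ : Measure (ι → ℝ)) [IsGaussian μ] (z : ι → ℝ) (s : ℝ) :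
    Integrable (fun y => lse (z + s • y)) μ := by
  refine (((IsGaussian.integrable_norm μ).const_mul |s|).const_add
    (Real.log (Fintype.card ι) + ‖z‖)).mono'
    (continuous_lse.comp (by fun_prop)).aestronglyMeasurable (ae_of_all _ fun y => ?_)
  refine (abs_lse_le _).trans ?_
  have := norm_add_le z (s • y)
  rw [norm_smul, Real.norm_eq_abs] at this
  linarith

/-- Taylor expansion around the frozen point `z`: the linear term integrates to zero because `μ` is
centered, the quadratic one sees only the variances of increments, and the remainder is cubic in
`s`. -/
lemma abs_integral_lse_sub_le (μ : Measure (ι → ℝ)) [IsGaussian μ]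
    (hμ : ∀ i, ∫ x : ι → ℝ, x i ∂μ = 0) (z : ι → ℝ) {s : ℝ} (hs : 0 ≤ s) :
    |∫ y, lse (z + s • y) ∂μ - (lse z + s ^ 2 / 4 * ∑ i, ∑ j, softmax z i * softmax z j *
      ∫ y : ι → ℝ, (y i - y j) ^ 2 ∂μ)| ≤ 12 * s ^ 3 * ∫ y, ‖y‖ ^ 3 ∂μ := by
  set q : (ι → ℝ) → ℝ := fun y => lse z + ∑ i, softmax z i * (s • y) i
      + 1 / 4 * ∑ i, ∑ j, softmax z i * softmax z j * ((s • y) i - (s • y) j) ^ 2 with hq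
  have i1 : Integrable (fun y : ι → ℝ => ∑ i, softmax z i * (s • y) i) μ := by
    refine integrable_finsetSum _ fun i _ => ?_
    exact ((IsGaussian.integrable_eval μ i).const_mul s).const_mul _
  have i2 : Integrable (fun y : ι → ℝ =>
      ∑ i, ∑ j, softmax z i * softmax z j * ((s • y) i - (s • y) j) ^ 2) μ := by
    refine integrable_finsetSum _ fun i _ => integrable_finsetSum _ fun j _ => ?_
    have : (fun y : ι → ℝ => softmax z i * softmax z j * ((s • y) i - (s • y) j) ^ 2) =
        fun y => softmax z i * softmax z j * s ^ 2 * (y i - y j) ^ 2 := by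
      ext y; simp only [Pi.smul_apply, smul_eq_mul]; ring
    rw [this]
    exact (IsGaussian.integrable_eval_sub_sq μ i j).const_mul _
  have iq : Integrable q μ := (i1.const_add _).add (i2.const_mul _)
  have hqi : ∫ y, q y ∂μ = lse z + s ^ 2 / 4 * ∑ i, ∑ j, softmax z i * softmax z j *
      ∫ y : ι → ℝ, (y i - y j) ^ 2 ∂μ := by
    simp only [hq]
    rw [integral_add (i1.const_add _) (i2.const_mul _), integral_add (integrable_const _) i1,
      integral_const_mul, integral_finsetSum, integral_finsetSum]
    · have : ∀ i, ∫ y : ι → ℝ, softmax z i * (s • y) i ∂μ = 0 := by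
        intro i
        simp [integral_const_mul, hμ i]
      simp only [this, integral_const, probReal_univ, one_smul, Finset.sum_const_zero, add_zero]
      congr 1
      rw [Finset.mul_sum, Finset.mul_sum]
      refine Finset.sum_congr rfl fun i _ => ?_
      rw [integral_finsetSum, Finset.mul_sum, Finset.mul_sum]
      · refine Finset.sum_congr rfl fun j _ => ?_
        rw [integral_const_mul]
        have : ∀ y : ι → ℝ, ((s • y) i - (s • y) j) ^ 2 = s ^ 2 * (y i - y j) ^ 2 := by
          intro y; simp only [Pi.smul_apply, smul_eq_mul]; ring
        simp_rw [this, integral_const_mul]; ring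
      · intro j _
        have : (fun y : ι → ℝ => softmax z i * softmax z j * ((s • y) i - (s • y) j) ^ 2) =
            fun y => softmax z i * softmax z j * s ^ 2 * (y i - y j) ^ 2 := by
          ext y; simp only [Pi.smul_apply, smul_eq_mul]; ring
        rw [this]
        exact (IsGaussian.integrable_eval_sub_sq μ i j).const_mul _
    · intro i _
      refine integrable_finsetSum _ fun j _ => ?_
      have : (fun y : ι → ℝ => softmax z i * softmax z j * ((s • y) i - (s • y) j) ^ 2) =
          fun y => softmax z i * softmax z j * s ^ 2 * (y i - y j) ^ 2 := by
        ext y; simp only [Pi.smul_apply, smul_eq_mul]; ring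
      rw [this]
      exact (IsGaussian.integrable_eval_sub_sq μ i j).const_mul _
    · intro i _
      exact ((IsGaussian.integrable_eval μ i).const_mul s).const_mul _
  rw [← hqi, ← integral_sub (IsGaussian.integrable_lse_affine μ z s) iq, ← integral_const_mul]
  refine (abs_integral_le_integral_abs).trans ?_
  refine integral_mono ((IsGaussian.integrable_lse_affine μ z s).sub iq).abs
    ((IsGaussian.integrable_norm_pow μ 3).const_mul _) fun y => ?_
  have := abs_lse_add_sub_le z (s • y) (a := s * ‖y‖) (by positivity) (fun i => by
    rw [Pi.smul_apply, smul_eq_mul, abs_mul, abs_of_nonneg hs]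
    exact mul_le_mul_of_nonneg_left (norm_le_pi_norm y i) hs)
  refine this.trans (le_of_eq ?_)
  ring

/-- Replacing a small Gaussian component by one with larger increments increases the mean of `lse`,
up to an error of third order. -/
lemma integral_lse_affine_le {μ ν : Measure (ι → ℝ)} [IsGaussian μ] [IsGaussian ν]
    (hμ : ∀ i, ∫ x : ι → ℝ, x i ∂μ = 0) (hν : ∀ i, ∫ x : ι → ℝ, x i ∂ν = 0)
    (h : ∀ i j, ∫ y : ι → ℝ, (y i - y j) ^ 2 ∂ν ≤ ∫ y : ι → ℝ, (y i - y j) ^ 2 ∂μ)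
    (z : ι → ℝ) {s : ℝ} (hs : 0 ≤ s) :
    ∫ y, lse (z + s • y) ∂ν ≤ ∫ y, lse (z + s • y) ∂μ +
      12 * s ^ 3 * (∫ y, ‖y‖ ^ 3 ∂μ + ∫ y, ‖y‖ ^ 3 ∂ν) := by
  have h1 := abs_le.1 (abs_integral_lse_sub_le μ hμ z hs)
  have h2 := abs_le.1 (abs_integral_lse_sub_le ν hν z hs)
  have h3 : s ^ 2 / 4 * ∑ i, ∑ j, softmax z i * softmax z j * ∫ y : ι → ℝ, (y i - y j) ^ 2 ∂ν ≤
      s ^ 2 / 4 * ∑ i, ∑ j, softmax z i * softmax z j * ∫ y : ι → ℝ, (y i - y j) ^ 2 ∂μ := by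
    refine mul_le_mul_of_nonneg_left (Finset.sum_le_sum fun i _ => Finset.sum_le_sum fun j _ =>
      mul_le_mul_of_nonneg_left (h i j) (mul_nonneg (softmax_nonneg z i) (softmax_nonneg z j)))
      (by positivity)
  linarith [h1.1, h2.2]

lemma IsGaussian.integrable_lse_prod (μ ν : Measure (ι → ℝ)) [IsGaussian μ] [IsGaussian ν]
    (z : ι → ℝ) (a b : ℝ) :
    Integrable (fun p : (ι → ℝ) × (ι → ℝ) => lse (z + (a • p.1 + b • p.2))) (μ.prod ν) := by
  have h1 : Integrable (fun p : (ι → ℝ) × (ι → ℝ) => ‖p.1‖) (μ.prod ν) :=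
    (IsGaussian.integrable_norm μ).comp_fst ν
  have h2 : Integrable (fun p : (ι → ℝ) × (ι → ℝ) => ‖p.2‖) (μ.prod ν) :=
    (IsGaussian.integrable_norm ν).comp_snd μ
  refine (((h1.const_mul |a|).add (h2.const_mul |b|)).const_add
    (Real.log (Fintype.card ι) + ‖z‖)).mono'
    (continuous_lse.comp (by fun_prop)).aestronglyMeasurable (ae_of_all _ fun p => ?_)
  refine (abs_lse_le _).trans ?_
  have e1 := norm_add_le z (a • p.1 + b • p.2)
  have e2 := norm_add_le (a • p.1) (b • p.2)
  rw [norm_smul, norm_smul, Real.norm_eq_abs, Real.norm_eq_abs] at e2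
  simp only [Pi.add_apply]
  linarith

lemma integrable_integral_lse (μ ν ρ : Measure (ι → ℝ)) [IsGaussian μ] [IsGaussian ν]
    [IsGaussian ρ] (a b : ℝ) {s : ℝ} :
    Integrable (fun p : (ι → ℝ) × (ι → ℝ) => ∫ w, lse (a • p.1 + b • p.2 + s • w) ∂ρ)
      (μ.prod ν) := by
  have h1 : Integrable (fun p : (ι → ℝ) × (ι → ℝ) => ‖p.1‖) (μ.prod ν) :=
    (IsGaussian.integrable_norm μ).comp_fst ν
  have h2 : Integrable (fun p : (ι → ℝ) × (ι → ℝ) => ‖p.2‖) (μ.prod ν) :=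
    (IsGaussian.integrable_norm ν).comp_snd μ
  refine (((h1.const_mul |a|).add (h2.const_mul |b|)).const_add
    (Real.log (Fintype.card ι) + |s| * ∫ w, ‖w‖ ∂ρ)).mono' ?_ (ae_of_all _ fun p => ?_)
  · refine (StronglyMeasurable.integral_prod_right (f := fun (p : (ι → ℝ) × (ι → ℝ)) w =>
      lse (a • p.1 + b • p.2 + s • w)) ?_).aestronglyMeasurable
    exact (continuous_lse.comp (by fun_prop)).stronglyMeasurable
  · refine (norm_integral_le_integral_norm _).trans ?_
    have : ∫ w, ‖lse (a • p.1 + b • p.2 + s • w)‖ ∂ρ ≤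
        ∫ w, (Real.log (Fintype.card ι) + (|a| * ‖p.1‖ + |b| * ‖p.2‖)) + |s| * ‖w‖ ∂ρ := by
      refine integral_mono (IsGaussian.integrable_lse_affine ρ _ s).norm
        (((IsGaussian.integrable_norm ρ).const_mul _).const_add _) fun w => ?_
      refine (abs_lse_le _).trans ?_
      have e1 := norm_add_le (a • p.1 + b • p.2) (s • w)
      have e2 := norm_add_le (a • p.1) (b • p.2)
      simp only [norm_smul, Real.norm_eq_abs] at e1 e2
      linarith
    refine this.trans (le_of_eq ?_)
    rw [integral_add (integrable_const _) ((IsGaussian.integrable_norm ρ).const_mul _),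
      integral_const_mul]
    simp only [integral_const, probReal_univ, one_smul, Pi.add_apply]
    ring

/-- One step of the Gaussian interpolation. -/
lemma integral_lse_interpolate_le {μ ν : Measure (ι → ℝ)} [IsGaussian μ] [IsGaussian ν]
    (hμ : ∀ i, ∫ x : ι → ℝ, x i ∂μ = 0) (hν : ∀ i, ∫ x : ι → ℝ, x i ∂ν = 0)
    (h : ∀ i j, ∫ y : ι → ℝ, (y i - y j) ^ 2 ∂ν ≤ ∫ y : ι → ℝ, (y i - y j) ^ 2 ∂μ)
    {a a' b b' s : ℝ} (hs : 0 ≤ s) (ha' : 0 ≤ a') (hb : 0 ≤ b)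
    (haa : a ^ 2 + s ^ 2 = a' ^ 2) (hbb : b' ^ 2 + s ^ 2 = b ^ 2) :
    ∫ p, lse (a • p.1 + b • p.2) ∂(μ.prod ν) ≤ ∫ p, lse (a' • p.1 + b' • p.2) ∂(μ.prod ν) +
      12 * s ^ 3 * (∫ y, ‖y‖ ^ 3 ∂μ + ∫ y, ‖y‖ ^ 3 ∂ν) := by
  have hμ0 := integral_id_eq_zero_of_forall_eval hμ
  have hν0 := integral_id_eq_zero_of_forall_eval hν
  have i0 : ∀ a b, Integrable (fun p : (ι → ℝ) × (ι → ℝ) => lse (a • p.1 + b • p.2))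
      (μ.prod ν) := fun a b => by simpa using IsGaussian.integrable_lse_prod μ ν 0 a b
  -- By stability `b • y` splits into `b' • y` and an independent piece `s • w` of law `ν`; in `e2`,
  -- `a' • x` splits off a piece of law `μ`. Both sides then share the same frozen part, and only
  -- the law of `w` differs.
  have e1 : ∫ p, lse (a • p.1 + b • p.2) ∂(μ.prod ν) =
      ∫ p, ∫ w, lse (a • p.1 + b' • p.2 + s • w) ∂ν ∂(μ.prod ν) := by
    rw [integral_prod _ (i0 a b), integral_prod _ (integrable_integral_lse μ ν ν a b')]
    refine integral_congr_ae (ae_of_all _ fun x => ?_)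
    have := IsGaussian.integral_smul_eq hν0 hs hb hbb (g := fun y => lse (a • x + y))
      (continuous_lse.comp (by fun_prop))
    simp only at this ⊢
    rw [this, integral_prod _ (IsGaussian.integrable_lse_prod ν ν (a • x) b' s)]
    simp_rw [add_assoc]
  have e2 : ∫ p, lse (a' • p.1 + b' • p.2) ∂(μ.prod ν) =
      ∫ p, ∫ w, lse (a • p.1 + b' • p.2 + s • w) ∂μ ∂(μ.prod ν) := by
    rw [integral_prod_symm _ (i0 a' b'), integral_prod_symm _ (integrable_integral_lse μ ν μ a b')]
    refine integral_congr_ae (ae_of_all _ fun y => ?_)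
    have := IsGaussian.integral_smul_eq hμ0 hs ha' haa (g := fun x => lse (b' • y + x))
      (continuous_lse.comp (by fun_prop))
    have c : ∀ x : ι → ℝ, a' • x + b' • y = b' • y + a' • x := fun x => add_comm _ _
    have c' : ∀ x w : ι → ℝ, a • x + b' • y + s • w = b' • y + (a • x + s • w) :=
      fun x w => by abel
    simp only [c, c'] at this ⊢
    rw [this, integral_prod _ (IsGaussian.integrable_lse_prod μ μ (b' • y) a s)]
  rw [e1, e2]
  have hint := integrable_integral_lse μ ν μ a b' (s := s)
  calc _ ≤ ∫ p, (∫ w, lse (a • p.1 + b' • p.2 + s • w) ∂μ) +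
        12 * s ^ 3 * (∫ y, ‖y‖ ^ 3 ∂μ + ∫ y, ‖y‖ ^ 3 ∂ν) ∂(μ.prod ν) :=
        integral_mono (integrable_integral_lse μ ν ν a b') (hint.add (integrable_const _))
          fun p => integral_lse_affine_le hμ hν h _ hs
    _ = _ := by
        rw [integral_add hint (integrable_const _)]; simp

/-- `N` exchanges of a component of variance share `1 / N` each cost order `N ^ (-3/2)`, so the
total error `N ^ (-1/2)` vanishes as `N` grows. -/
lemma integral_lse_le_of_increments_le {μ ν : Measure (ι → ℝ)} [IsGaussian μ] [IsGaussian ν]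
    (hμ : ∀ i, ∫ x : ι → ℝ, x i ∂μ = 0) (hν : ∀ i, ∫ x : ι → ℝ, x i ∂ν = 0)
    (h : ∀ i j, ∫ y : ι → ℝ, (y i - y j) ^ 2 ∂ν ≤ ∫ y : ι → ℝ, (y i - y j) ^ 2 ∂μ) :
    ∫ y, lse y ∂ν ≤ ∫ y, lse y ∂μ := by
  set M := 12 * (∫ y, ‖y‖ ^ 3 ∂μ + ∫ y, ‖y‖ ^ 3 ∂ν) with hM
  have hN : ∀ n : ℕ, ∫ y, lse y ∂ν ≤ ∫ y, lse y ∂μ + M * Real.sqrt (1 / ((n : ℝ) + 1)) := by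
    intro n
    set N : ℝ := (n : ℝ) + 1 with hNdef
    have hNpos : 0 < N := by positivity
    set s := Real.sqrt (1 / N) with hs
    have hs2 : s ^ 2 = 1 / N := Real.sq_sqrt (by positivity)
    have key : ∀ k : ℕ, (k : ℝ) ≤ N →
        ∫ p, lse ((0 : ℝ) • p.1 + (1 : ℝ) • p.2) ∂(μ.prod ν) ≤
        ∫ p, lse (Real.sqrt (k / N) • p.1 + Real.sqrt ((N - k) / N) • p.2) ∂(μ.prod ν)
          + k * (s ^ 3 * M) := by
      intro k
      induction k with
      | zero => intro _; simp [hNpos.ne']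
      | succ k ih =>
        intro hk
        push_cast at hk ⊢
        refine (ih (by linarith)).trans ?_
        have := integral_lse_interpolate_le hμ hν h (a := Real.sqrt (k / N))
          (a' := Real.sqrt ((k + 1) / N)) (b := Real.sqrt ((N - k) / N))
          (b' := Real.sqrt ((N - (k + 1)) / N)) (s := s) (Real.sqrt_nonneg _)
          (Real.sqrt_nonneg _) (Real.sqrt_nonneg _)
          (by rw [hs2, Real.sq_sqrt (by positivity), Real.sq_sqrt (by positivity)]; ring)
          (by
            rw [hs2, Real.sq_sqrt (div_nonneg (by linarith) hNpos.le),
              Real.sq_sqrt (div_nonneg (by linarith) hNpos.le)]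
            ring)
        nlinarith
    have := key (n + 1) (by push_cast; exact le_of_eq hNdef.symm)
    push_cast at this
    rw [← hNdef, sub_self, zero_div, div_self hNpos.ne'] at this
    simp only [Real.sqrt_one, Real.sqrt_zero, one_smul, zero_smul, zero_add, add_zero] at this
    rw [integral_fun_fst (f := fun x => lse x), integral_fun_snd (f := fun x => lse x)] at this
    simp only [probReal_univ, one_smul] at this
    refine this.trans (le_of_eq ?_)
    rw [show s ^ 3 = s ^ 2 * s by ring, hs2]
    field_simp
  have hlim : Tendsto (fun n : ℕ => ∫ y, lse y ∂μ + M * Real.sqrt (1 / ((n : ℝ) + 1))) atTop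
      (𝓝 (∫ y, lse y ∂μ + M * Real.sqrt 0)) :=
    ((Real.continuous_sqrt.tendsto 0).comp tendsto_one_div_add_atTop_nhds_zero_nat).const_mul M
      |>.const_add _
  rw [Real.sqrt_zero, mul_zero, add_zero] at hlim
  exact ge_of_tendsto' hlim hN

lemma IsGaussian.integrable_ciSup (μ : Measure (ι → ℝ)) [IsGaussian μ] :
    Integrable (fun x : ι → ℝ => ⨆ i, x i) μ :=
  (IsGaussian.integrable_norm μ).mono' measurable_ciSup_pi.aestronglyMeasurable
    (ae_of_all _ abs_ciSup_le_norm)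

/-- The **Sudakov–Fernique inequality** for Gaussian measures on `ι → ℝ`. -/
theorem integral_ciSup_le_of_increments_le {μ ν : Measure (ι → ℝ)} [IsGaussian μ] [IsGaussian ν]
    (hμ : ∀ i, ∫ x : ι → ℝ, x i ∂μ = 0) (hν : ∀ i, ∫ x : ι → ℝ, x i ∂ν = 0)
    (h : ∀ i j, ∫ y : ι → ℝ, (y i - y j) ^ 2 ∂ν ≤ ∫ y : ι → ℝ, (y i - y j) ^ 2 ∂μ) :
    ∫ y, ⨆ i, y i ∂ν ≤ ∫ y, ⨆ i, y i ∂μ := by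
  have key : ∀ n : ℕ, ∫ y, ⨆ i, y i ∂ν ≤
      ∫ y, ⨆ i, y i ∂μ + Real.log (Fintype.card ι) * (1 / ((n : ℝ) + 1)) := by
    intro n
    -- Inverse temperature: `lse (β • y) / β` differs from the maximum of `y` by at most `log (card)
    -- / β`.
    set β : ℝ := (n : ℝ) + 1 with hβ
    have hβ0 : 0 < β := by positivity
    let L : (ι → ℝ) →L[ℝ] (ι → ℝ) := β • ContinuousLinearMap.id ℝ (ι → ℝ)
    have hL : ∀ x, L x = β • x := fun x => rfl
    have hLm : ∀ ρ : Measure (ι → ℝ), AEMeasurable L ρ := fun ρ => L.continuous.aemeasurable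
    have hmap : ∀ (ρ : Measure (ι → ℝ)) (g : (ι → ℝ) → ℝ), Continuous g →
        ∫ y, g y ∂(ρ.map L) = ∫ y, g (β • y) ∂ρ := fun ρ g hg =>
      integral_map (hLm ρ) hg.aestronglyMeasurable
    have hl := integral_lse_le_of_increments_le (μ := μ.map L) (ν := ν.map L)
      (fun i => by rw [hmap _ _ (by fun_prop)]; simp [integral_const_mul, hμ i])
      (fun i => by rw [hmap _ _ (by fun_prop)]; simp [integral_const_mul, hν i])
      (fun i j => by
        rw [hmap _ _ (by fun_prop), hmap _ _ (by fun_prop)]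
        have : ∀ y : ι → ℝ, ((β • y) i - (β • y) j) ^ 2 = β ^ 2 * (y i - y j) ^ 2 := by
          intro y; simp only [Pi.smul_apply, smul_eq_mul]; ring
        simp_rw [this, integral_const_mul]
        exact mul_le_mul_of_nonneg_left (h i j) (by positivity))
    rw [hmap _ _ continuous_lse, hmap _ _ continuous_lse] at hl
    have hsup : ∀ y : ι → ℝ, ⨆ i, (β • y) i = β * ⨆ i, y i := fun y => by
      simp only [Pi.smul_apply, smul_eq_mul]
      rw [Real.mul_iSup_of_nonneg hβ0.le]
    have i1 : ∀ ρ : Measure (ι → ℝ), IsGaussian ρ → Integrable (fun y => lse (β • y)) ρ :=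
      fun ρ hρ => by simpa using IsGaussian.integrable_lse_affine ρ 0 β
    have h1 : β * ∫ y, ⨆ i, y i ∂ν ≤ ∫ y, lse (β • y) ∂ν := by
      rw [← integral_const_mul]
      refine integral_mono ((IsGaussian.integrable_ciSup ν).const_mul β) (i1 ν ‹_›) fun y => ?_
      simp only [← hsup]
      exact ciSup_le_lse _
    have h2 : ∫ y, lse (β • y) ∂μ ≤ β * ∫ y, ⨆ i, y i ∂μ + Real.log (Fintype.card ι) := by
      have : ∫ y, lse (β • y) ∂μ ≤ ∫ y, β * (⨆ i, y i) + Real.log (Fintype.card ι) ∂μ := by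
        refine integral_mono (i1 μ ‹_›)
          (((IsGaussian.integrable_ciSup μ).const_mul β).add (integrable_const _)) fun y => ?_
        simp only [← hsup]
        exact lse_le_ciSup_add _
      refine this.trans (le_of_eq ?_)
      rw [integral_add ((IsGaussian.integrable_ciSup μ).const_mul β) (integrable_const _),
        integral_const_mul]
      simp
    have h3 := h1.trans (hl.trans h2)
    rw [← mul_le_mul_iff_right₀ hβ0]
    refine h3.trans (le_of_eq ?_)
    field_simp
  have hlim : Tendsto (fun n : ℕ => ∫ y : ι → ℝ, ⨆ i, y i ∂μ +
      Real.log (Fintype.card ι) * (1 / ((n : ℝ) + 1))) atTop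
      (𝓝 (∫ y : ι → ℝ, ⨆ i, y i ∂μ + Real.log (Fintype.card ι) * 0)) :=
    (tendsto_one_div_add_atTop_nhds_zero_nat.const_mul _).const_add _
  rw [mul_zero, add_zero] at hlim
  exact ge_of_tendsto' hlim key

end SudakovFernique

lemma _root_.MeasureTheory.Integrable.comp_measurePreserving {α β : Type*} [MeasurableSpace α]
    [MeasurableSpace β] {μ : Measure α} {ν : Measure β} {f : β → ℝ} (hf : Integrable f ν)
    {g : α → β} (hg : MeasurePreserving g μ ν) : Integrable (fun x => f (g x)) μ :=
  (hg.integrable_comp hf.aestronglyMeasurable).2 hf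

/-! ### The maximum of independent standard Gaussian variables -/

section GaussianMax

variable {I : Type*} [Fintype I]

/-- On `[x, x + 1]`, an interval of length one, the density is at least its value at the right
endpoint. -/
lemma le_gaussianReal_Ici {x : ℝ} (hx : 0 ≤ x) :
    (Real.sqrt (2 * Real.pi))⁻¹ * Real.exp (-(x + 1) ^ 2 / 2) ≤
      (gaussianReal 0 1).real (Set.Ici x) := by
  have h1 : ENNReal.ofReal ((Real.sqrt (2 * Real.pi))⁻¹ * Real.exp (-(x + 1) ^ 2 / 2)) ≤
      gaussianReal 0 1 (Set.Ici x) := by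
    rw [gaussianReal_apply _ one_ne_zero]
    calc _ = ∫⁻ y in Set.Icc x (x + 1),
          ENNReal.ofReal ((Real.sqrt (2 * Real.pi))⁻¹ * Real.exp (-(x + 1) ^ 2 / 2)) := by
          simp
      _ ≤ ∫⁻ y in Set.Icc x (x + 1), gaussianPDF 0 1 y := by
          refine setLIntegral_mono (measurable_gaussianPDF 0 1) fun y hy => ?_
          rw [gaussianPDF, gaussianPDFReal_def]
          refine ENNReal.ofReal_le_ofReal ?_
          simp only [NNReal.coe_one, mul_one, sub_zero]
          gcongr
          all_goals linarith [hy.1, hy.2]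
      _ ≤ _ := lintegral_mono_set Set.Icc_subset_Ici_self
  have h2 := (ENNReal.ofReal_le_iff_le_toReal (by simp)).1 h1
  exact h2

lemma integrable_ciSup_pi_gaussian [Nonempty I] :
    Integrable (fun g : I → ℝ => ⨆ i, g i) (Measure.pi fun _ => gaussianReal 0 1) := by
  have h : ∀ i : I, Integrable (fun g : I → ℝ => g i) (Measure.pi fun _ => gaussianReal 0 1) :=
    fun i => ((memLp_id_gaussianReal (μ := 0) (v := 1) 1).integrable le_rfl).comp_measurePreserving
      (measurePreserving_eval (fun _ : I => gaussianReal 0 1) i)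
  refine (integrable_finsetSum Finset.univ fun i _ => (h i).abs).mono'
    measurable_ciSup_pi.aestronglyMeasurable (ae_of_all _ fun g => ?_)
  refine (abs_ciSup_le_norm g).trans ?_
  rw [pi_norm_le_iff_of_nonneg (Finset.sum_nonneg fun i _ => abs_nonneg _)]
  exact fun i => Finset.single_le_sum (f := fun i => |g i|) (fun _ _ => abs_nonneg _)
    (Finset.mem_univ i)

lemma integral_abs_gaussianReal_le : ∫ x, |x| ∂(gaussianReal 0 1) ≤ 1 := by
  have h2 : Integrable (fun x : ℝ => x ^ 2) (gaussianReal 0 1) :=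
    (memLp_id_gaussianReal (μ := 0) (v := 1) 2).integrable_sq
  have hv : ∫ x, x ^ 2 ∂(gaussianReal 0 1) = 1 := by
    have := variance_id_gaussianReal (μ := 0) (v := 1)
    rw [variance_eq_integral measurable_id.aemeasurable] at this
    simpa [integral_id_gaussianReal] using this
  calc ∫ x, |x| ∂(gaussianReal 0 1) ≤ ∫ x, (1 + x ^ 2) / 2 ∂(gaussianReal 0 1) := by
        refine integral_mono ((memLp_id_gaussianReal (μ := 0) (v := 1) 1).integrable le_rfl).abs
          ((h2.const_add 1).div_const 2) fun x => ?_
        nlinarith [sq_abs x, sq_nonneg (|x| - 1)]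
    _ = 1 := by
        rw [integral_div, integral_add (integrable_const _) h2, hv]; simp

/-- Lower bound on the expected maximum of independent standard Gaussian variables. -/
lemma le_integral_ciSup_pi_gaussian [Nonempty I] :
    Real.sqrt (Real.log (Fintype.card I)) / 2 - 2 ≤
      ∫ g : I → ℝ, ⨆ i, g i ∂(Measure.pi fun _ => gaussianReal 0 1) := by
  obtain ⟨i₀⟩ := ‹Nonempty I›
  have : Nonempty I := ⟨i₀⟩
  set γ := gaussianReal 0 1 with hγ
  have hint1 : Integrable (fun x : ℝ => x) γ :=
    (memLp_id_gaussianReal (μ := 0) (v := 1) 1).integrable le_rfl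
  have hmp := measurePreserving_eval (fun _ : I => γ) i₀
  have hint : Integrable (fun g : I → ℝ => g i₀) (Measure.pi fun _ => γ) :=
    hint1.comp_measurePreserving hmp
  have hsup := integrable_ciSup_pi_gaussian (I := I)
  -- If the root is at most `4`, the left side is nonpositive and a single centered coordinate
  -- suffices.
  rcases le_total (Real.sqrt (Real.log (Fintype.card I))) 4 with hsmall | hlarge
  · have h0 : ∫ g : I → ℝ, g i₀ ∂(Measure.pi fun _ => γ) = 0 := by
      rw [integral_comp_eval (μ := fun _ : I => γ) (f := fun x => x) (i := i₀)
        measurable_id.aestronglyMeasurable, hγ, integral_id_gaussianReal]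
    have : ∫ g : I → ℝ, g i₀ ∂(Measure.pi fun _ => γ) ≤
        ∫ g : I → ℝ, ⨆ i, g i ∂(Measure.pi fun _ => γ) :=
      integral_mono hint hsup fun g => le_ciSup (Finite.bddAbove_range g) i₀
    linarith
  · set n := Fintype.card I with hn
    have hn0 : (0 : ℝ) < n := by exact_mod_cast Fintype.card_pos
    -- The shift by `1` makes the tail bound at `x` equal to `n ^ (-1/2) / √(2π)`, so the expected
    -- number of coordinates above `x` is at least `1`, and all stay below with probability at most
    -- `exp (-1) ≤ 1/2`.
    set x := Real.sqrt (Real.log n) - 1 with hx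
    have hx0 : 0 ≤ x := by linarith
    have hlog : (x + 1) ^ 2 = Real.log n := by
      rw [hx, sub_add_cancel]
      exact Real.sq_sqrt (Real.log_natCast_nonneg n)
    have hlog16 : 16 ≤ Real.log n := by rw [← hlog]; nlinarith
    set p := γ.real (Set.Ici x) with hp
    have hpn : 1 ≤ p * n := by
      have h1 := le_gaussianReal_Ici hx0
      rw [hlog] at h1
      have h2 : Real.exp (-Real.log n / 2) * n = Real.exp (Real.log n / 2) := by
        nth_rewrite 2 [← Real.exp_log hn0]
        rw [← Real.exp_add]; congr 1; ring
      have h3 : Real.sqrt (2 * Real.pi) ≤ Real.exp (Real.log n / 2) := by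
        have : Real.sqrt (2 * Real.pi) ≤ 3 := by
          rw [Real.sqrt_le_left (by norm_num)]
          nlinarith [Real.pi_lt_d2]
        linarith [Real.add_one_le_exp (Real.log n / 2)]
      have h4 : 0 < Real.sqrt (2 * Real.pi) := by positivity
      calc (1 : ℝ) = (Real.sqrt (2 * Real.pi))⁻¹ * Real.sqrt (2 * Real.pi) := by field_simp
        _ ≤ (Real.sqrt (2 * Real.pi))⁻¹ * Real.exp (Real.log n / 2) := by gcongr
        _ = ((Real.sqrt (2 * Real.pi))⁻¹ * Real.exp (-Real.log n / 2)) * n := by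
            rw [mul_assoc, h2]
        _ ≤ p * n := by gcongr
    set S : Set (I → ℝ) := Set.pi Set.univ fun _ => Set.Iio x with hS
    have hSm : MeasurableSet S := MeasurableSet.univ_pi fun _ => measurableSet_Iio
    have hSp : (Measure.pi fun _ : I => γ).real S ≤ 1 / 2 := by
      have h1 : (Measure.pi fun _ : I => γ).real S = (1 - p) ^ n := by
        rw [measureReal_def, hS, Measure.pi_pi, Finset.prod_const, Finset.card_univ,
          ENNReal.toReal_pow, ← measureReal_def, ← Set.compl_Ici,
          probReal_compl_eq_one_sub measurableSet_Ici]
      have hp1 : p ≤ 1 := measureReal_le_one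
      rw [h1]
      calc (1 - p) ^ n ≤ (Real.exp (-p)) ^ n :=
            pow_le_pow_left₀ (by linarith) (by linarith [Real.add_one_le_exp (-p)]) n
        _ = Real.exp (-(p * n)) := by rw [← Real.exp_nat_mul]; congr 1; ring
        _ ≤ Real.exp (-1) := Real.exp_le_exp.2 (by linarith)
        _ ≤ 1 / 2 := by
            rw [Real.exp_neg, one_div]
            exact inv_anti₀ (by norm_num) (by linarith [Real.add_one_le_exp 1])
    have hSc : 1 / 2 ≤ (Measure.pi fun _ : I => γ).real Sᶜ := by
      rw [probReal_compl_eq_one_sub hSm]; linarith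
    -- A supremum below `x` may be negative; it is still at least `g i₀`, and subtracting `|g i₀|`
    -- costs at most `1` in mean.
    have hpt : ∀ g : I → ℝ, Sᶜ.indicator (fun _ => x) g - |g i₀| ≤ ⨆ i, g i := by
      intro g
      have hbdd := Finite.bddAbove_range g
      by_cases hg : g ∈ S
      · rw [Set.indicator_of_notMem (by simpa using hg)]
        linarith [neg_abs_le (g i₀), le_ciSup hbdd i₀]
      · rw [Set.indicator_of_mem (by simpa using hg)]
        simp only [hS, Set.mem_univ_pi, Set.mem_Iio, not_forall, not_lt] at hg
        obtain ⟨i, hi⟩ := hg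
        linarith [abs_nonneg (g i₀), le_ciSup hbdd i]
    have habs : ∫ g : I → ℝ, |g i₀| ∂(Measure.pi fun _ => γ) ≤ 1 := by
      rw [integral_comp_eval (μ := fun _ : I => γ) (f := fun x => |x|) (i := i₀)
        (continuous_abs.aestronglyMeasurable)]
      exact integral_abs_gaussianReal_le
    have hind : Integrable (Sᶜ.indicator fun _ => x) (Measure.pi fun _ : I => γ) :=
      (integrable_const x).indicator hSm.compl
    have := integral_mono (hind.sub hint.abs) hsup hpt
    rw [integral_sub' hind hint.abs, integral_indicator hSm.compl, setIntegral_const,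
      smul_eq_mul] at this
    nlinarith

end GaussianMax

/-! ### Talagrand's growth condition for expected suprema -/

section Growth

variable {V : Type*} [Fintype V]

/-- The expected supremum over `A` of the canonical process on `V → ℝ`. -/
noncomputable def meanSup (μ : Measure (V → ℝ)) (A : Finset V) : ℝ := ∫ x, ⨆ s : A, x s ∂μ

lemma integrable_ciSup_finset (μ : Measure (V → ℝ)) [IsGaussian μ] {A : Finset V}
    (hA : A.Nonempty) : Integrable (fun x : V → ℝ => ⨆ s : A, x s) μ := by
  have : Nonempty A := hA.to_subtype
  refine (IsGaussian.integrable_norm μ).mono'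
    (Measurable.iSup fun i : A => measurable_pi_apply (i : V)).aestronglyMeasurable
    (ae_of_all _ fun x => ?_)
  refine (abs_ciSup_le_norm fun s : A => x s).trans ?_
  rw [pi_norm_le_iff_of_nonneg (norm_nonneg _)]
  exact fun s => norm_le_pi_norm x s

lemma meanSup_mono (μ : Measure (V → ℝ)) [IsGaussian μ] {A B : Finset V} (hA : A.Nonempty)
    (h : A ⊆ B) : meanSup μ A ≤ meanSup μ B := by
  refine integral_mono (integrable_ciSup_finset μ hA) (integrable_ciSup_finset μ (hA.mono h))
    fun x => ?_
  have : Nonempty A := hA.to_subtype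
  exact ciSup_le fun s => le_ciSup (f := fun s : B => x s) (Finite.bddAbove_range _) ⟨s, h s.2⟩

lemma meanSup_nonneg {μ : Measure (V → ℝ)} [IsGaussian μ] (hμ : ∀ i, ∫ x : V → ℝ, x i ∂μ = 0)
    {A : Finset V} (hA : A.Nonempty) : 0 ≤ meanSup μ A := by
  obtain ⟨s, hs⟩ := hA
  rw [← hμ s]
  exact integral_mono (IsGaussian.integrable_eval μ s) (integrable_ciSup_finset μ ⟨s, hs⟩)
    fun x => le_ciSup (f := fun s : A => x s) (Finite.bddAbove_range _) ⟨s, hs⟩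

lemma hasGaussianLaw_pi_eval {I : Type*} [Fintype I] {E : Type*} [NormedAddCommGroup E]
    [NormedSpace ℝ E] [MeasurableSpace E] [BorelSpace E] [CompleteSpace E]
    [SecondCountableTopology E] (μ : Measure E) [IsGaussian μ] :
    HasGaussianLaw (fun (x : I → E) (i : I) => x i) (Measure.pi fun _ : I => μ) := by
  refine iIndepFun.hasGaussianLaw (X := fun (i : I) (x : I → E) => x i) (fun i => ⟨?_⟩)
    (iIndepFun_pi (μ := fun _ : I => μ) (X := fun _ x => x) fun _ => aemeasurable_id)
  rw [(measurePreserving_eval (fun _ : I => μ) i).map_eq]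
  infer_instance

/-- **Talagrand's growth condition** for the expected supremum of a Gaussian process. -/
theorem le_meanSup_of_separated [PseudoMetricSpace V] {μ : Measure (V → ℝ)} [IsGaussian μ]
    (hμ : ∀ i, ∫ x : V → ℝ, x i ∂μ = 0)
    (hd : ∀ i j, ∫ x : V → ℝ, (x i - x j) ^ 2 ∂μ = dist i j ^ 2)
    {I : Type*} [Fintype I] [Nonempty I] {a B : ℝ} (ha : 0 ≤ a) {t : I → V}
    (ht : ∀ i j, i ≠ j → a ≤ dist (t i) (t j)) {A : I → Finset V} (hA : ∀ i, (A i).Nonempty)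
    (hAt : ∀ i, ∀ s ∈ A i, dist s (t i) ≤ a / 8) {C : Finset V} (hAC : ∀ i, A i ⊆ C)
    (hB : ∀ i, B ≤ meanSup μ (A i)) :
    a / 8 * (Real.sqrt (Real.log (Fintype.card I)) / 2 - 2) + B ≤ meanSup μ C := by
  classical
  set b := a / 8 with hb
  have hb0 : 0 ≤ b := by positivity
  let ι := Σ i, A i
  have hι : Nonempty ι := by
    obtain ⟨i₀⟩ := ‹Nonempty I›
    obtain ⟨s, hs⟩ := hA i₀
    exact ⟨⟨i₀, s, hs⟩⟩
  set γ := gaussianReal 0 1 with hγ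
  set μI := Measure.pi fun _ : I => μ with hμI
  set γI := Measure.pi fun _ : I => γ with hγI
  have pμ : IsProbabilityMeasure μI := by rw [hμI]; infer_instance
  have pγ : IsProbabilityMeasure γI := by rw [hγI]; infer_instance
  have fμ : IsFiniteMeasure μI := ⟨by rw [pμ.measure_univ]; exact ENNReal.one_lt_top⟩
  have σμ : SigmaFinite μI := IsFiniteMeasure.toSigmaFinite μI
  -- The comparison process: for each `i` an independent copy of the process, recentered at `t i`,
  -- plus an independent Gaussian of standard deviation `b = a / 8`. Its increments are dominated by
  -- those of the original.
  let Y : (I → V → ℝ) × (I → ℝ) → ι → ℝ := fun w p =>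
    w.1 p.1 p.2 - w.1 p.1 (t p.1) + b * w.2 p.1
  let L : ((I → V → ℝ) × (I → ℝ)) →L[ℝ] (ι → ℝ) :=
    { toFun := Y
      map_add' := fun v w => by
        ext p; simp only [Y, Prod.fst_add, Prod.snd_add, Pi.add_apply]; ring
      map_smul' := fun c v => by
        ext p
        simp only [Y, Prod.smul_fst, Prod.smul_snd, Pi.smul_apply, smul_eq_mul, RingHom.id_apply]
        ring
      cont := by fun_prop }
  have g1 : IsGaussian μI := by
    have := (hasGaussianLaw_pi_eval (I := I) μ).isGaussian_map
    simpa using this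
  have g2 : IsGaussian γI := by
    have := (hasGaussianLaw_pi_eval (I := I) γ).isGaussian_map
    simpa using this
  set ν := (μI.prod γI).map L with hν
  have g3 : IsGaussian ν := inferInstance
  have hνint : ∀ f : (ι → ℝ) → ℝ, Measurable f → ∫ y, f y ∂ν = ∫ w, f (Y w) ∂(μI.prod γI) :=
    fun f hf => integral_map L.continuous.aemeasurable hf.aestronglyMeasurable
  let X' : (V → ℝ) →L[ℝ] (ι → ℝ) :=
    ContinuousLinearMap.pi fun p : ι => ContinuousLinearMap.proj (p.2 : V)
  set ρ := μ.map X' with hρ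
  have g4 : IsGaussian ρ := inferInstance
  have hρint : ∀ f : (ι → ℝ) → ℝ, Measurable f → ∫ y, f y ∂ρ = ∫ x, f (fun p => x p.2) ∂μ :=
    fun f hf => integral_map X'.continuous.aemeasurable hf.aestronglyMeasurable
  have hγ1 : Integrable (fun x : ℝ => x) γ :=
    (memLp_id_gaussianReal (μ := 0) (v := 1) 1).integrable le_rfl
  have hγ2 : Integrable (fun x : ℝ => x ^ 2) γ :=
    (memLp_id_gaussianReal (μ := 0) (v := 1) 2).integrable_sq
  have hγv : ∫ x, x ^ 2 ∂γ = 1 := by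
    have := variance_id_gaussianReal (μ := 0) (v := 1)
    rw [variance_eq_integral measurable_id.aemeasurable] at this
    simpa [integral_id_gaussianReal] using this
  have ev1 : ∀ (i : I) (f : (V → ℝ) → ℝ), Integrable f μ →
      Integrable (fun w : (I → V → ℝ) × (I → ℝ) => f (w.1 i)) (μI.prod γI) := fun i f hf =>
    (hf.comp_measurePreserving (measurePreserving_eval (fun _ : I => μ) i)).comp_fst γI
  have ev1' : ∀ (i : I) (f : (V → ℝ) → ℝ), Integrable f μ →
      ∫ w : (I → V → ℝ) × (I → ℝ), f (w.1 i) ∂(μI.prod γI) = ∫ x, f x ∂μ := fun i f hf => by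
    rw [integral_fun_fst (f := fun w : I → V → ℝ => f (w i)), probReal_univ, one_smul]
    exact integral_comp_eval (μ := fun _ : I => μ) hf.aestronglyMeasurable
  have ev2 : ∀ (i : I) (f : ℝ → ℝ), Integrable f γ →
      Integrable (fun w : (I → V → ℝ) × (I → ℝ) => f (w.2 i)) (μI.prod γI) := fun i f hf =>
    (hf.comp_measurePreserving (measurePreserving_eval (fun _ : I => γ) i)).comp_snd μI
  have ev2' : ∀ (i : I) (f : ℝ → ℝ), Integrable f γ →
      ∫ w : (I → V → ℝ) × (I → ℝ), f (w.2 i) ∂(μI.prod γI) = ∫ x, f x ∂γ := fun i f hf => by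
    rw [integral_fun_snd (f := fun w : I → ℝ => f (w i)), probReal_univ, one_smul]
    exact integral_comp_eval (μ := fun _ : I => γ) hf.aestronglyMeasurable
  have hsub : ∀ u v : V, Integrable (fun x : V → ℝ => x u - x v) μ := fun u v =>
    (IsGaussian.integrable_eval μ u).sub (IsGaussian.integrable_eval μ v)
  have hsub0 : ∀ u v : V, ∫ x : V → ℝ, x u - x v ∂μ = 0 := fun u v => by
    rw [integral_sub (IsGaussian.integrable_eval μ u) (IsGaussian.integrable_eval μ v), hμ, hμ,
      sub_zero]
  have hν0 : ∀ p : ι, ∫ y : ι → ℝ, y p ∂ν = 0 := by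
    intro p
    rw [hνint _ (measurable_pi_apply p)]
    simp only [Y]
    rw [integral_add (ev1 p.1 (fun x => x p.2 - x (t p.1)) (hsub _ _))
      ((ev2 p.1 (fun x => x) hγ1).const_mul b), integral_const_mul,
      ev1' p.1 (fun x => x p.2 - x (t p.1)) (hsub _ _), ev2' p.1 (fun x => x) hγ1, hsub0,
      hγ, integral_id_gaussianReal]
    simp
  have hρ0 : ∀ p : ι, ∫ y : ι → ℝ, y p ∂ρ = 0 := by
    intro p
    rw [hρint _ (measurable_pi_apply p)]
    exact hμ _
  have hinc : ∀ p q : ι, ∫ y : ι → ℝ, (y p - y q) ^ 2 ∂ν ≤ ∫ y : ι → ℝ, (y p - y q) ^ 2 ∂ρ := by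
    rintro ⟨i, s, hs⟩ ⟨j, s', hs'⟩
    rw [hνint (fun y => (y ⟨i, s, hs⟩ - y ⟨j, s', hs'⟩) ^ 2) (by fun_prop),
      hρint (fun y => (y ⟨i, s, hs⟩ - y ⟨j, s', hs'⟩) ^ 2) (by fun_prop)]
    simp only [Y]
    rw [hd]
    by_cases hij : i = j
    · subst hij
      have : ∀ w : (I → V → ℝ) × (I → ℝ), (w.1 i s - w.1 i (t i) + b * w.2 i -
          (w.1 i s' - w.1 i (t i) + b * w.2 i)) ^ 2 = (w.1 i s - w.1 i s') ^ 2 := by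
        intro w; ring
      simp_rw [this]
      rw [ev1' i (fun x => (x s - x s') ^ 2) (IsGaussian.integrable_eval_sub_sq μ s s'), hd]
    · have i1 := ev1 i (fun x => (x s - x (t i)) ^ 2) (IsGaussian.integrable_eval_sub_sq μ s (t i))
      have i2 := ev1 j (fun x => (x s' - x (t j)) ^ 2)
        (IsGaussian.integrable_eval_sub_sq μ s' (t j))
      have i3 := ev2 i (fun x => x ^ 2) hγ2
      have i4 := ev2 j (fun x => x ^ 2) hγ2
      have i12 : Integrable (fun w : (I → V → ℝ) × (I → ℝ) => 3 * (w.1 i s - w.1 i (t i)) ^ 2 +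
          3 * (w.1 j s' - w.1 j (t j)) ^ 2) (μI.prod γI) := (i1.const_mul 3).add (i2.const_mul 3)
      have i34 : Integrable (fun w : (I → V → ℝ) × (I → ℝ) =>
          6 * b ^ 2 * (w.2 i) ^ 2 + 6 * b ^ 2 * (w.2 j) ^ 2) (μI.prod γI) :=
        (i3.const_mul _).add (i4.const_mul _)
      -- The pointwise bound `(α - β + γ)² ≤ 3 (α² + β² + γ²)` avoids computing cross terms. It
      -- gives at most `18 b²`, against `d(s, s')² ≥ (8b - 2b)² = 36 b²`.
      calc _ ≤ ∫ w : (I → V → ℝ) × (I → ℝ), (3 * (w.1 i s - w.1 i (t i)) ^ 2 +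
              3 * (w.1 j s' - w.1 j (t j)) ^ 2) +
              (6 * b ^ 2 * (w.2 i) ^ 2 + 6 * b ^ 2 * (w.2 j) ^ 2) ∂(μI.prod γI) := by
            refine integral_mono_of_nonneg (ae_of_all _ fun w => sq_nonneg _)
              (i12.add i34) (ae_of_all _ fun w => ?_)
            simp only
            nlinarith [sq_nonneg ((w.1 i s - w.1 i (t i)) + (w.1 j s' - w.1 j (t j))),
              sq_nonneg ((w.1 i s - w.1 i (t i)) - b * (w.2 i - w.2 j)),
              sq_nonneg ((w.1 j s' - w.1 j (t j)) + b * (w.2 i - w.2 j)),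
              sq_nonneg (b * (w.2 i + w.2 j))]
        _ = 3 * dist s (t i) ^ 2 + 3 * dist s' (t j) ^ 2 + 12 * b ^ 2 := by
            rw [integral_add i12 i34,
              integral_add (i1.const_mul 3) (i2.const_mul 3),
              integral_add (i3.const_mul _) (i4.const_mul _), integral_const_mul,
              integral_const_mul, integral_const_mul, integral_const_mul,
              ev1' i (fun x => (x s - x (t i)) ^ 2) (IsGaussian.integrable_eval_sub_sq μ s (t i)),
              ev1' j (fun x => (x s' - x (t j)) ^ 2) (IsGaussian.integrable_eval_sub_sq μ s' (t j)),
              ev2' i (fun x => x ^ 2) hγ2, ev2' j (fun x => x ^ 2) hγ2, hd, hd, hγv]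
            ring
        _ ≤ dist s s' ^ 2 := by
            have e1 := hAt i s hs
            have e2 := hAt j s' hs'
            have e3 := ht i j hij
            have e4 : dist (t i) (t j) ≤ dist s (t i) + dist s s' + dist s' (t j) := by
              have := dist_triangle4 (t i) s s' (t j)
              rwa [dist_comm (t i) s] at this
            have e5 : 6 * b ≤ dist s s' := by linarith
            have n1 := dist_nonneg (x := s) (y := t i)
            have n2 := dist_nonneg (x := s') (y := t j)
            nlinarith
  have hSF := integral_ciSup_le_of_increments_le (μ := ρ) (ν := ν) hρ0 hν0 hinc
  rw [hνint _ measurable_ciSup_pi, hρint _ measurable_ciSup_pi] at hSF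
  have hup : ∫ x : V → ℝ, ⨆ p : ι, x p.2 ∂μ ≤ meanSup μ C := by
    have hC : C.Nonempty := by
      obtain ⟨p⟩ := hι
      exact ⟨p.2, hAC p.1 p.2.2⟩
    refine integral_mono ?_ (integrable_ciSup_finset μ hC) fun x =>
      ciSup_le fun p => le_ciSup (f := fun s : C => x s) (Finite.bddAbove_range _)
        ⟨p.2, hAC p.1 p.2.2⟩
    exact (IsGaussian.integrable_ciSup ρ).comp_aemeasurable X'.continuous.aemeasurable
  have hYint : Integrable (fun w => ⨆ p : ι, Y w p) (μI.prod γI) :=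
    (IsGaussian.integrable_ciSup ν).comp_aemeasurable L.continuous.aemeasurable
  have hgi : Integrable (fun g : I → ℝ => ⨆ i, g i) γI := integrable_ciSup_pi_gaussian
  -- Condition on `g` and keep only an index `i` where `g` is maximal: the supremum over the copy on
  -- `A i` contributes at least `B` in mean, the recentering term has mean zero, and `b * g i` is
  -- `b` times the maximum.
  have hlow : b * (∫ g : I → ℝ, ⨆ i, g i ∂γI) + B ≤ ∫ w, ⨆ p : ι, Y w p ∂(μI.prod γI) := by
    rw [integral_prod_symm _ hYint]
    have : ∫ g : I → ℝ, b * (⨆ i, g i) + B ∂γI ≤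
        ∫ g, ∫ x, ⨆ p : ι, Y (x, g) p ∂μI ∂γI := by
      refine integral_mono_ae ((hgi.const_mul b).add (integrable_const B))
        hYint.integral_prod_right ?_
      filter_upwards [hYint.prod_left_ae] with g hg
      obtain ⟨i, hi⟩ := exists_eq_ciSup_of_finite (f := g)
      have hAi : Nonempty (A i) := (hA i).to_subtype
      have j1 : Integrable (fun x : I → V → ℝ => ⨆ s : A i, x i s) μI :=
        (integrable_ciSup_finset μ (hA i)).comp_measurePreserving
        (measurePreserving_eval (fun _ : I => μ) i)
      have j2 : Integrable (fun x : I → V → ℝ => x i (t i)) μI :=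
        (IsGaussian.integrable_eval μ (t i)).comp_measurePreserving
        (measurePreserving_eval (fun _ : I => μ) i)
      have j12 : Integrable (fun x : I → V → ℝ => (⨆ s : A i, x i s) - x i (t i)) μI := j1.sub j2
      have j3 : ∫ x : I → V → ℝ, ⨆ s : A i, x i s ∂μI = meanSup μ (A i) :=
        integral_comp_eval (μ := fun _ : I => μ) (f := fun x : V → ℝ => ⨆ s : A i, x s)
          (integrable_ciSup_finset μ (hA i)).aestronglyMeasurable
      have j4 : ∫ x : I → V → ℝ, x i (t i) ∂μI = 0 := by
        rw [← hμ (t i)]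
        exact integral_comp_eval (μ := fun _ : I => μ) (f := fun x : V → ℝ => x (t i))
          (IsGaussian.integrable_eval μ (t i)).aestronglyMeasurable
      calc b * (⨆ i, g i) + B ≤ meanSup μ (A i) - 0 + b * g i := by
            rw [hi]; linarith [hB i]
        _ = ∫ x : I → V → ℝ, ((⨆ s : A i, x i s) - x i (t i)) + b * g i ∂μI := by
            rw [integral_add j12 (integrable_const _)]
            simp only [integral_const, probReal_univ, one_smul]
            rw [← j3, ← j4, integral_sub j1 j2]
        _ ≤ _ := by
            refine integral_mono (j12.add (integrable_const _)) hg fun x => ?_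
            have : (⨆ s : A i, x i s) ≤ (⨆ p : ι, Y (x, g) p) + x i (t i) - b * g i := by
              refine ciSup_le fun s => ?_
              have := le_ciSup (Finite.bddAbove_range (Y (x, g))) (⟨i, s⟩ : ι)
              simp only [Y] at this ⊢
              linarith
            linarith
    refine le_trans (le_of_eq ?_) this
    rw [integral_add (hgi.const_mul b) (integrable_const B), integral_const_mul]
    simp
  have hmax := mul_le_mul_of_nonneg_left (le_integral_ciSup_pi_gaussian (I := I)) hb0
  linarith

end Growth

/-! ### Greedy partitions and the induction over scales -/

section Partition

variable {V : Type*} [PseudoMetricSpace V]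

/-- Greedy partition of `C` into pieces of radius `a` around separated centers, each center
maximizing `F` on the balls of radius `b` in what remains. -/
lemma exists_greedy_partition [DecidableEq V] {F : Finset V → ℝ}
    (hF : ∀ A B : Finset V, A.Nonempty → A ⊆ B → F A ≤ F B) {a b : ℝ} (hb : 0 ≤ b) (hba : b ≤ a)
    {C : Finset V} (hC : C.Nonempty) :
    ∃ (m : ℕ) (t : ℕ → V) (A : ℕ → Finset V), (∀ i < m, t i ∈ A i) ∧ (∀ i, A i ⊆ C) ∧
      (∀ i < m, ∀ s ∈ A i, dist s (t i) ≤ a) ∧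
      (∀ i j, i < j → j < m → a < dist (t i) (t j)) ∧
      (∀ i j, i < j → Disjoint (A i) (A j)) ∧ C = (Finset.range m).biUnion A ∧
      ∀ i j, i ≤ j → j < m → ∀ s ∈ A j,
        F {u ∈ A j | dist u s ≤ b} ≤ F {u ∈ A i | dist u (t i) ≤ b} := by
  have hpick : ∀ D : Finset V, ∃ t : V, D.Nonempty → t ∈ D ∧
      ∀ s ∈ D, F {u ∈ D | dist u s ≤ b} ≤ F {u ∈ D | dist u t ≤ b} := by
    intro D
    rcases D.eq_empty_or_nonempty with rfl | hD
    · exact ⟨hC.choose, fun h => absurd h (by simp)⟩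
    · obtain ⟨t, ht, hmax⟩ := D.exists_max_image (fun s => F {u ∈ D | dist u s ≤ b}) hD
      exact ⟨t, fun _ => ⟨ht, hmax⟩⟩
  choose pick hpick using hpick
  -- Each step removes the ball of radius `a` around the picked center. The center itself is
  -- removed, so the cardinality drops and the procedure stops.
  let step : Finset V → Finset V := fun D => {s ∈ D | a < dist s (pick D)}
  let D : ℕ → Finset V := fun n => step^[n] C
  have hD0 : D 0 = C := rfl
  have hDs : ∀ n, D (n + 1) = {s ∈ D n | a < dist s (pick (D n))} := fun n => by
    simp only [D, Function.iterate_succ_apply']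
    rfl
  have hDanti : Antitone D := antitone_nat_of_succ_le fun n => by
    rw [hDs]; exact Finset.filter_subset _ _
  have hex : ∃ n, D n = ∅ := by
    by_contra! hne
    have : ∀ n, (D n).card + n ≤ C.card := by
      intro n
      induction n with
      | zero => simp [hD0]
      | succ n ih =>
        have hlt : (D (n + 1)).card < (D n).card := by
          refine Finset.card_lt_card ?_
          rw [hDs, Finset.filter_ssubset]
          have h1 := (hpick _ (hne n)).1
          exact ⟨_, h1, by simp; linarith⟩
        omega
    have := this (C.card + 1)
    omega
  let m := Nat.find hex
  have hDm : D m = ∅ := Nat.find_spec hex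
  have hDne : ∀ i < m, (D i).Nonempty := fun i hi =>
    Finset.nonempty_iff_ne_empty.2 (Nat.find_min hex hi)
  let A : ℕ → Finset V := fun n => {s ∈ D n | dist s (pick (D n)) ≤ a}
  have hAD : ∀ i, A i ⊆ D i := fun i => Finset.filter_subset _ _
  have hDA : ∀ i j, i < j → ∀ s ∈ D j, a < dist s (pick (D i)) := fun i j hij s hs => by
    have := hDanti (Nat.succ_le_of_lt hij) hs
    rw [Nat.succ_eq_add_one, hDs] at this
    exact (Finset.mem_filter.1 this).2
  refine ⟨m, fun i => pick (D i), A, ?_, ?_, ?_, ?_, ?_, ?_, ?_⟩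
  · intro i hi
    exact Finset.mem_filter.2 ⟨(hpick _ (hDne i hi)).1, by simp; linarith⟩
  · exact fun i => (hAD i).trans (hDanti (Nat.zero_le i))
  · exact fun i _ s hs => (Finset.mem_filter.1 hs).2
  · intro i j hij hj
    rw [dist_comm]
    exact hDA i j hij _ (hpick _ (hDne j hj)).1
  · intro i j hij
    rw [Finset.disjoint_left]
    intro s hs hs'
    have h1 := (Finset.mem_filter.1 hs).2
    have h2 := hDA i j hij s (hAD j hs')
    linarith
  · ext s
    rw [Finset.mem_biUnion]
    constructor
    · intro hs
      have : ∀ n, s ∈ D n ∨ ∃ i ∈ Finset.range n, s ∈ A i := by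
        intro n
        induction n with
        | zero => exact Or.inl hs
        | succ n ih =>
          rcases ih with h | ⟨i, hi, h⟩
          · rcases le_or_gt (dist s (pick (D n))) a with h' | h'
            · exact Or.inr ⟨n, by simp, Finset.mem_filter.2 ⟨h, h'⟩⟩
            · left
              rw [hDs]
              exact Finset.mem_filter.2 ⟨h, h'⟩
          · exact Or.inr ⟨i, by simp at hi ⊢; omega, h⟩
      rcases this m with h | h
      · rw [hDm] at h; simp at h
      · exact h
    · rintro ⟨i, _, hs⟩
      exact hDanti (Nat.zero_le i) (hAD i hs)
  · intro i j hij hj s hs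
    have hsj := hAD j hs
    have hi := hpick _ (hDne i (hij.trans_lt hj))
    -- Since `b ≤ a`, passing from the remainder `D i` to the piece `A i` loses nothing of the ball
    -- of radius `b`, so the maximality of the center over `D i` compares it with every later piece.
    have e : ({u ∈ A i | dist u (pick (D i)) ≤ b} : Finset V) =
        {u ∈ D i | dist u (pick (D i)) ≤ b} := by
      ext u
      simp only [A, Finset.mem_filter]
      constructor
      · exact fun h => ⟨h.1.1, h.2⟩
      · exact fun h => ⟨⟨h.1, h.2.trans hba⟩, h.2⟩
    rw [e]
    refine le_trans (hF _ {u ∈ D i | dist u s ≤ b} ⟨s, ?_⟩ ?_) (hi.2 s (hDanti hij hsj))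
    · simp [hs, hb]
    · exact Finset.filter_subset_filter _ ((hAD j).trans (hDanti hij))

/-- The growth condition for a monotone functional on finite sets. -/
structure HasGrowth (F : Finset V → ℝ) : Prop where
  mono : ∀ A B : Finset V, A.Nonempty → A ⊆ B → F A ≤ F B
  nonneg : ∀ A : Finset V, A.Nonempty → 0 ≤ F A
  growth : ∀ (n : ℕ) (a B : ℝ) (t : Fin (n + 1) → V) (A : Fin (n + 1) → Finset V) (C : Finset V),
    0 ≤ a → (∀ i j, i ≠ j → a ≤ dist (t i) (t j)) → (∀ i, (A i).Nonempty) →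
    (∀ i, ∀ s ∈ A i, dist s (t i) ≤ a / 8) → (∀ i, A i ⊆ C) → (∀ i, B ≤ F (A i)) →
    a / 8 * (Real.sqrt (Real.log ((n : ℝ) + 1)) / 2 - 2) + B ≤ F C

/-- Either `W / p ≤ (i + 1)⁴`, and the logarithm is at most `4 log (i + 1)`; or the piece is so
light that `log x ≤ x` gives `√(p W) ≤ W / (i + 1)²`, which is summable. The entropy of a piece is
thus measured by its rank in the greedy order. -/
lemma mul_sqrt_log_inv_le {p W : ℝ} (hp : 0 < p) (hpW : p ≤ W) (i : ℕ) :
    p * Real.sqrt (Real.log (W / p)) ≤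
      2 * p * Real.sqrt (Real.log ((i : ℝ) + 1)) + W * (1 / ((i : ℝ) + 1) ^ 2) := by
  have hW : 0 < W := hp.trans_le hpW
  set k : ℝ := (i : ℝ) + 1 with hk
  have hk1 : 1 ≤ k := by simp [hk]
  have hk0 : 0 < k := by linarith
  rcases le_total (W / p) (k ^ 4) with h | h
  · have h1 : Real.log (W / p) ≤ 2 ^ 2 * Real.log k := by
      calc _ ≤ Real.log (k ^ 4) := Real.log_le_log (by positivity) h
        _ = _ := by rw [Real.log_pow]; norm_num
    have h2 : Real.sqrt (Real.log (W / p)) ≤ 2 * Real.sqrt (Real.log k) := by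
      calc _ ≤ Real.sqrt (2 ^ 2 * Real.log k) := Real.sqrt_le_sqrt h1
        _ = _ := by rw [Real.sqrt_mul (by norm_num), Real.sqrt_sq (by norm_num)]
    have h3 : 0 ≤ W * (1 / k ^ 2) := by positivity
    nlinarith
  · have h1 : Real.log (W / p) ≤ W / p := (Real.log_le_sub_one_of_pos (by positivity)).trans
      (by linarith)
    have h2 : p * Real.sqrt (Real.log (W / p)) ≤ W * (1 / k ^ 2) := by
      calc _ ≤ p * Real.sqrt (W / p) :=
            mul_le_mul_of_nonneg_left (Real.sqrt_le_sqrt h1) hp.le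
        _ ≤ W * (1 / k ^ 2) := by
            refine (sq_le_sq₀ (by positivity) (by positivity)).1 ?_
            rw [mul_pow, Real.sq_sqrt (by positivity), mul_pow, div_pow, ← pow_mul]
            have h3 : p * k ^ 4 ≤ W := by
              rw [le_div_iff₀ hp] at h; linarith
            have : p ^ 2 * (W / p) = p * W := by field_simp
            rw [this]
            rw [one_pow, ← mul_div_assoc, mul_one, le_div_iff₀ (by positivity)]
            calc p * W * k ^ (2 * 2) = W * (p * k ^ 4) := by ring
              _ ≤ W * W := mul_le_mul_of_nonneg_left h3 hW.le
              _ = W ^ 2 := (sq W).symm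
    have h3 : 0 ≤ 2 * p * Real.sqrt (Real.log k) := by positivity
    linarith

lemma sum_one_div_sq_le (m : ℕ) : ∑ i ∈ Finset.range m, 1 / ((i : ℝ) + 1) ^ 2 ≤ 2 := by
  have h : ∀ m : ℕ, ∑ i ∈ Finset.range (m + 1), 1 / ((i : ℝ) + 1) ^ 2 ≤ 2 - 1 / ((m : ℝ) + 1) := by
    intro m
    induction m with
    | zero => norm_num
    | succ m ih =>
      rw [Finset.sum_range_succ]
      have : 1 / (((m + 1 : ℕ) : ℝ) + 1) ^ 2 ≤ 1 / ((m : ℝ) + 1) - 1 / (((m + 1 : ℕ) : ℝ) + 1) := by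
        push_cast
        rw [div_sub_div _ _ (by positivity) (by positivity),
          div_le_div_iff₀ (by positivity) (by positivity)]
        nlinarith
      linarith
  rcases m with _ | m
  · simp
  · have := h m
    have : 0 ≤ 1 / ((m : ℝ) + 1) := by positivity
    linarith [h m]

/-- The integral `∫_0^r √(log (W(C) / W(C ∩ B(t, ε)))) dε` for weights `w` with `W(A) = ∑ t ∈ A, w t`. -/
noncomputable def ballEntropy (w : V → ℝ) (C : Finset V) (r : ℝ) (t : V) : ℝ≥0∞ :=
  ∫⁻ ε in Set.Ioc 0 r, ENNReal.ofReal
    (Real.sqrt (Real.log ((∑ s ∈ C, w s) / ∑ s ∈ C with dist s t ≤ ε, w s)))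

lemma ballEntropy_eq_zero {w : V → ℝ} {C : Finset V} (hw : ∀ s ∈ C, 0 < w s) {r : ℝ} {t : V}
    (h : ∀ ε, 0 < ε → ε ≤ r → ∀ s ∈ C, dist s t ≤ ε) (hC : C.Nonempty) :
    ballEntropy w C r t = 0 := by
  unfold ballEntropy
  rw [setLIntegral_congr_fun (g := fun _ => 0) measurableSet_Ioc, lintegral_zero]
  intro ε hε
  have : ({s ∈ C | dist s t ≤ ε} : Finset V) = C := Finset.filter_true_of_mem (h ε hε.1 hε.2)
  have hpos : 0 < ∑ s ∈ C, w s := Finset.sum_pos hw hC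
  simp only
  rw [this, div_self hpos.ne']
  simp

/-- Comparing the entropy integral on a set with the one on a piece of small diameter. -/
lemma ballEntropy_le_add {w : V → ℝ} {C A : Finset V} (hw : ∀ s ∈ C, 0 < w s) (hA : A ⊆ C)
    {r r' : ℝ} (hr' : 0 ≤ r') (hrr : r' ≤ r) {t : V} (ht : t ∈ A) (hAt : ∀ s ∈ A, dist s t ≤ r') :
    ballEntropy w C r t ≤ ballEntropy w A r' t +
      ENNReal.ofReal (r * Real.sqrt (Real.log ((∑ s ∈ C, w s) / ∑ s ∈ A, w s))) := by
  set L := Real.sqrt (Real.log ((∑ s ∈ C, w s) / ∑ s ∈ A, w s)) with hL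
  have hWA : 0 < ∑ s ∈ A, w s := Finset.sum_pos (fun s hs => hw s (hA hs)) ⟨t, ht⟩
  have hWC : 0 < ∑ s ∈ C, w s := Finset.sum_pos hw ⟨t, hA ht⟩
  have hWAC : ∑ s ∈ A, w s ≤ ∑ s ∈ C, w s :=
    Finset.sum_le_sum_of_subset_of_nonneg hA fun s hs _ => (hw s hs).le
  -- Beyond `r'` the ball contains all of `A`, so only the mass ratio of `A` in `C` matters.
  have hbig : ∀ ε, r' < ε → Real.sqrt (Real.log ((∑ s ∈ C, w s) / ∑ s ∈ C with dist s t ≤ ε, w s))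
      ≤ L := by
    intro ε hε
    have hsub : A ⊆ {s ∈ C | dist s t ≤ ε} := fun s hs =>
      Finset.mem_filter.2 ⟨hA hs, (hAt s hs).trans hε.le⟩
    have h1 : ∑ s ∈ A, w s ≤ ∑ s ∈ C with dist s t ≤ ε, w s :=
      Finset.sum_le_sum_of_subset_of_nonneg hsub fun s hs _ => (hw s (Finset.mem_filter.1 hs).1).le
    refine Real.sqrt_le_sqrt (Real.log_le_log (div_pos hWC (hWA.trans_le h1)) ?_)
    exact div_le_div_of_nonneg_left hWC.le hWA h1
  -- Below `r'` the mass ratio in `C` is at most the ratio in `A` times that of `A` in `C`; the root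
  -- of the sum of logarithms is subadditive.
  have hsmall : ∀ ε, 0 < ε →
      Real.sqrt (Real.log ((∑ s ∈ C, w s) / ∑ s ∈ C with dist s t ≤ ε, w s)) ≤
      Real.sqrt (Real.log ((∑ s ∈ A, w s) / ∑ s ∈ A with dist s t ≤ ε, w s)) + L := by
    intro ε hε
    have hsub : ({s ∈ A | dist s t ≤ ε} : Finset V) ⊆ {s ∈ C | dist s t ≤ ε} :=
      Finset.filter_subset_filter _ hA
    have htm : t ∈ ({s ∈ A | dist s t ≤ ε} : Finset V) := by simp [ht, hε.le]
    have h0 : 0 < ∑ s ∈ A with dist s t ≤ ε, w s :=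
      Finset.sum_pos (fun s hs => hw s (hA (Finset.mem_filter.1 hs).1)) ⟨t, htm⟩
    have h1 : ∑ s ∈ A with dist s t ≤ ε, w s ≤ ∑ s ∈ C with dist s t ≤ ε, w s :=
      Finset.sum_le_sum_of_subset_of_nonneg hsub fun s hs _ => (hw s (Finset.mem_filter.1 hs).1).le
    have h2 : ∑ s ∈ A with dist s t ≤ ε, w s ≤ ∑ s ∈ A, w s :=
      Finset.sum_le_sum_of_subset_of_nonneg (Finset.filter_subset _ _)
        fun s hs _ => (hw s (hA hs)).le
    have n1 : 0 ≤ Real.log ((∑ s ∈ A, w s) / ∑ s ∈ A with dist s t ≤ ε, w s) :=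
      Real.log_nonneg ((one_le_div h0).2 h2)
    have n2 : 0 ≤ Real.log ((∑ s ∈ C, w s) / ∑ s ∈ A, w s) :=
      Real.log_nonneg ((one_le_div hWA).2 hWAC)
    have h3 : Real.log ((∑ s ∈ C, w s) / ∑ s ∈ C with dist s t ≤ ε, w s) ≤
        Real.log ((∑ s ∈ A, w s) / ∑ s ∈ A with dist s t ≤ ε, w s) +
        Real.log ((∑ s ∈ C, w s) / ∑ s ∈ A, w s) := by
      rw [← Real.log_mul (div_pos hWA h0).ne' (div_pos hWC hWA).ne']
      refine Real.log_le_log (div_pos hWC (h0.trans_le h1)) ?_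
      have : (∑ s ∈ A, w s) / (∑ s ∈ A with dist s t ≤ ε, w s) * ((∑ s ∈ C, w s) / ∑ s ∈ A, w s) =
          (∑ s ∈ C, w s) / (∑ s ∈ A with dist s t ≤ ε, w s) := by field_simp
      rw [this]
      exact div_le_div_of_nonneg_left hWC.le h0 h1
    refine (Real.sqrt_le_sqrt h3).trans ?_
    rw [hL, Real.sqrt_le_left (by positivity)]
    nlinarith [Real.sq_sqrt n1, Real.sq_sqrt n2, Real.sqrt_nonneg
      (Real.log ((∑ s ∈ A, w s) / ∑ s ∈ A with dist s t ≤ ε, w s)),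
      Real.sqrt_nonneg (Real.log ((∑ s ∈ C, w s) / ∑ s ∈ A, w s))]
  have hL0 : 0 ≤ L := Real.sqrt_nonneg _
  unfold ballEntropy
  rw [← Set.Ioc_union_Ioc_eq_Ioc hr' hrr]
  refine (lintegral_union_le _ _ _).trans ?_
  have e1 : ∫⁻ ε in Set.Ioc 0 r', ENNReal.ofReal
      (Real.sqrt (Real.log ((∑ s ∈ C, w s) / ∑ s ∈ C with dist s t ≤ ε, w s))) ≤
      (∫⁻ ε in Set.Ioc 0 r', ENNReal.ofReal
        (Real.sqrt (Real.log ((∑ s ∈ A, w s) / ∑ s ∈ A with dist s t ≤ ε, w s)))) +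
        ENNReal.ofReal (r' * L) := by
    calc _ ≤ ∫⁻ ε in Set.Ioc 0 r', (ENNReal.ofReal
          (Real.sqrt (Real.log ((∑ s ∈ A, w s) / ∑ s ∈ A with dist s t ≤ ε, w s))) +
          ENNReal.ofReal L) := by
          refine setLIntegral_mono' measurableSet_Ioc fun ε hε => ?_
          rw [← ENNReal.ofReal_add (Real.sqrt_nonneg _) hL0]
          exact ENNReal.ofReal_le_ofReal (hsmall ε hε.1)
      _ = _ := by
          rw [lintegral_add_right _ measurable_const]
          congr 1
          rw [setLIntegral_const, Real.volume_Ioc, sub_zero, mul_comm, ENNReal.ofReal_mul hr']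
  have e2 : ∫⁻ ε in Set.Ioc r' r, ENNReal.ofReal
      (Real.sqrt (Real.log ((∑ s ∈ C, w s) / ∑ s ∈ C with dist s t ≤ ε, w s))) ≤
      ENNReal.ofReal ((r - r') * L) := by
    calc _ ≤ ∫⁻ ε in Set.Ioc r' r, ENNReal.ofReal L :=
          setLIntegral_mono' measurableSet_Ioc fun ε hε =>
            ENNReal.ofReal_le_ofReal (hbig ε hε.1)
      _ = _ := by
          rw [setLIntegral_const, Real.volume_Ioc, mul_comm, ENNReal.ofReal_mul (by linarith)]
  refine (add_le_add e1 e2).trans (le_of_eq ?_)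
  rw [add_assoc, ← ENNReal.ofReal_add (by positivity) (mul_nonneg (by linarith) hL0)]
  congr 2
  ring

/-- The induction over scales behind the majorizing measure lower bound. -/
lemma sum_ballEntropy_le_of_radius {F : Finset V → ℝ} (hF : HasGrowth F) {w : V → ℝ} (n : ℕ) :
    ∀ (ρ : ℝ) (C : Finset V) (x : V) (f g : ℝ), 0 ≤ ρ → C.Nonempty → (∀ s ∈ C, 0 < w s) →
    (∀ s ∈ C, dist s x ≤ ρ) → (∀ s ∈ C, ∀ t ∈ C, dist s t ≤ 2 * ρ / 8 ^ n → dist s t = 0) →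
    F C ≤ f → (∀ s ∈ C, F {u ∈ C | dist u s ≤ ρ / 8} ≤ g) →
    ∑ t ∈ C, ENNReal.ofReal (w t) * ballEntropy w C (2 * ρ) t ≤
      ENNReal.ofReal (512 * (∑ s ∈ C, w s) * (f + g + ρ)) := by
  classical
  have hdiam : ∀ {ρ : ℝ} {C : Finset V} {x : V}, (∀ s ∈ C, dist s x ≤ ρ) →
      ∀ s ∈ C, ∀ t ∈ C, dist s t ≤ 2 * ρ := fun {ρ C x} h s hs t ht => by
    have := dist_triangle_right s t x
    linarith [h s hs, h t ht]
  induction n with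
  -- Here every two points of `C` are at distance at most `2ρ`, hence at distance zero, and all
  -- entropy integrals vanish.
  | zero =>
    intro ρ C x f g hρ hC hw hx hsep _ _
    have : ∑ t ∈ C, ENNReal.ofReal (w t) * ballEntropy w C (2 * ρ) t = 0 := by
      refine Finset.sum_eq_zero fun t ht => ?_
      rw [ballEntropy_eq_zero hw _ hC, mul_zero]
      intro ε hε _ s hs
      rw [hsep s hs t ht (by simpa using hdiam hx s hs t ht)]
      exact hε.le
    rw [this]
    exact zero_le
  | succ n ih =>
    intro ρ C x f g hρ hC hw hx hsep hf hg
    obtain ⟨m, t, A, htA, hAC, hAt, htt, hdisj, hcov, hmax⟩ :=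
      exists_greedy_partition hF.mono (a := ρ / 8) (b := ρ / 64) (by positivity) (by linarith) hC
    set W := ∑ s ∈ C, w s with hW
    have hpair : ((Finset.range m : Finset ℕ) : Set ℕ).PairwiseDisjoint A := by
      intro i _ j _ hij
      rcases lt_or_gt_of_ne hij with h | h
      · exact hdisj i j h
      · exact (hdisj j i h).symm
    have hsplit : ∀ {M : Type} [AddCommMonoid M] (φ : V → M), ∑ t ∈ C, φ t =
        ∑ i ∈ Finset.range m, ∑ t ∈ A i, φ t := fun φ => by
      conv_lhs => rw [hcov]
      exact Finset.sum_biUnion hpair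
    have hWsum : W = ∑ i ∈ Finset.range m, ∑ s ∈ A i, w s := hsplit w
    set p : ℕ → ℝ := fun i => ∑ s ∈ A i, w s with hp
    have hp0 : ∀ i < m, 0 < p i := fun i hi =>
      Finset.sum_pos (fun s hs => hw s (hAC i hs)) ⟨_, htA i hi⟩
    have hpW : ∀ i, p i ≤ W := fun i =>
      Finset.sum_le_sum_of_subset_of_nonneg (hAC i) fun s hs _ => (hw s hs).le
    have hW0 : 0 < W := Finset.sum_pos hw hC
    set ℓ : ℕ → ℝ := fun i => Real.sqrt (Real.log ((i : ℝ) + 1)) with hℓ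
    set gi : ℕ → ℝ := fun i => F {u ∈ A i | dist u (t i) ≤ ρ / 64} with hgi
    -- Growth is applied to the first `i + 1` centers, which are `ρ / 8` separated. By the greedy
    -- choice the values `gi` decrease, so `gi i` is a common lower bound for these pieces.
    have hgrow : ∀ i < m, ρ / 64 * (ℓ i / 2 - 2) + gi i ≤ f := by
      intro i hi
      have := hF.growth i (ρ / 8) (gi i) (fun k => t k)
        (fun k => {u ∈ A k | dist u (t k) ≤ ρ / 64}) C (by positivity) ?_ ?_ ?_ ?_ ?_
      · have e : ρ / 8 / 8 = ρ / 64 := by ring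
        rw [e] at this
        exact this.trans hf
      · intro j k hjk
        rcases lt_or_gt_of_ne hjk with h | h
        · exact (htt j k h (lt_of_lt_of_le k.2 hi)).le
        · rw [dist_comm]
          exact (htt k j h (lt_of_lt_of_le j.2 hi)).le
      · exact fun k => ⟨t k, Finset.mem_filter.2 ⟨htA k (lt_of_lt_of_le k.2 hi),
          by simp; positivity⟩⟩
      · intro k s hs
        have := (Finset.mem_filter.1 hs).2
        linarith
      · exact fun k => (Finset.filter_subset _ _).trans (hAC k)
      · exact fun k => hmax k i (Nat.lt_succ_iff.1 k.2) hi (t i) (htA i hi)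
    -- The induction hypothesis enters with `(ρ / 8, g, gi i)` in place of `(ρ, f, g)`: a piece lies
    -- in a ball of radius `ρ / 8` of `C`, so `g` bounds it, and `gi i` bounds its balls of radius
    -- `ρ / 64`.
    have hpiece : ∀ i < m, ∑ s ∈ A i, ENNReal.ofReal (w s) * ballEntropy w C (2 * ρ) s ≤
        ENNReal.ofReal (512 * p i * (g + gi i + ρ / 8) +
          2 * ρ * (p i * Real.sqrt (Real.log (W / p i)))) := by
      intro i hi
      have hFA : F (A i) ≤ g := by
        refine (hF.mono _ _ ⟨_, htA i hi⟩ fun u hu => ?_).trans (hg (t i) (hAC i (htA i hi)))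
        exact Finset.mem_filter.2 ⟨hAC i hu, hAt i hi u hu⟩
      have hFAi : ∀ s ∈ A i, F {u ∈ A i | dist u s ≤ ρ / 8 / 8} ≤ gi i := by
        intro s hs
        have e : ρ / 8 / 8 = ρ / 64 := by ring
        rw [e]
        exact hmax i i le_rfl hi s hs
      have hI := ih (ρ / 8) (A i) (t i) g (gi i) (by positivity) ⟨_, htA i hi⟩
        (fun s hs => hw s (hAC i hs)) (hAt i hi) (fun s hs u hu hsu =>
          hsep s (hAC i hs) u (hAC i hu) (hsu.trans (le_of_eq (by rw [pow_succ]; field_simp))))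
        hFA hFAi
      have h0 : 0 ≤ 512 * p i * (g + gi i + ρ / 8) ∨ 512 * p i * (g + gi i + ρ / 8) ≤ 0 :=
        le_total _ _
      have hL0 : 0 ≤ 2 * ρ * (p i * Real.sqrt (Real.log (W / p i))) := by
        have := (hp0 i hi).le
        positivity
      calc _ ≤ ∑ s ∈ A i, ENNReal.ofReal (w s) * (ballEntropy w (A i) (2 * (ρ / 8)) s +
            ENNReal.ofReal (2 * ρ * Real.sqrt (Real.log (W / p i)))) := by
            refine Finset.sum_le_sum fun s hs => ?_
            gcongr
            exact ballEntropy_le_add hw (hAC i) (by positivity) (by linarith) hs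
              fun u hu => hdiam (hAt i hi) u hu s hs
        _ = ∑ s ∈ A i, ENNReal.ofReal (w s) * ballEntropy w (A i) (2 * (ρ / 8)) s +
            ENNReal.ofReal (2 * ρ * (p i * Real.sqrt (Real.log (W / p i)))) := by
            simp_rw [mul_add, Finset.sum_add_distrib]
            congr 1
            rw [← Finset.sum_mul, ← ENNReal.ofReal_sum_of_nonneg
              (fun s hs => (hw s (hAC i hs)).le), ← ENNReal.ofReal_mul (hp0 i hi).le]
            congr 1
            ring
        _ ≤ _ := by
            have hg0 : 0 ≤ g + gi i + ρ / 8 := by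
              have q1 := (hF.nonneg _ ⟨_, htA i hi⟩).trans hFA
              have q2 : 0 ≤ gi i := hF.nonneg _ ⟨t i, Finset.mem_filter.2 ⟨htA i hi, by
                simp; positivity⟩⟩
              positivity
            rw [ENNReal.ofReal_add (by have := (hp0 i hi).le; positivity) hL0]
            gcongr
    have hf0 : 0 ≤ f := (hF.nonneg C hC).trans hf
    have hg0 : 0 ≤ g := by
      obtain ⟨s, hs⟩ := hC
      refine (hF.nonneg _ ⟨s, ?_⟩).trans (hg s hs)
      simp [hs]; positivity
    rw [hsplit]
    calc _ ≤ ∑ i ∈ Finset.range m, ENNReal.ofReal (512 * p i * (g + gi i + ρ / 8) +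
          2 * ρ * (p i * Real.sqrt (Real.log (W / p i)))) :=
          Finset.sum_le_sum fun i hi => hpiece i (Finset.mem_range.1 hi)
      -- The constant `512` is chosen here: growth replaces `gi i` by `f - ρ ℓ i / 128 + ρ / 32`,
      -- and `512 / 128 = 4` cancels the term `2ρ * 2 p i ℓ i` of the entropy cost. The radii `ρ / 8
      -- + ρ / 32` make `5ρ / 32`.
      _ ≤ ∑ i ∈ Finset.range m, ENNReal.ofReal (512 * p i * (f + g + 5 / 32 * ρ) +
          2 * ρ * W * (1 / ((i : ℝ) + 1) ^ 2)) := by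
          refine Finset.sum_le_sum fun i hi => ENNReal.ofReal_le_ofReal ?_
          have hi' := Finset.mem_range.1 hi
          have h1 := mul_sqrt_log_inv_le (hp0 i hi') (hpW i) i
          have h2 := hgrow i hi'
          have h3 : 2 * ρ * (p i * Real.sqrt (Real.log (W / p i))) ≤
            2 * ρ * (2 * p i * ℓ i + W * (1 / ((i : ℝ) + 1) ^ 2)) :=
            mul_le_mul_of_nonneg_left h1 (by positivity)
          have h4 : p i * gi i ≤ p i * (f - ρ / 64 * (ℓ i / 2 - 2)) :=
            mul_le_mul_of_nonneg_left (by linarith) (hp0 i hi').le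
          linarith
      _ = ENNReal.ofReal (∑ i ∈ Finset.range m, (512 * p i * (f + g + 5 / 32 * ρ) +
          2 * ρ * W * (1 / ((i : ℝ) + 1) ^ 2))) := by
          rw [ENNReal.ofReal_sum_of_nonneg]
          intro i hi
          have := (hp0 i (Finset.mem_range.1 hi)).le
          positivity
      _ ≤ _ := by
          refine ENNReal.ofReal_le_ofReal ?_
          rw [Finset.sum_add_distrib, ← Finset.sum_mul, ← Finset.mul_sum, ← Finset.mul_sum,
            ← hWsum]
          have h1 : 2 * ρ * W * ∑ i ∈ Finset.range m, 1 / ((i : ℝ) + 1) ^ 2 ≤ 2 * ρ * W * 2 :=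
            mul_le_mul_of_nonneg_left (sum_one_div_sq_le m) (by positivity)
          have h2 : 0 ≤ W * ρ := by positivity
          linarith

/-- Entropy integrals are bounded by a functional with the growth condition that controls the
distances. -/
theorem sum_ballEntropy_le {F : Finset V → ℝ} (hF : HasGrowth F) {w : V → ℝ} {C : Finset V}
    (hC : C.Nonempty) (hw : ∀ s ∈ C, 0 < w s)
    (hd : ∀ s ∈ C, ∀ t ∈ C, dist s t ≤ 40 * F C) (c : ℝ) :
    ∑ t ∈ C, ENNReal.ofReal (w t) * ballEntropy w C c t ≤
      ENNReal.ofReal (22000 * (∑ s ∈ C, w s) * F C) := by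
  classical
  obtain ⟨x, hx⟩ := hC
  have hC : C.Nonempty := ⟨x, hx⟩
  have hF0 := hF.nonneg C hC
  -- The starting radius is the bound on the diameter; with `f = g = F C` the induction gives `512 *
  -- (1 + 1 + 40) = 21504 ≤ 22000`.
  set ρ := 40 * F C with hρ
  have hρ0 : 0 ≤ ρ := by positivity
  have hW : 0 < ∑ s ∈ C, w s := Finset.sum_pos hw hC
  have hsep : ∃ n : ℕ, ∀ s ∈ C, ∀ t ∈ C, dist s t ≤ 2 * ρ / 8 ^ n → dist s t = 0 := by
    have hev : ∀ s ∈ C, ∀ t ∈ C, ∀ᶠ n : ℕ in atTop, dist s t ≤ 2 * ρ / 8 ^ n → dist s t = 0 := by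
      intro s _ t _
      rcases (dist_nonneg (x := s) (y := t)).eq_or_lt with h | h
      · exact Eventually.of_forall fun n _ => h.symm
      · have hlim : Tendsto (fun n : ℕ => 2 * ρ / 8 ^ n) atTop (𝓝 0) := by
          simp_rw [div_eq_mul_inv, ← inv_pow]
          have := (tendsto_pow_atTop_nhds_zero_of_lt_one (r := (8 : ℝ)⁻¹) (by norm_num)
            (by norm_num)).const_mul (2 * ρ)
          simpa using this
        filter_upwards [hlim.eventually_lt_const h] with n hn hle
        linarith
    have h2 : ∀ᶠ n : ℕ in atTop, ∀ s ∈ C, ∀ t ∈ C, dist s t ≤ 2 * ρ / 8 ^ n → dist s t = 0 := by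
      rw [Filter.eventually_all_finset]
      intro s hs
      rw [Filter.eventually_all_finset]
      exact hev s hs
    exact h2.exists
  obtain ⟨n, hn⟩ := hsep
  have key := sum_ballEntropy_le_of_radius hF (w := w) n ρ C x (F C) (F C) hρ0 hC hw
    (fun s hs => hd s hs x hx) hn le_rfl (fun s hs => hF.mono _ _ ⟨s, by
      simp [hs]; positivity⟩ (Finset.filter_subset _ _))
  -- Beyond `2ρ` balls contain all of `C` and the integrand is zero, so the upper limit `c` is
  -- irrelevant.
  have hle : ∀ t ∈ C, ballEntropy w C c t ≤ ballEntropy w C (2 * ρ) t := by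
    intro t ht
    rcases le_total c (2 * ρ) with h | h
    · exact lintegral_mono_set (Set.Ioc_subset_Ioc_right h)
    · refine (ballEntropy_le_add hw (Finset.Subset.refl C) (by positivity) h ht
        fun s hs => (hd s hs t ht).trans (by linarith)).trans ?_
      rw [div_self hW.ne']
      simp
  calc _ ≤ ∑ t ∈ C, ENNReal.ofReal (w t) * ballEntropy w C (2 * ρ) t :=
        Finset.sum_le_sum fun t ht => mul_le_mul_right (hle t ht) _
    _ ≤ _ := key
    _ ≤ _ := by
        refine ENNReal.ofReal_le_ofReal ?_
        have : 0 ≤ (∑ s ∈ C, w s) * F C := by positivity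
        rw [hρ]; linarith

end Partition

/-! ### Growth and diameter control for finite Gaussian families -/

section FiniteLowerBound

/-- `E|g|` is at least `P(g ≥ 1)`, and the tail bound at `1` is `exp (-2) / √(2π)`. -/
lemma one_div_twenty_le_integral_abs_gaussianReal : 1 / 20 ≤ ∫ x, |x| ∂(gaussianReal 0 1) := by
  have h1 := le_gaussianReal_Ici (x := 1) zero_le_one
  have h2 : 1 / 20 ≤ (Real.sqrt (2 * Real.pi))⁻¹ * Real.exp (-(1 + 1) ^ 2 / 2) := by
    have e1 : Real.sqrt (2 * Real.pi) ≤ 2.6 := by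
      rw [Real.sqrt_le_left (by norm_num)]
      nlinarith [Real.pi_lt_d2]
    have e2 : Real.exp (-(1 + 1) ^ 2 / 2) = (Real.exp 1 ^ 2)⁻¹ := by
      rw [← Real.exp_nat_mul, ← Real.exp_neg]; norm_num
    have e3 : Real.exp 1 ^ 2 ≤ 7.5 := by
      have := Real.exp_one_lt_d9
      nlinarith [Real.exp_pos 1]
    rw [e2, ← mul_inv, one_div]
    have h0 : 0 < Real.sqrt (2 * Real.pi) := by positivity
    refine inv_anti₀ (by positivity) ?_
    calc _ ≤ (2.6 : ℝ) * 7.5 := by gcongr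
      _ ≤ 20 := by norm_num
  have hint : Integrable (fun x : ℝ => |x|) (gaussianReal 0 1) :=
    ((memLp_id_gaussianReal (μ := 0) (v := 1) 1).integrable le_rfl).abs
  have h3 : (gaussianReal 0 1).real (Set.Ici 1) ≤ ∫ x, |x| ∂(gaussianReal 0 1) := by
    calc _ = ∫ x, (Set.Ici (1 : ℝ)).indicator (fun _ => (1 : ℝ)) x ∂(gaussianReal 0 1) := by
          rw [integral_indicator measurableSet_Ici]; simp
      _ ≤ _ := by
          refine integral_mono ((integrable_const 1).indicator measurableSet_Ici) hint fun x => ?_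
          by_cases hx : x ∈ Set.Ici (1 : ℝ)
          · rw [Set.indicator_of_mem hx]
            exact (Set.mem_Ici.1 hx).trans (le_abs_self x)
          · rw [Set.indicator_of_notMem hx]
            exact abs_nonneg x
  linarith

lemma integral_abs_gaussianReal (v : ℝ) (hv : 0 ≤ v) :
    ∫ x, |x| ∂(gaussianReal 0 (v ^ 2).toNNReal) = v * ∫ x, |x| ∂(gaussianReal 0 1) := by
  have h := gaussianReal_map_const_mul (μ := 0) (v := 1) v
  have e : NNReal.mk (v ^ 2) (sq_nonneg v) * 1 = (v ^ 2).toNNReal := by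
    rw [mul_one, Real.toNNReal_of_nonneg (sq_nonneg v)]
  rw [mul_zero, e] at h
  rw [← h, integral_map (by fun_prop) (by fun_prop), ← integral_const_mul]
  simp_rw [abs_mul, abs_of_nonneg hv]

variable {V : Type*} [Fintype V] [PseudoMetricSpace V] {μ : Measure (V → ℝ)} [IsGaussian μ]

lemma map_eval_sub_eq_gaussianReal (hμ : ∀ i, ∫ x : V → ℝ, x i ∂μ = 0)
    (hd : ∀ i j, ∫ x : V → ℝ, (x i - x j) ^ 2 ∂μ = dist i j ^ 2) (s t : V) :
    μ.map (fun x : V → ℝ => x s - x t) = gaussianReal 0 (dist s t ^ 2).toNNReal := by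
  let L : (V → ℝ) →L[ℝ] ℝ := ContinuousLinearMap.proj (R := ℝ) (φ := fun _ => ℝ) s -
    ContinuousLinearMap.proj (R := ℝ) (φ := fun _ => ℝ) t
  have hL : ∀ x, L x = x s - x t := fun x => rfl
  have h0 : ∫ x, L x ∂μ = 0 := by
    simp only [hL]
    rw [integral_sub (IsGaussian.integrable_eval μ s) (IsGaussian.integrable_eval μ t), hμ, hμ,
      sub_zero]
  have hv : Var[L; μ] = dist s t ^ 2 := by
    rw [variance_of_integral_eq_zero L.continuous.aemeasurable h0, ← hd s t]
    rfl
  have := IsGaussian.map_eq_gaussianReal (μ := μ) L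
  rw [h0, hv] at this
  exact this

/-- The larger of two numbers is half their sum plus half their distance. In mean this leaves `E|x s
- x t| / 2 = d(s, t) E|g| / 2`, and `E|g| ≥ 1/20`. -/
lemma dist_le_meanSup (hμ : ∀ i, ∫ x : V → ℝ, x i ∂μ = 0)
    (hd : ∀ i j, ∫ x : V → ℝ, (x i - x j) ^ 2 ∂μ = dist i j ^ 2) {C : Finset V} {s t : V}
    (hs : s ∈ C) (ht : t ∈ C) : dist s t ≤ 40 * meanSup μ C := by
  have h1 : ∫ x : V → ℝ, |x s - x t| ∂μ = dist s t * ∫ x, |x| ∂(gaussianReal 0 1) := by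
    rw [← integral_abs_gaussianReal _ dist_nonneg, ← map_eval_sub_eq_gaussianReal hμ hd,
      integral_map (by fun_prop) (by fun_prop)]
  have is := IsGaussian.integrable_eval μ s
  have it := IsGaussian.integrable_eval μ t
  have h2 : ∫ x : V → ℝ, (x s + x t + |x s - x t|) / 2 ∂μ ≤ meanSup μ C := by
    refine integral_mono (((is.add it).add (is.sub it).abs).div_const 2)
      (integrable_ciSup_finset μ ⟨s, hs⟩) fun x => ?_
    have e1 := le_ciSup (f := fun s : C => x s) (Finite.bddAbove_range _) ⟨s, hs⟩
    have e2 := le_ciSup (f := fun s : C => x s) (Finite.bddAbove_range _) ⟨t, ht⟩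
    simp only at e1 e2 ⊢
    rcases abs_cases (x s - x t) with h | h <;> rw [h.1] <;> linarith
  have h3 : ∫ x : V → ℝ, (x s + x t + |x s - x t|) / 2 ∂μ = (∫ x : V → ℝ, |x s - x t| ∂μ) / 2 := by
    have i12 : Integrable (fun x : V → ℝ => x s + x t) μ := is.add it
    have i3 : Integrable (fun x : V → ℝ => |x s - x t|) μ := (is.sub it).abs
    rw [integral_div, integral_add i12 i3, integral_add is it, hμ, hμ]
    simp
  have h4 := mul_le_mul_of_nonneg_left one_div_twenty_le_integral_abs_gaussianReal
    (dist_nonneg (x := s) (y := t))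
  linarith

lemma hasGrowth_meanSup (hμ : ∀ i, ∫ x : V → ℝ, x i ∂μ = 0)
    (hd : ∀ i j, ∫ x : V → ℝ, (x i - x j) ^ 2 ∂μ = dist i j ^ 2) :
    HasGrowth (V := V) (meanSup μ) where
  mono A B hA hAB := meanSup_mono μ hA hAB
  nonneg A hA := meanSup_nonneg hμ hA
  growth n a B t A C ha ht hA hAt hAC hB := by
    have := le_meanSup_of_separated hμ hd ha ht hA hAt hAC hB
    simpa using this

end FiniteLowerBound

/-! ### From finite families to the modulus of the process -/

section ProcessLowerBound

variable {T : Type u} [PseudoMetricSpace T] {Ω : Type v} [MeasurableSpace Ω] {P : Measure Ω}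
  {X : T → Ω → ℝ}

lemma IsCanonicalGaussian.isGaussian_map (hX : IsCanonicalGaussian P X) (S : Finset T) :
    IsGaussian (P.map fun ω (s : S) => X s ω) :=
  (hX.gaussian.hasGaussianLaw S).isGaussian_map

lemma IsCanonicalGaussian.aemeasurable_pi (hX : IsCanonicalGaussian P X) (S : Finset T) :
    AEMeasurable (fun ω (s : S) => X s ω) P :=
  (hX.gaussian.hasGaussianLaw S).aemeasurable

lemma IsCanonicalGaussian.integral_eval_map (hX : IsCanonicalGaussian P X) (S : Finset T) (s : S) :
    ∫ x : S → ℝ, x s ∂(P.map fun ω (s : S) => X s ω) = 0 := by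
  rw [integral_map (hX.aemeasurable_pi S) (measurable_pi_apply s).aestronglyMeasurable]
  exact hX.centered s

lemma IsCanonicalGaussian.integral_sub_sq_map (hX : IsCanonicalGaussian P X) (S : Finset T)
    (s t : S) : ∫ x : S → ℝ, (x s - x t) ^ 2 ∂(P.map fun ω (s : S) => X s ω) = dist s t ^ 2 := by
  have hm : Measurable fun x : S → ℝ => (x s - x t) ^ 2 := by fun_prop
  rw [integral_map (hX.aemeasurable_pi S) hm.aestronglyMeasurable, Subtype.dist_eq, hX.dist_eq,
    Real.sq_sqrt (integral_nonneg fun ω => sq_nonneg _)]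

lemma ofReal_integral_le_lintegral {α : Type*} [MeasurableSpace α] {μ : Measure α} {f : α → ℝ}
    (hf : Integrable f μ) : ENNReal.ofReal (∫ x, f x ∂μ) ≤ ∫⁻ x, ENNReal.ofReal (f x) ∂μ := by
  have h1 : ∫ x, f x ∂μ ≤ ∫ x, max (f x) 0 ∂μ :=
    integral_mono hf hf.pos_part fun x => le_max_left _ _
  refine (ENNReal.ofReal_le_ofReal h1).trans ?_
  rw [ofReal_integral_eq_lintegral_ofReal hf.pos_part (ae_of_all _ fun x => le_max_right _ _)]
  refine lintegral_mono fun x => ?_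
  rw [ENNReal.ofReal_max]; simp

/-- Subtracting the centered variable `X t₀` does not change the expected supremum, and turns it
into a supremum of increments of length at most `δ`. -/
lemma ofReal_meanSup_le_modulus (hX : IsCanonicalGaussian P X) {S : Finset T} (hS : S.Nonempty)
    {t₀ : T} {δ : ℝ} (hδ : ∀ s ∈ S, dist s t₀ ≤ δ) :
    ENNReal.ofReal (meanSup (P.map fun ω (s : S) => X s ω) Finset.univ) ≤ modulus P X δ := by
  have := hX.isGaussian_map S
  have hne : (Finset.univ : Finset S).Nonempty := by
    obtain ⟨s, hs⟩ := hS
    exact ⟨⟨s, hs⟩, Finset.mem_univ _⟩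
  have : Nonempty (Finset.univ : Finset S) := hne.to_subtype
  have i1 : Integrable (fun ω => ⨆ s : (Finset.univ : Finset S), X s ω) P :=
    (integrable_ciSup_finset (P.map fun ω (s : S) => X s ω) hne).comp_aemeasurable
      (hX.aemeasurable_pi S)
  have i2 : Integrable (X t₀) P := (hX.gaussian.hasGaussianLaw_eval t₀).integrable
  have e : meanSup (P.map fun ω (s : S) => X s ω) Finset.univ =
      ∫ ω, (⨆ s : (Finset.univ : Finset S), X s ω) - X t₀ ω ∂P := by
    rw [integral_sub i1 i2, hX.centered, sub_zero, meanSup, integral_map (hX.aemeasurable_pi S)]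
    exact (integrable_ciSup_finset _ hne).aestronglyMeasurable
  rw [e]
  refine (ofReal_integral_le_lintegral (i1.sub i2)).trans (lintegral_mono fun ω => ?_)
  obtain ⟨s, hs⟩ := exists_eq_ciSup_of_finite (f := fun s : (Finset.univ : Finset S) => X s ω)
  refine le_trans (ENNReal.ofReal_le_ofReal ?_)
    (le_iSup_of_le ((s : S) : T) (le_iSup_of_le t₀ (le_iSup_of_le (hδ _ s.1.2) le_rfl)))
  simp only [Pi.sub_apply]
  rw [← hs]
  exact le_abs_self _

/-- Lower bound of the modulus by the entropy integrals of a finitely supported measure. -/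
lemma sum_ballEntropy_le_modulus (hX : IsCanonicalGaussian P X) {S : Finset T} (hS : S.Nonempty)
    {w : T → ℝ} (hw : ∀ s ∈ S, 0 < w s) (hw1 : ∑ s ∈ S, w s = 1)
    {t₀ : T} {δ : ℝ} (hδ : ∀ s ∈ S, dist s t₀ ≤ δ) (c : ℝ) :
    ∑ t ∈ S, ENNReal.ofReal (w t) * ballEntropy w S c t ≤ 22000 * modulus P X δ := by
  have := hX.isGaussian_map S
  set μ := P.map fun ω (s : S) => X s ω with hμ
  have h0 := hX.integral_eval_map S
  have h1 := hX.integral_sub_sq_map S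
  have hne : (Finset.univ : Finset S).Nonempty := by
    obtain ⟨s, hs⟩ := hS
    exact ⟨⟨s, hs⟩, Finset.mem_univ _⟩
  have hb : ∀ t : S, ballEntropy (fun s : S => w s) Finset.univ c t = ballEntropy w S c t := by
    intro t
    unfold ballEntropy
    congr 1
    ext ε
    rw [Finset.sum_filter, Finset.sum_filter, Finset.sum_coe_sort S w,
      ← Finset.sum_coe_sort S (fun s => if dist s (t : T) ≤ ε then w s else 0)]
    rfl
  have key := sum_ballEntropy_le (hasGrowth_meanSup h0 h1) (w := fun s : S => w s) hne
    (fun s _ => hw s s.2) (fun s hs t ht => dist_le_meanSup h0 h1 hs ht) c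
  rw [Finset.sum_coe_sort S w, hw1, mul_one] at key
  rw [← Finset.sum_coe_sort S]
  simp_rw [← hb]
  refine key.trans ?_
  rw [ENNReal.ofReal_mul (by norm_num)]
  refine (mul_le_mul_right (ofReal_meanSup_le_modulus hX hS hδ) _).trans (le_of_eq ?_)
  norm_num

end ProcessLowerBound

/-! ### Elementary properties of `√(log₂ (1 / p))` -/

section SqrtLogInv

lemma sqrtLogInv_zero : sqrtLogInv 0 = ∞ := by simp [sqrtLogInv]

lemma sqrtLogInv_anti {p q : ℝ≥0∞} (h : p ≤ q) (hq : q ≠ ∞) : sqrtLogInv q ≤ sqrtLogInv p := by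
  rcases eq_or_ne p 0 with rfl | hp
  · rw [sqrtLogInv_zero]; exact le_top
  · have hq0 : q ≠ 0 := (lt_of_lt_of_le (pos_iff_ne_zero.2 hp) h).ne'
    rw [sqrtLogInv, sqrtLogInv, if_neg hp, if_neg hq0]
    have hp0 : 0 < p.toReal := ENNReal.toReal_pos hp (ne_top_of_le_ne_top hq h)
    refine ENNReal.ofReal_le_ofReal (Real.sqrt_le_sqrt ?_)
    refine Real.logb_le_logb_of_le one_lt_two (inv_pos.2 (ENNReal.toReal_pos hq0 hq)) ?_
    exact inv_anti₀ hp0 (ENNReal.toReal_mono hq h)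

lemma measurable_sqrtLogInv : Measurable sqrtLogInv := by
  unfold sqrtLogInv
  refine Measurable.ite (measurableSet_singleton 0) measurable_const ?_
  exact ((Real.measurable_log.comp ENNReal.measurable_toReal.inv).div_const _).sqrt.ennreal_ofReal

lemma sqrtLogInv_mul_le {p q : ℝ≥0∞} (hp : p ≤ 1) (hq : q ≤ 1) :
    sqrtLogInv (p * q) ≤ sqrtLogInv p + sqrtLogInv q := by
  rcases eq_or_ne p 0 with rfl | hp0
  · simp [sqrtLogInv_zero]
  rcases eq_or_ne q 0 with rfl | hq0
  · simp [sqrtLogInv_zero]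
  rw [sqrtLogInv, sqrtLogInv, sqrtLogInv, if_neg (mul_ne_zero hp0 hq0), if_neg hp0, if_neg hq0,
    ← ENNReal.ofReal_add (Real.sqrt_nonneg _) (Real.sqrt_nonneg _), ENNReal.toReal_mul, mul_inv]
  refine ENNReal.ofReal_le_ofReal ?_
  have hp1 : 0 < p.toReal := ENNReal.toReal_pos hp0 (ne_top_of_le_ne_top ENNReal.one_ne_top hp)
  have hq1 : 0 < q.toReal := ENNReal.toReal_pos hq0 (ne_top_of_le_ne_top ENNReal.one_ne_top hq)
  have hp2 : p.toReal ≤ 1 := ENNReal.toReal_le_of_le_ofReal zero_le_one (by simpa using hp)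
  have hq2 : q.toReal ≤ 1 := ENNReal.toReal_le_of_le_ofReal zero_le_one (by simpa using hq)
  have n1 : 0 ≤ Real.logb 2 p.toReal⁻¹ := Real.logb_nonneg one_lt_two ((one_le_inv₀ hp1).2 hp2)
  have n2 : 0 ≤ Real.logb 2 q.toReal⁻¹ := Real.logb_nonneg one_lt_two ((one_le_inv₀ hq1).2 hq2)
  rw [Real.logb_mul (inv_ne_zero hp1.ne') (inv_ne_zero hq1.ne'), Real.sqrt_le_left (by positivity)]
  nlinarith [Real.sq_sqrt n1, Real.sq_sqrt n2, Real.sqrt_nonneg (Real.logb 2 p.toReal⁻¹),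
    Real.sqrt_nonneg (Real.logb 2 q.toReal⁻¹)]

/-- Change of the base of the logarithm. -/
lemma sqrtLogInv_ofReal_le {p : ℝ} (hp : 0 < p) (hp1 : p ≤ 1) :
    sqrtLogInv (ENNReal.ofReal p) ≤ 2 * ENNReal.ofReal (Real.sqrt (Real.log p⁻¹)) := by
  rw [sqrtLogInv, if_neg (by simpa using hp), ENNReal.toReal_ofReal hp.le,
    show (2 : ℝ≥0∞) = ENNReal.ofReal 2 by norm_num, ← ENNReal.ofReal_mul (by norm_num)]
  refine ENNReal.ofReal_le_ofReal ?_
  have n1 : 0 ≤ Real.log p⁻¹ := Real.log_nonneg ((one_le_inv₀ hp).2 hp1)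
  rw [Real.sqrt_le_left (by positivity), mul_pow, Real.sq_sqrt n1, Real.logb,
    div_le_iff₀ (Real.log_pos one_lt_two)]
  nlinarith [Real.log_two_gt_d9]

lemma le_sqrtLogInv_ofReal {p : ℝ} (hp : 0 < p) (hp1 : p ≤ 1) :
    ENNReal.ofReal (Real.sqrt (Real.log p⁻¹)) ≤ sqrtLogInv (ENNReal.ofReal p) := by
  rw [sqrtLogInv, if_neg (by simpa using hp), ENNReal.toReal_ofReal hp.le]
  refine ENNReal.ofReal_le_ofReal (Real.sqrt_le_sqrt ?_)
  have n1 : 0 ≤ Real.log p⁻¹ := Real.log_nonneg ((one_le_inv₀ hp).2 hp1)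
  rw [Real.logb, le_div_iff₀ (Real.log_pos one_lt_two)]
  nlinarith [Real.log_two_lt_d9]

end SqrtLogInv

/-! ### Discretization of measures carried by a ball -/

section MeasureLowerBound

variable {T : Type u} [PseudoMetricSpace T]

lemma isCover_univ_iff {r : ℝ} (hr : 0 ≤ r) {C : Set T} :
    Metric.IsCover r.toNNReal Set.univ C ↔ ∀ t, ∃ c ∈ C, dist t c ≤ r := by
  rw [Metric.isCover_iff_subset_iUnion_closedBall]
  simp only [Set.subset_def, Set.mem_univ, true_imp_iff, Set.mem_iUnion, Metric.mem_closedBall,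
    exists_prop, Real.coe_toNNReal r hr]

variable [MeasurableSpace T] [BorelSpace T]

/-- A measurable nearest-point map onto a finite net. Its fibers serve both to discretize measures
and to split them along a cover. -/
lemma exists_simpleFunc_dist_le {C : Set T} (hC : C.Finite) (hne : C.Nonempty) {r : ℝ}
    (h : ∀ t, ∃ c ∈ C, dist t c ≤ r) :
    ∃ κ : SimpleFunc T T, (∀ t, κ t ∈ C) ∧ ∀ t, dist (κ t) t ≤ r := by
  obtain ⟨c₀, hc₀⟩ := hne
  let l := hC.toFinset.toList
  -- The default `c₀` keeps every value in `C`, also past the end of the list.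
  let e : ℕ → T := fun k => l.getD k c₀
  have he : ∀ k, e k ∈ C := by
    intro k
    by_cases hk : k < l.length
    · have : e k = l[k] := by simp [e, hk]
      rw [this]
      exact hC.mem_toFinset.1 (Finset.mem_toList.1 (List.getElem_mem hk))
    · have : e k = c₀ := by simp [e, not_lt.1 hk]
      rw [this]; exact hc₀
  refine ⟨SimpleFunc.nearestPt e l.length, fun t => he _, fun t => ?_⟩
  obtain ⟨c, hc, hct⟩ := h t
  have hcl : c ∈ l := by simpa [l] using hc
  obtain ⟨k, hk, rfl⟩ := List.getElem_of_mem hcl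
  have h1 := SimpleFunc.edist_nearestPt_le e t hk.le
  have h2 : e k = l[k] := by simp [e, hk]
  rw [h2, edist_dist, edist_dist, ENNReal.ofReal_le_ofReal_iff dist_nonneg, dist_comm l[k]] at h1
  exact h1.trans hct

lemma measurable_measure_closedBall [SecondCountableTopology T] (μ : Measure T) [SFinite μ] :
    Measurable fun p : T × ℝ => μ (Metric.closedBall p.1 p.2) := by
  have hs : MeasurableSet {q : (T × ℝ) × T | dist q.2 q.1.1 ≤ q.1.2} :=
    (isClosed_le (by fun_prop) (by fun_prop)).measurableSet
  exact measurable_measure_prodMk_left hs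

lemma measurable_sqrtLogInv_closedBall [SecondCountableTopology T] (μ : Measure T) [SFinite μ] :
    Measurable fun p : T × ℝ => sqrtLogInv (μ (Metric.closedBall p.1 p.2)) :=
  measurable_sqrtLogInv.comp (measurable_measure_closedBall μ)

lemma measurable_lintegral_sqrtLogInv [SecondCountableTopology T] (μ : Measure T) [SFinite μ]
    (s : Set ℝ) :
    Measurable fun t => ∫⁻ ε in s, sqrtLogInv (μ (Metric.closedBall t ε)) :=
  (measurable_sqrtLogInv_closedBall μ).lintegral_prod_right'

lemma setLIntegral_Ioc_shift (f : ℝ → ℝ≥0∞) (a c : ℝ) :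
    ∫⁻ ε in Set.Ioc a c, f ε = ∫⁻ ε in Set.Ioc 0 (c - a), f (ε + a) := by
  rw [← lintegral_indicator measurableSet_Ioc, ← lintegral_indicator measurableSet_Ioc,
    ← lintegral_add_right_eq_self _ a]
  congr 1
  ext ε
  simp only [Set.indicator, Set.mem_Ioc]
  congr 1
  rw [eq_iff_iff]
  constructor <;> rintro ⟨h1, h2⟩ <;> constructor <;> linarith

variable [CompactSpace T] {Ω : Type v} [MeasurableSpace Ω] {P : Measure Ω} {X : T → Ω → ℝ}

/-- The truncated functional of a measure carried by a ball is controlled by the modulus. -/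
lemma lintegral_truncated_le_modulus (hX : IsCanonicalGaussian P X) (ν : Measure T)
    [IsProbabilityMeasure ν] {t₀ : T} {δ : ℝ} (hν : ν (Metric.closedBall t₀ δ) = 1)
    {η : ℝ} (hη : 0 < η) (c : ℝ) :
    ∫⁻ t, ∫⁻ ε in Set.Ioc (4 * η) c, sqrtLogInv (ν (Metric.closedBall t ε)) ∂volume ∂ν ≤
      44000 * modulus P X δ := by
  classical
  obtain ⟨C, -, hCfin, hCcov⟩ := Metric.exists_finite_isCover_of_isCompact
    (ε := η.toNNReal) (s := (Set.univ : Set T)) (by simpa using hη) isCompact_univ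
  rw [isCover_univ_iff hη.le] at hCcov
  obtain ⟨π, -, hπ⟩ := exists_simpleFunc_dist_le hCfin
    (let ⟨c, hc, _⟩ := hCcov t₀; ⟨c, hc⟩) hCcov
  let w : T → ℝ := fun t => (ν (π ⁻¹' {π t})).toReal
  let S₀ : Finset T := π.range.filter fun s => ν (π ⁻¹' {s}) ≠ 0
  -- A net point may lie outside the ball carrying `ν`. A fiber of positive mass meets that ball, so
  -- its mass is placed at a point `y s` of the fiber inside the ball.
  have hy : ∀ s : T, ∃ y, ν (π ⁻¹' {s}) ≠ 0 → π y = s ∧ dist y t₀ ≤ δ := by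
    intro s
    by_cases hs : ν (π ⁻¹' {s}) = 0
    · exact ⟨s, fun h => absurd hs h⟩
    · have : (π ⁻¹' {s} ∩ Metric.closedBall t₀ δ).Nonempty := by
        by_contra hem
        rw [Set.not_nonempty_iff_eq_empty] at hem
        have h0 : ν (Metric.closedBall t₀ δ)ᶜ = 0 :=
          (prob_compl_eq_zero_iff Metric.isClosed_closedBall.measurableSet).2 hν
        have hsub : π ⁻¹' {s} ⊆ (Metric.closedBall t₀ δ)ᶜ := fun u hu hu' => by
          have : u ∈ π ⁻¹' {s} ∩ Metric.closedBall t₀ δ := ⟨hu, hu'⟩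
          rw [hem] at this; exact this
        exact hs (measure_mono_null hsub h0)
      obtain ⟨y, hy1, hy2⟩ := this
      exact ⟨y, fun _ => ⟨hy1, hy2⟩⟩
  choose y hy using hy
  have hyS : ∀ s ∈ S₀, π (y s) = s ∧ dist (y s) t₀ ≤ δ := fun s hs =>
    hy s (Finset.mem_filter.1 hs).2
  have hinj : Set.InjOn y S₀ := fun s hs s' hs' h => by
    rw [← (hyS s hs).1, h, (hyS s' hs').1]
  let S : Finset T := S₀.image y
  have hwy : ∀ s ∈ S₀, w (y s) = (ν (π ⁻¹' {s})).toReal := fun s hs => by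
    simp only [w, (hyS s hs).1]
  have hwpos : ∀ s ∈ S₀, 0 < w (y s) := fun s hs => by
    rw [hwy s hs]
    exact ENNReal.toReal_pos (Finset.mem_filter.1 hs).2 (measure_ne_top _ _)
  have hofw : ∀ s ∈ S₀, ENNReal.ofReal (w (y s)) = ν (π ⁻¹' {s}) := fun s hs => by
    rw [hwy s hs, ENNReal.ofReal_toReal (measure_ne_top _ _)]
  have hfilt : ∀ A : Finset T, A ⊆ S₀ → ∑ s ∈ A, ν (π ⁻¹' {s}) = ν (⋃ s ∈ A, π ⁻¹' {s}) := by
    intro A hA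
    rw [measure_biUnion_finset]
    · intro s _ s' _ hss
      exact Disjoint.preimage _ (by simpa using hss)
    · exact fun s _ => π.measurableSet_fiber s
  have hsum : ∑ s ∈ S₀, ν (π ⁻¹' {s}) = 1 := by
    rw [Finset.sum_filter_ne_zero, ← measure_biUnion_finset]
    · have : (⋃ s ∈ π.range, π ⁻¹' {s}) = Set.univ := by
        ext u; simp
      rw [this, measure_univ]
    · intro s _ s' _ hss
      exact Disjoint.preimage _ (by simpa using hss)
    · exact fun s _ => π.measurableSet_fiber s
  have hw1 : ∑ t ∈ S, w t = 1 := by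
    rw [Finset.sum_image hinj, Finset.sum_congr rfl hwy, ← ENNReal.toReal_sum
      (fun s _ => measure_ne_top _ _), hsum, ENNReal.toReal_one]
  have hS₀ne : S₀.Nonempty := by
    by_contra h
    rw [Finset.not_nonempty_iff_eq_empty] at h
    rw [h] at hsum; simp at hsum
  have hSpos : ∀ t ∈ S, 0 < w t := by
    intro t ht
    obtain ⟨s, hs, rfl⟩ := Finset.mem_image.1 ht
    exact hwpos s hs
  have key := sum_ballEntropy_le_modulus hX (hS₀ne.image y) hSpos hw1 (t₀ := t₀) (δ := δ)
    (fun t ht => by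
      obtain ⟨s, hs, rfl⟩ := Finset.mem_image.1 ht
      exact (hyS s hs).2) c
  -- The value `∞` on null fibers makes the pointwise bound trivial there, and costs nothing since
  -- it is multiplied by mass `0`.
  let G : T → ℝ≥0∞ := fun s => if ν (π ⁻¹' {s}) = 0 then ∞ else 2 * ballEntropy w S c (y s)
  have hpt : ∀ t, ∫⁻ ε in Set.Ioc (4 * η) c, sqrtLogInv (ν (Metric.closedBall t ε)) ≤
      G (π t) := by
    intro t
    simp only [G]
    split_ifs with h0
    · exact le_top
    · have hπt : π t ∈ S₀ := Finset.mem_filter.2 ⟨π.mem_range_self t, h0⟩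
      have hyt : dist (y (π t)) t ≤ 2 * η := by
        have h1 := hπ t
        have h2 := hπ (y (π t))
        rw [(hyS _ hπt).1] at h2
        have := dist_triangle_left (y (π t)) t (π t)
        linarith
      rw [setLIntegral_Ioc_shift, ballEntropy, ← lintegral_const_mul' _ _ (by norm_num)]
      refine (lintegral_mono_set (Set.Ioc_subset_Ioc_right (by linarith))).trans
        (setLIntegral_mono' measurableSet_Ioc fun ε hε => ?_)
      set W := ∑ s ∈ S with dist s (y (π t)) ≤ ε, w s with hW
      have hW0 : 0 < W := by
        refine Finset.sum_pos (fun s hs => hSpos s (Finset.mem_filter.1 hs).1) ⟨y (π t), ?_⟩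
        exact Finset.mem_filter.2 ⟨Finset.mem_image_of_mem y hπt, by simpa using hε.1.le⟩
      have hW1 : W ≤ 1 := by
        rw [← hw1]
        exact Finset.sum_le_sum_of_subset_of_nonneg (Finset.filter_subset _ _)
          fun s hs _ => (hSpos s hs).le
      -- Origin of the shift `4η`: points of one fiber are within `2η` of each other. This is used
      -- once for `u` and `y s`, and once for `y (π t)` and `t`.
      have hle : ENNReal.ofReal W ≤ ν (Metric.closedBall t (ε + 4 * η)) := by
        rw [hW, Finset.filter_image, Finset.sum_image (hinj.mono
          (Finset.coe_subset.2 (Finset.filter_subset _ _))),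
          ENNReal.ofReal_sum_of_nonneg (fun s hs => (hwpos s (Finset.mem_filter.1 hs).1).le),
          Finset.sum_congr rfl (fun s hs => hofw s (Finset.mem_filter.1 hs).1),
          hfilt _ (Finset.filter_subset _ _)]
        refine measure_mono (Set.iUnion₂_subset fun s hs u hu => ?_)
        have hs' := Finset.mem_filter.1 hs
        have hus : π u = s := hu
        have e1 := hπ u
        have e2 := hπ (y s)
        rw [(hyS s hs'.1).1] at e2
        rw [hus] at e1
        have e3 := dist_triangle_left u (y s) s
        have e4 := dist_triangle4 u (y s) (y (π t)) t
        rw [Metric.mem_closedBall]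
        linarith [hs'.2]
      rw [hw1, one_div]
      exact (sqrtLogInv_anti hle (measure_ne_top _ _)).trans (sqrtLogInv_ofReal_le hW0 hW1)
  calc _ ≤ ∫⁻ t, (π.map G) t ∂ν := lintegral_mono fun t => hpt t
    _ = ∑ s ∈ π.range, G s * ν (π ⁻¹' {s}) := by
        rw [SimpleFunc.lintegral_eq_lintegral, SimpleFunc.map_lintegral]
    _ = ∑ s ∈ S₀, G s * ν (π ⁻¹' {s}) := by
        symm
        refine Finset.sum_subset (Finset.filter_subset _ _) fun s hs hs' => ?_
        have : ν (π ⁻¹' {s}) = 0 := by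
          by_contra h
          exact hs' (Finset.mem_filter.2 ⟨hs, h⟩)
        rw [this, mul_zero]
    _ = 2 * ∑ t ∈ S, ENNReal.ofReal (w t) * ballEntropy w S c t := by
        rw [Finset.sum_image hinj, Finset.mul_sum]
        refine Finset.sum_congr rfl fun s hs => ?_
        rw [hofw s hs]
        simp only [G, if_neg (Finset.mem_filter.1 hs).2]
        ring
    _ ≤ 2 * (22000 * modulus P X δ) := by gcongr
    _ = _ := by rw [← mul_assoc]; norm_num

/-- The truncated bound does not depend on the truncation, so monotone convergence along `η = 1 / (n
+ 1)` removes it. -/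
lemma mmFunctional_le_modulus (hX : IsCanonicalGaussian P X) (ν : Measure T)
    [IsProbabilityMeasure ν] {t₀ : T} {δ : ℝ} (hν : ν (Metric.closedBall t₀ δ) = 1) (c : ℝ) :
    mmFunctional ν ν c ≤ 44000 * modulus P X δ := by
  have hη : ∀ n : ℕ, (0 : ℝ) < 1 / ((n : ℝ) + 1) := fun n => by positivity
  have hanti : Antitone fun n : ℕ => 4 * (1 / ((n : ℝ) + 1)) := by
    intro m n hmn
    simp only
    gcongr
  have hU : Set.Ioc (0 : ℝ) c = ⋃ n : ℕ, Set.Ioc (4 * (1 / ((n : ℝ) + 1))) c := by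
    ext ε
    simp only [Set.mem_Ioc, Set.mem_iUnion]
    constructor
    · rintro ⟨h1, h2⟩
      obtain ⟨n, hn⟩ := exists_nat_one_div_lt (show (0 : ℝ) < ε / 4 by linarith)
      exact ⟨n, by linarith, h2⟩
    · rintro ⟨n, h1, h2⟩
      exact ⟨(by have := hη n; linarith), h2⟩
  have hmono : Monotone fun n : ℕ => Set.Ioc (4 * (1 / ((n : ℝ) + 1))) c :=
    fun m n hmn => Set.Ioc_subset_Ioc_left (hanti hmn)
  unfold mmFunctional
  rw [hU]
  simp_rw [setLIntegral_iUnion_of_directed _ hmono.directed_le]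
  rw [lintegral_iSup (fun n => measurable_lintegral_sqrtLogInv ν _)
    (fun m n hmn t => lintegral_mono_set (hmono hmn))]
  exact iSup_le fun n => lintegral_truncated_le_modulus hX ν hν (hη n) c

end MeasureLowerBound

/-! ### Splitting a measure along a minimal cover -/

section CoveringSplit

/-- Gibbs' inequality: apply `log x ≤ x - 1` at `x = 1 / (N p i)` and average with the weights `p
i`. -/
lemma sum_mul_log_inv_le {ι : Type*} {s : Finset ι} {p : ι → ℝ} (hp : ∀ i ∈ s, 0 < p i)
    (hsum : ∑ i ∈ s, p i = 1) {N : ℕ} (hN : s.card ≤ N) :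
    ∑ i ∈ s, p i * Real.log (p i)⁻¹ ≤ Real.log N := by
  have hs : s.Nonempty := by
    by_contra h
    rw [Finset.not_nonempty_iff_eq_empty] at h
    rw [h] at hsum; simp at hsum
  have hN0 : (0 : ℝ) < N := by exact_mod_cast hs.card_pos.trans_le hN
  have h1 : ∀ i ∈ s, p i * Real.log (p i)⁻¹ ≤ p i * Real.log N + ((N : ℝ)⁻¹ - p i) := by
    intro i hi
    have h2 := Real.log_le_sub_one_of_pos (x := (p i)⁻¹ * (N : ℝ)⁻¹)
      (mul_pos (inv_pos.2 (hp i hi)) (inv_pos.2 hN0))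
    rw [Real.log_mul (inv_ne_zero (hp i hi).ne') (inv_ne_zero hN0.ne'), Real.log_inv (N : ℝ)] at h2
    have h3 := mul_le_mul_of_nonneg_left h2 (hp i hi).le
    have h4 : p i * ((p i)⁻¹ * (N : ℝ)⁻¹ - 1) = (N : ℝ)⁻¹ - p i := by
      have := (hp i hi).ne'
      field_simp
    rw [h4] at h3
    linarith
  refine (Finset.sum_le_sum h1).trans ?_
  rw [Finset.sum_add_distrib, ← Finset.sum_mul, hsum, Finset.sum_sub_distrib, hsum,
    Finset.sum_const, nsmul_eq_mul, one_mul]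
  have : (s.card : ℝ) * (N : ℝ)⁻¹ ≤ 1 := by
    rw [← div_eq_mul_inv, div_le_one hN0]; exact_mod_cast hN
  linarith

/-- Cauchy–Schwarz for the weights `p` moves the root outside the sum, where the entropy bound
applies. -/
lemma sum_mul_sqrt_logb_inv_le {ι : Type*} {s : Finset ι} {p : ι → ℝ} (hp : ∀ i ∈ s, 0 < p i)
    (hsum : ∑ i ∈ s, p i = 1) {N : ℕ} (hN : s.card ≤ N) :
    ∑ i ∈ s, p i * Real.sqrt (Real.logb 2 (p i)⁻¹) ≤ Real.sqrt (Real.logb 2 N) := by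
  have hl : (0 : ℝ) < Real.log 2 := Real.log_pos one_lt_two
  have hn : ∀ i ∈ s, 0 ≤ Real.logb 2 (p i)⁻¹ := fun i hi => by
    refine Real.logb_nonneg one_lt_two ((one_le_inv₀ (hp i hi)).2 ?_)
    rw [← hsum]
    exact Finset.single_le_sum (fun j hj => (hp j hj).le) hi
  have h1 := Finset.sum_sq_le_sum_mul_sum_of_sq_le_mul s
    (r := fun i => p i * Real.sqrt (Real.logb 2 (p i)⁻¹)) (f := p)
    (g := fun i => p i * Real.logb 2 (p i)⁻¹) (fun i hi => (hp i hi).le)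
    (fun i hi => mul_nonneg (hp i hi).le (hn i hi))
    (fun i hi => by rw [mul_pow, Real.sq_sqrt (hn i hi), sq, mul_assoc])
  rw [hsum, one_mul] at h1
  refine Real.le_sqrt_of_sq_le (h1.trans ?_)
  have h2 := sum_mul_log_inv_le hp hsum hN
  simp only [Real.logb, ← mul_div_assoc]
  rw [← Finset.sum_div]
  exact div_le_div_of_nonneg_right h2 hl.le

variable {T : Type u} [PseudoMetricSpace T]

/-- Compactness makes the covering number finite, so its `toNat` is the size of an actual minimal
cover. -/
lemma exists_minimal_cover [CompactSpace T] {δ : ℝ} (hδ : 0 < δ) :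
    ∃ C : Finset T, C.card = (Metric.coveringNumber δ.toNNReal (Set.univ : Set T)).toNat ∧
      ∀ t, ∃ c ∈ C, dist t c ≤ δ := by
  obtain ⟨C₀, -, hCfin, hCcov⟩ := Metric.exists_finite_isCover_of_isCompact
    (ε := δ.toNNReal) (s := (Set.univ : Set T)) (by simpa using hδ) isCompact_univ
  have hne : Metric.coveringNumber δ.toNNReal (Set.univ : Set T) ≠ ⊤ :=
    ne_top_of_le_ne_top (Set.encard_ne_top_iff.2 hCfin)
      (hCcov.coveringNumber_le_encard (Set.subset_univ _))
  obtain ⟨C, -, hfin, hC, hcard⟩ := Metric.exists_set_encard_eq_coveringNumber hne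
  refine ⟨hfin.toFinset, ?_, ?_⟩
  · rw [← hcard, hfin.encard_eq_coe_toFinset_card, ENat.toNat_natCast]
  · rw [isCover_univ_iff hδ.le] at hC
    simpa using hC

variable [MeasurableSpace T] [BorelSpace T] [CompactSpace T] {Ω : Type v} [MeasurableSpace Ω]
  {P : Measure Ω} {X : T → Ω → ℝ}

/-- Splitting of a probability measure along a minimal cover by balls of radius `δ`. -/
lemma mmFunctional_le_add (hX : IsCanonicalGaussian P X) (μ : Measure T) [IsProbabilityMeasure μ]
    {δ : ℝ} (hδ : 0 < δ) {c : ℝ} (hc : 0 < c) :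
    mmFunctional μ μ c ≤
      ENNReal.ofReal (c * sqrtLogCovering T δ) + 44000 * modulus P X δ := by
  classical
  obtain ⟨C, hCcard, hC⟩ := exists_minimal_cover (T := T) hδ
  have hT : Nonempty T := by
    by_contra h
    rw [not_nonempty_iff] at h
    have h1 := measure_univ (μ := μ)
    rw [Set.eq_empty_of_isEmpty Set.univ, measure_empty] at h1
    exact zero_ne_one h1
  obtain ⟨κ, hκC, hκ⟩ := exists_simpleFunc_dist_le C.finite_toSet
    (let ⟨c, hc, _⟩ := hC hT.some; ⟨c, hc⟩) hC
  let A : T → Set T := fun s => κ ⁻¹' {s}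
  have hA : ∀ s, MeasurableSet (A s) := κ.measurableSet_fiber
  let R : Finset T := κ.range.filter fun s => μ (A s) ≠ 0
  have hdisj : ∀ (B : Set T), B.PairwiseDisjoint A := fun B s _ s' _ hss =>
    Disjoint.preimage _ (by simpa using hss)
  have hU : (⋃ s ∈ κ.range, A s) = Set.univ := by
    ext u; simp [A]
  have hsum : ∑ s ∈ R, μ (A s) = 1 := by
    rw [Finset.sum_filter_ne_zero, ← measure_biUnion_finset (hdisj _) (fun s _ => hA s), hU,
      measure_univ]
  have hpos : ∀ s ∈ R, 0 < (μ (A s)).toReal := fun s hs =>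
    ENNReal.toReal_pos (Finset.mem_filter.1 hs).2 (measure_ne_top _ _)
  have hsum' : ∑ s ∈ R, (μ (A s)).toReal = 1 := by
    rw [← ENNReal.toReal_sum (fun s _ => measure_ne_top _ _), hsum, ENNReal.toReal_one]
  have hRC : R ⊆ C := fun s hs => by
    obtain ⟨t, rfl⟩ := SimpleFunc.mem_range.1 (Finset.mem_filter.1 hs).1
    exact hκC t
  -- On the fiber `A s`, a ball has `μ`-mass at least `μ (A s)` times its conditional mass. The
  -- first factor is the cost of splitting; the second gives the functional of the conditional
  -- measure, which lives on a `δ`-ball.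
  have hfiber : ∀ s ∈ R, ∫⁻ t in A s, (∫⁻ ε in Set.Ioc 0 c,
      sqrtLogInv (μ (Metric.closedBall t ε)) ∂volume) ∂μ ≤
      μ (A s) * (ENNReal.ofReal c * sqrtLogInv (μ (A s)) + 44000 * modulus P X δ) := by
    intro s hs
    have h0 : μ (A s) ≠ 0 := (Finset.mem_filter.1 hs).2
    have hprob : IsProbabilityMeasure (cond μ (A s)) := cond_isProbabilityMeasure h0
    have hres : μ.restrict (A s) = μ (A s) • cond μ (A s) := by
      rw [ProbabilityTheory.cond, smul_smul, ENNReal.mul_inv_cancel h0 (measure_ne_top _ _),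
        one_smul]
    have hball : cond μ (A s) (Metric.closedBall s δ) = 1 := by
      have h1 : A s ∩ Metric.closedBall s δ = A s := Set.inter_eq_left.2 fun u hu => by
        have hu : κ u = s := hu
        have := hκ u
        rw [hu] at this
        rwa [Metric.mem_closedBall, dist_comm]
      rw [cond_apply (hA s), h1, ENNReal.inv_mul_cancel h0 (measure_ne_top _ _)]
    have hmm := mmFunctional_le_modulus hX (cond μ (A s)) hball c
    have hle : ∀ t ε, sqrtLogInv (μ (Metric.closedBall t ε)) ≤
        sqrtLogInv (μ (A s)) + sqrtLogInv (cond μ (A s) (Metric.closedBall t ε)) := by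
      intro t ε
      refine (sqrtLogInv_anti ?_ (measure_ne_top _ _)).trans
        (sqrtLogInv_mul_le prob_le_one prob_le_one)
      rw [cond_apply (hA s), ← mul_assoc, ENNReal.mul_inv_cancel h0 (measure_ne_top _ _), one_mul]
      exact measure_mono Set.inter_subset_right
    rw [hres, lintegral_smul_measure, smul_eq_mul]
    gcongr
    calc _ ≤ ∫⁻ t, (ENNReal.ofReal c * sqrtLogInv (μ (A s)) + ∫⁻ ε in Set.Ioc 0 c,
          sqrtLogInv (cond μ (A s) (Metric.closedBall t ε)) ∂volume) ∂(cond μ (A s)) := by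
          refine lintegral_mono fun t => ?_
          refine (lintegral_mono (hle t)).trans ?_
          rw [lintegral_add_left measurable_const, setLIntegral_const, Real.volume_Ioc, sub_zero,
            mul_comm]
      _ = ENNReal.ofReal c * sqrtLogInv (μ (A s)) + mmFunctional (cond μ (A s)) (cond μ (A s)) c
          := by
          rw [lintegral_add_left measurable_const, lintegral_const, measure_univ, mul_one,
            mmFunctional]
      _ ≤ _ := by gcongr
  calc mmFunctional μ μ c = ∑ s ∈ κ.range, ∫⁻ t in A s, (∫⁻ ε in Set.Ioc 0 c,
        sqrtLogInv (μ (Metric.closedBall t ε)) ∂volume) ∂μ := by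
        rw [← lintegral_biUnion_finset (hdisj _) (fun s _ => hA s), hU, setLIntegral_univ,
          mmFunctional]
    _ = ∑ s ∈ R, ∫⁻ t in A s, (∫⁻ ε in Set.Ioc 0 c,
        sqrtLogInv (μ (Metric.closedBall t ε)) ∂volume) ∂μ := by
        symm
        refine Finset.sum_subset (Finset.filter_subset _ _) fun s hs hs' => ?_
        have : μ (A s) = 0 := by
          by_contra h
          exact hs' (Finset.mem_filter.2 ⟨hs, h⟩)
        exact setLIntegral_measure_zero _ _ this
    _ ≤ ∑ s ∈ R, μ (A s) * (ENNReal.ofReal c * sqrtLogInv (μ (A s)) + 44000 * modulus P X δ) :=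
        Finset.sum_le_sum hfiber
    _ = ENNReal.ofReal c * ∑ s ∈ R, μ (A s) * sqrtLogInv (μ (A s)) + 44000 * modulus P X δ := by
        simp_rw [mul_add]
        rw [Finset.sum_add_distrib, ← Finset.sum_mul, hsum, one_mul, Finset.mul_sum]
        congr 1
        exact Finset.sum_congr rfl fun s _ => by ring
    _ = ENNReal.ofReal c * ENNReal.ofReal (∑ s ∈ R, (μ (A s)).toReal *
          Real.sqrt (Real.logb 2 (μ (A s)).toReal⁻¹)) + 44000 * modulus P X δ := by
        rw [ENNReal.ofReal_sum_of_nonneg (fun s _ => by positivity)]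
        congr 2
        refine Finset.sum_congr rfl fun s hs => ?_
        rw [ENNReal.ofReal_mul ENNReal.toReal_nonneg, ENNReal.ofReal_toReal (measure_ne_top _ _),
          sqrtLogInv, if_neg (Finset.mem_filter.1 hs).2]
    _ ≤ _ := by
        rw [← ENNReal.ofReal_mul hc.le]
        gcongr
        rw [sqrtLogCovering, ← hCcard]
        exact sum_mul_sqrt_logb_inv_le hpos hsum' (Finset.card_le_card hRC)

lemma lowerBoundMM_le (hX : IsCanonicalGaussian P X) {δ : ℝ} (hδ : 0 < δ) :
    lowerBoundMM T δ ≤ 44000 * modulus P X δ :=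
  iSup_le fun _ => iSup_le fun hc => iSup_le fun μ =>
    tsub_le_iff_left.2 (mmFunctional_le_add hX (μ : Measure T) hδ hc)

end CoveringSplit

/-! ### Chaining through averages over balls -/

section Chaining

variable {V : Type*}

/-- The mean of `f` over `A` with respect to the weights `w`. -/
noncomputable def weightedMean (w : V → ℝ) (A : Finset V) (f : V → ℝ) : ℝ :=
  (∑ u ∈ A, w u)⁻¹ * ∑ u ∈ A, w u * f u

lemma weightedMean_sub_const (w : V → ℝ) {A : Finset V} (hA : 0 < ∑ u ∈ A, w u) (f : V → ℝ)
    (c : ℝ) : weightedMean w A f - c = (∑ u ∈ A, w u)⁻¹ * ∑ u ∈ A, w u * (f u - c) := by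
  have := hA.ne'
  simp only [mul_sub, Finset.sum_sub_distrib, ← Finset.sum_mul, weightedMean]
  field_simp

/-- As a double average over `A × B`, the difference involves only increments of `f`, to which the
energy applies. -/
lemma weightedMean_sub_weightedMean (w : V → ℝ) {A B : Finset V} (hA : 0 < ∑ u ∈ A, w u)
    (hB : 0 < ∑ u ∈ B, w u) (f : V → ℝ) :
    weightedMean w A f - weightedMean w B f = (∑ u ∈ A, w u)⁻¹ * (∑ u ∈ B, w u)⁻¹ *
      ∑ u ∈ A, ∑ v ∈ B, w u * w v * (f u - f v) := by
  have e : ∀ u ∈ A, ∑ v ∈ B, w u * w v * (f u - f v) =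
      w u * f u * (∑ v ∈ B, w v) - w u * ∑ v ∈ B, w v * f v := by
    intro u _
    rw [Finset.mul_sum, Finset.mul_sum, ← Finset.sum_sub_distrib]
    exact Finset.sum_congr rfl fun v _ => by ring
  rw [Finset.sum_congr rfl e, Finset.sum_sub_distrib, ← Finset.sum_mul, ← Finset.sum_mul,
    weightedMean, weightedMean]
  have := hA.ne'
  have := hB.ne'
  field_simp

lemma weightedMean_eq_of_forall (w : V → ℝ) {A : Finset V} (hA : 0 < ∑ u ∈ A, w u) {f : V → ℝ}
    {c : ℝ} (h : ∀ u ∈ A, f u = c) : weightedMean w A f = c := by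
  have h0 : ∑ u ∈ A, w u * (f u - c) = 0 := Finset.sum_eq_zero fun u hu => by
    rw [h u hu, sub_self, mul_zero]
  rw [← sub_eq_zero, weightedMean_sub_const w hA, h0, mul_zero]

/-- For `x > L ≥ 1`, `x - L ≤ x² - L²`, which the exponential dominates. The free level `L` splits
an increment into an entropy part and a part paid by the energy. -/
lemma le_add_exp_neg_sq_mul_exp_sq {x L : ℝ} (hx : 0 ≤ x) (hL : 1 ≤ L) :
    x ≤ L + Real.exp (-L ^ 2) * Real.exp (x ^ 2) := by
  rw [← Real.exp_add]
  rcases le_total x L with h | h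
  · have := Real.exp_pos (-L ^ 2 + x ^ 2)
    linarith
  · have := Real.add_one_le_exp (-L ^ 2 + x ^ 2)
    nlinarith

variable [PseudoMetricSpace V]

/-- The double sum of the subgaussian functional of the increments of `f`. -/
noncomputable def expEnergy [Fintype V] (w f : V → ℝ) : ℝ :=
  ∑ u, ∑ v, w u * w v * Real.exp (((f u - f v) / (2 * dist u v)) ^ 2)

lemma expEnergy_nonneg [Fintype V] {w : V → ℝ} (hw : ∀ u, 0 ≤ w u) (f : V → ℝ) :
    0 ≤ expEnergy w f :=
  Finset.sum_nonneg fun u _ => Finset.sum_nonneg fun v _ =>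
    mul_nonneg (mul_nonneg (hw u) (hw v)) (Real.exp_pos _).le

variable [Fintype V] {w : V → ℝ} {f : V → ℝ}

lemma abs_weightedMean_sub_le (hw : ∀ u, 0 ≤ w u) (hw1 : ∑ u, w u = 1)
    (hf : ∀ u v, dist u v = 0 → f u = f v) {A B : Finset V} (hA : 0 < ∑ u ∈ A, w u)
    (hB : 0 < ∑ u ∈ B, w u) {D : ℝ} (hD : 0 ≤ D) (hAB : ∀ u ∈ A, ∀ v ∈ B, dist u v ≤ D) :
    |weightedMean w A f - weightedMean w B f| ≤ 2 * D * (1 + Real.sqrt (Real.log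
      (1 / ∑ u ∈ A, w u)) + Real.sqrt (Real.log (1 / ∑ u ∈ B, w u)) + expEnergy w f) := by
  set a := ∑ u ∈ A, w u with ha
  set b := ∑ u ∈ B, w u with hb
  have ha1 : a ≤ 1 := by
    rw [ha, ← hw1]
    exact Finset.sum_le_sum_of_subset_of_nonneg (Finset.subset_univ _) fun u _ _ => hw u
  have hb1 : b ≤ 1 := by
    rw [hb, ← hw1]
    exact Finset.sum_le_sum_of_subset_of_nonneg (Finset.subset_univ _) fun u _ _ => hw u
  have la : 0 ≤ Real.log (1 / a) := Real.log_nonneg ((one_le_div hA).2 ha1)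
  have lb : 0 ≤ Real.log (1 / b) := Real.log_nonneg ((one_le_div hB).2 hb1)
  -- This level makes `exp (-L²) ≤ a * b`, which cancels the normalization `a⁻¹ * b⁻¹` of the double
  -- average in front of the energy.
  set L := Real.sqrt (1 + Real.log (1 / a) + Real.log (1 / b)) with hL
  have hL1 : 1 ≤ L := Real.one_le_sqrt.2 (by linarith)
  have hLle : L ≤ 1 + Real.sqrt (Real.log (1 / a)) + Real.sqrt (Real.log (1 / b)) := by
    rw [hL, Real.sqrt_le_left (by positivity)]
    nlinarith [Real.sq_sqrt la, Real.sq_sqrt lb, Real.sqrt_nonneg (Real.log (1 / a)),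
      Real.sqrt_nonneg (Real.log (1 / b)), mul_nonneg (Real.sqrt_nonneg (Real.log (1 / a)))
        (Real.sqrt_nonneg (Real.log (1 / b)))]
  have hexp : Real.exp (-L ^ 2) ≤ a * b := by
    rw [hL, Real.sq_sqrt (by linarith), one_div, one_div, Real.log_inv, Real.log_inv]
    calc _ ≤ Real.exp (Real.log a + Real.log b) := Real.exp_le_exp.2 (by linarith)
      _ = a * b := by rw [Real.exp_add, Real.exp_log hA, Real.exp_log hB]
  have hterm : ∀ u ∈ A, ∀ v ∈ B, |f u - f v| ≤
      2 * D * (L + a * b * Real.exp (((f u - f v) / (2 * dist u v)) ^ 2)) := by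
    intro u hu v hv
    set x := |f u - f v| / (2 * dist u v) with hx
    have hx0 : 0 ≤ x := by positivity
    have hxx : ((f u - f v) / (2 * dist u v)) ^ 2 = x ^ 2 := by
      rw [hx, div_pow, div_pow, sq_abs]
    have h1 : |f u - f v| ≤ 2 * D * x := by
      rcases eq_or_ne (dist u v) 0 with h | h
      · rw [hf u v h, sub_self, abs_zero]; positivity
      · have h2 : |f u - f v| = 2 * dist u v * x := by rw [hx]; field_simp
        rw [h2]
        have := hAB u hu v hv
        gcongr
    rw [hxx]
    refine h1.trans (mul_le_mul_of_nonneg_left ?_ (by positivity))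
    refine (le_add_exp_neg_sq_mul_exp_sq hx0 hL1).trans ?_
    gcongr
  rw [weightedMean_sub_weightedMean w hA hB, abs_mul,
    abs_of_nonneg (mul_nonneg (inv_nonneg.2 hA.le) (inv_nonneg.2 hB.le))]
  have hsum : |∑ u ∈ A, ∑ v ∈ B, w u * w v * (f u - f v)| ≤
      2 * D * (a * b * L + a * b * expEnergy w f) := by
    calc _ ≤ ∑ u ∈ A, ∑ v ∈ B, |w u * w v * (f u - f v)| :=
          (Finset.abs_sum_le_sum_abs _ _).trans
            (Finset.sum_le_sum fun u _ => Finset.abs_sum_le_sum_abs _ _)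
      _ ≤ ∑ u ∈ A, ∑ v ∈ B, (w u * (w v * (2 * D * L)) + 2 * D * (a * b) *
            (w u * w v * Real.exp (((f u - f v) / (2 * dist u v)) ^ 2))) := by
          refine Finset.sum_le_sum fun u hu => Finset.sum_le_sum fun v hv => ?_
          rw [abs_mul, abs_of_nonneg (mul_nonneg (hw u) (hw v))]
          refine (mul_le_mul_of_nonneg_left (hterm u hu v hv)
            (mul_nonneg (hw u) (hw v))).trans (le_of_eq ?_)
          ring
      _ = a * (b * (2 * D * L)) + 2 * D * (a * b) * ∑ u ∈ A, ∑ v ∈ B,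
            w u * w v * Real.exp (((f u - f v) / (2 * dist u v)) ^ 2) := by
          simp_rw [Finset.sum_add_distrib, ← Finset.mul_sum, ← Finset.sum_mul]
          rfl
      _ ≤ a * (b * (2 * D * L)) + 2 * D * (a * b) * expEnergy w f := by
          have h0 : ∀ u v, 0 ≤ w u * w v * Real.exp (((f u - f v) / (2 * dist u v)) ^ 2) :=
            fun u v => mul_nonneg (mul_nonneg (hw u) (hw v)) (Real.exp_pos _).le
          have hAB' : ∑ u ∈ A, ∑ v ∈ B, w u * w v *
              Real.exp (((f u - f v) / (2 * dist u v)) ^ 2) ≤ expEnergy w f :=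
            (Finset.sum_le_sum fun u _ => Finset.sum_le_sum_of_subset_of_nonneg
              (Finset.subset_univ _) fun v _ _ => h0 u v).trans
              (Finset.sum_le_sum_of_subset_of_nonneg (Finset.subset_univ _)
                fun u _ _ => Finset.sum_nonneg fun v _ => h0 u v)
          have := hAB'
          gcongr
      _ = _ := by ring
  calc _ ≤ a⁻¹ * b⁻¹ * (2 * D * (a * b * L + a * b * expEnergy w f)) :=
        mul_le_mul_of_nonneg_left hsum (mul_nonneg (inv_nonneg.2 hA.le) (inv_nonneg.2 hB.le))
    _ = 2 * D * (L + expEnergy w f) := by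
        have := hA.ne'
        have := hB.ne'
        field_simp
    _ ≤ _ := by gcongr

/-- On `(ρ / 2, ρ]`, of length `ρ / 2`, an antitone function is at least its value at `ρ`; the
dyadic intervals are disjoint. -/
lemma sum_range_mul_le_lintegral {h : ℝ → ℝ≥0∞} (hh : AntitoneOn h (Set.Ioi 0)) (n : ℕ) {ρ : ℝ}
    (hρ : 0 < ρ) : ∑ k ∈ Finset.range n, ENNReal.ofReal (ρ / 2 ^ k) * h (ρ / 2 ^ k) ≤
      2 * ∫⁻ ε in Set.Ioc 0 ρ, h ε := by
  induction n generalizing ρ with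
  | zero => simp
  | succ n ih =>
    have h1 : ENNReal.ofReal ρ * h ρ ≤ 2 * ∫⁻ ε in Set.Ioc (ρ / 2) ρ, h ε := by
      have h2 : ∫⁻ _ in Set.Ioc (ρ / 2) ρ, h ρ ≤ ∫⁻ ε in Set.Ioc (ρ / 2) ρ, h ε :=
        setLIntegral_mono' measurableSet_Ioc fun ε hε =>
          hh (Set.mem_Ioi.2 (by linarith [hε.1])) hρ hε.2
      rw [setLIntegral_const, Real.volume_Ioc, show ρ - ρ / 2 = ρ / 2 by ring] at h2
      calc ENNReal.ofReal ρ * h ρ = 2 * (h ρ * ENNReal.ofReal (ρ / 2)) := by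
            rw [show ρ = 2 * (ρ / 2) by ring, ENNReal.ofReal_mul (by norm_num)]
            simp only [ENNReal.ofReal_ofNat]
            rw [show 2 * (ρ / 2) = ρ by ring]
            ring
        _ ≤ _ := by gcongr
    rw [Finset.sum_range_succ', ← Set.Ioc_union_Ioc_eq_Ioc (half_pos hρ).le (half_le_self hρ.le),
      lintegral_union measurableSet_Ioc (Set.Ioc_disjoint_Ioc_of_le le_rfl), mul_add, pow_zero,
      div_one]
    refine add_le_add ?_ h1
    refine le_trans (le_of_eq (Finset.sum_congr rfl fun k _ => ?_)) (ih (half_pos hρ))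
    rw [pow_succ', ← div_div]

variable (w) in
lemma antitoneOn_sqrt_log_div (hw : ∀ u, 0 ≤ w u) (hw1 : ∑ u, w u = 1) {s : V} (hs : 0 < w s) :
    AntitoneOn (fun ε => ENNReal.ofReal
      (Real.sqrt (Real.log ((∑ u, w u) / ∑ u with dist u s ≤ ε, w u)))) (Set.Ici 0) := by
  intro ε hε ε' _ h
  have hpos : 0 < ∑ u with dist u s ≤ ε, w u :=
    hs.trans_le (Finset.single_le_sum (fun u _ => hw u) (by simpa using hε))
  refine ENNReal.ofReal_le_ofReal (Real.sqrt_le_sqrt ?_)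
  have hle : ∑ u with dist u s ≤ ε, w u ≤ ∑ u with dist u s ≤ ε', w u :=
    Finset.sum_le_sum_of_subset_of_nonneg
      (Finset.monotone_filter_right _ fun u _ hu => hu.trans h) fun u _ _ => hw u
  rw [hw1]
  exact Real.log_le_log (div_pos one_pos (hpos.trans_le hle))
    (div_le_div_of_nonneg_left zero_le_one hpos hle)

/-- Telescope the means over the balls of radius `ρ / 2 ^ k` around `s`. Each step costs its radius
times an entropy, and the dyadic sum is an integral. -/
lemma ofReal_abs_sub_weightedMean_le (hw : ∀ u, 0 ≤ w u) (hw1 : ∑ u, w u = 1)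
    (hf : ∀ u v, dist u v = 0 → f u = f v) {s : V} (hs : 0 < w s) {ρ : ℝ} (hρ : 0 < ρ) :
    ENNReal.ofReal |weightedMean w {u | dist u s ≤ ρ} f - f s| ≤
      ENNReal.ofReal (8 * ρ * (1 + expEnergy w f)) + 32 * ballEntropy w Finset.univ ρ s := by
  set h : ℝ → ℝ := fun ε => Real.sqrt (Real.log ((∑ u, w u) / ∑ u with dist u s ≤ ε, w u))
    with hh
  have hanti := antitoneOn_sqrt_log_div w hw hw1 hs
  have hpos : ∀ ε, 0 ≤ ε → 0 < ∑ u with dist u s ≤ ε, w u := fun ε hε =>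
    hs.trans_le (Finset.single_le_sum (fun u _ => hw u) (by simpa using hε))
  have hρk : ∀ k : ℕ, 0 < ρ / 2 ^ k := fun k => by positivity
  let m : ℕ → ℝ := fun k => weightedMean w {u | dist u s ≤ ρ / 2 ^ k} f
  have hQ := expEnergy_nonneg hw f
  -- As `V` is finite, a small ball contains only points at distance zero from `s`, where `f` takes
  -- the value `f s`; the chain is finite.
  obtain ⟨n, hn⟩ : ∃ n : ℕ, m n = f s := by
    have htend : Tendsto (fun k : ℕ => ρ / 2 ^ k) atTop (𝓝 0) := by
      have := (tendsto_pow_atTop_nhds_zero_of_lt_one (r := (1 / 2 : ℝ)) (by norm_num)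
        (by norm_num)).const_mul ρ
      rw [mul_zero] at this
      refine this.congr fun k => ?_
      rw [one_div, inv_pow, div_eq_mul_inv]
    have hev : ∀ᶠ k : ℕ in atTop, ∀ u, dist u s ≤ ρ / 2 ^ k → dist u s = 0 := by
      rw [eventually_all]
      intro u
      rcases eq_or_ne (dist u s) 0 with h0 | h0
      · exact Eventually.of_forall fun _ _ => h0
      · filter_upwards [htend.eventually_lt_const (lt_of_le_of_ne dist_nonneg h0.symm)] with k hk hk'
        exact absurd hk' (not_le.2 hk)
    obtain ⟨n, hn⟩ := hev.exists
    refine ⟨n, weightedMean_eq_of_forall w (hpos _ (hρk n).le) fun u hu => hf u s (hn u ?_)⟩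
    simpa using hu
  -- Two consecutive balls lie within `2ρ / 2 ^ k`. The entropy at the larger radius is absorbed in
  -- that at the smaller one, and `8ρ / 2 ^ k = 16ρ / 2 ^ (k + 1)`.
  have hstep : ∀ k : ℕ, dist (m k) (m (k + 1)) ≤
      4 * (ρ / 2 ^ k) * (1 + expEnergy w f) + 16 * (ρ / 2 ^ (k + 1) * h (ρ / 2 ^ (k + 1))) := by
    intro k
    have hle : ρ / 2 ^ (k + 1) ≤ ρ / 2 ^ k := by
      rw [pow_succ', ← div_div]
      have := hρk k
      exact div_le_div_of_nonneg_right (half_le_self hρ.le) (by positivity)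
    have h1 := abs_weightedMean_sub_le hw hw1 hf (hpos _ (hρk k).le) (hpos _ (hρk (k + 1)).le)
      (D := 2 * (ρ / 2 ^ k)) (by have := hρk k; positivity) (fun u hu v hv => by
        have hu : dist u s ≤ ρ / 2 ^ k := by simpa using hu
        have hv : dist v s ≤ ρ / 2 ^ (k + 1) := by simpa using hv
        have := dist_triangle_right u v s
        linarith)
    have h2 : h (ρ / 2 ^ k) ≤ h (ρ / 2 ^ (k + 1)) :=
      (ENNReal.ofReal_le_ofReal_iff (Real.sqrt_nonneg _)).1
        (hanti (hρk (k + 1)).le (hρk k).le hle)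
    have e1 : ∀ ε, Real.sqrt (Real.log (1 / ∑ u with dist u s ≤ ε, w u)) = h ε := fun ε => by
      rw [hh, hw1]
    rw [e1, e1] at h1
    rw [Real.dist_eq]
    refine h1.trans ?_
    have e2 : ρ / 2 ^ k = 2 * (ρ / 2 ^ (k + 1)) := by rw [pow_succ]; field_simp
    have e3 := hρk (k + 1)
    rw [e2] at h2 ⊢
    nlinarith [mul_le_mul_of_nonneg_left h2 e3.le]
  have htel := dist_le_range_sum_of_dist_le n fun {k} _ => hstep k
  rw [hn, Finset.sum_add_distrib, Real.dist_eq, ← Finset.sum_mul, ← Finset.mul_sum,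
    ← Finset.mul_sum] at htel
  have hgeo : ∑ k ∈ Finset.range n, ρ / 2 ^ k ≤ 2 * ρ := by
    have h1 := sum_geometric_two_le n
    calc _ = ρ * ∑ k ∈ Finset.range n, (1 / (2 : ℝ)) ^ k := by
          rw [Finset.mul_sum]
          exact Finset.sum_congr rfl fun k _ => by rw [one_div, inv_pow, div_eq_mul_inv]
      _ ≤ ρ * 2 := by gcongr
      _ = _ := mul_comm _ _
  have hm0 : m 0 = weightedMean w {u | dist u s ≤ ρ} f := by simp only [m, pow_zero, div_one]
  rw [← hm0]
  have h3 : |m 0 - f s| ≤ 8 * ρ * (1 + expEnergy w f) +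
      16 * ∑ k ∈ Finset.range n, ρ / 2 ^ (k + 1) * h (ρ / 2 ^ (k + 1)) := by
    refine htel.trans ?_
    nlinarith
  refine (ENNReal.ofReal_le_ofReal h3).trans ?_
  have hnn : ∀ k : ℕ, 0 ≤ ρ / 2 ^ k * h (ρ / 2 ^ k) := fun k =>
    mul_nonneg (hρk k).le (Real.sqrt_nonneg _)
  rw [ENNReal.ofReal_add (by positivity)
    (mul_nonneg (by norm_num) (Finset.sum_nonneg fun k _ => hnn _)),
    ENNReal.ofReal_mul (p := 16) (by norm_num), ENNReal.ofReal_sum_of_nonneg fun k _ => hnn _]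
  refine add_le_add le_rfl ?_
  have h4 := sum_range_mul_le_lintegral (hanti.mono Set.Ioi_subset_Ici_self) (n + 1) hρ
  rw [Finset.sum_range_succ'] at h4
  calc _ = ENNReal.ofReal 16 * ∑ k ∈ Finset.range n,
        ENNReal.ofReal (ρ / 2 ^ (k + 1)) * ENNReal.ofReal (h (ρ / 2 ^ (k + 1))) := by
        congr 1
        exact Finset.sum_congr rfl fun k _ => ENNReal.ofReal_mul (hρk _).le
    _ ≤ ENNReal.ofReal 16 * (2 * ballEntropy w Finset.univ ρ s) := by
        refine mul_le_mul_right (le_trans le_self_add h4) _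
    _ = _ := by rw [← mul_assoc]; norm_num

/-- The chaining bound of an increment, with the weights `w`. -/
lemma ofReal_abs_sub_le_ballEntropy (hw : ∀ u, 0 ≤ w u) (hw1 : ∑ u, w u = 1)
    (hf : ∀ u v, dist u v = 0 → f u = f v) {s t : V} (hs : 0 < w s) (ht : 0 < w t)
    {ρ : ℝ} (hρ : 0 < ρ) (hst : dist s t ≤ ρ) :
    ENNReal.ofReal |f s - f t| ≤ ENNReal.ofReal (22 * ρ * (1 + expEnergy w f)) +
      38 * (ballEntropy w Finset.univ ρ s + ballEntropy w Finset.univ ρ t) := by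
  have hQ := expEnergy_nonneg hw f
  have hpos : ∀ s, 0 < w s → 0 < ∑ u with dist u s ≤ ρ, w u := fun s hs =>
    hs.trans_le (Finset.single_le_sum (fun u _ => hw u) (by simpa using hρ.le))
  have h1 := ofReal_abs_sub_weightedMean_le hw hw1 hf hs hρ
  have h2 := ofReal_abs_sub_weightedMean_le hw hw1 hf ht hρ
  -- The link between the two chains: points of the balls around `s` and `t` are within `3ρ`. With
  -- the two chains the constants are `8 + 6 + 8 = 22` and `32 + 6 = 38`.
  have h3 := abs_weightedMean_sub_le hw hw1 hf (hpos s hs) (hpos t ht) (D := 3 * ρ)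
    (by positivity) (fun u hu v hv => by
      have hu : dist u s ≤ ρ := by simpa using hu
      have hv : dist v t ≤ ρ := by simpa using hv
      have := dist_triangle4 u s t v
      rw [dist_comm t v] at this
      linarith)
  have h4 : ∀ s, 0 < w s → ENNReal.ofReal (ρ * Real.sqrt (Real.log
      (1 / ∑ u with dist u s ≤ ρ, w u))) ≤ ballEntropy w Finset.univ ρ s := by
    intro s hs
    have h5 : ∫⁻ _ in Set.Ioc 0 ρ, ENNReal.ofReal (Real.sqrt (Real.log
        ((∑ u, w u) / ∑ u with dist u s ≤ ρ, w u))) ≤ ballEntropy w Finset.univ ρ s :=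
      setLIntegral_mono' measurableSet_Ioc fun ε hε =>
        antitoneOn_sqrt_log_div w hw hw1 hs hε.1.le hρ.le hε.2
    rw [setLIntegral_const, Real.volume_Ioc, sub_zero, hw1] at h5
    rwa [ENNReal.ofReal_mul hρ.le, mul_comm]
  set m := weightedMean w {u | dist u s ≤ ρ} f
  set m' := weightedMean w {u | dist u t ≤ ρ} f
  set L := Real.sqrt (Real.log (1 / ∑ u with dist u s ≤ ρ, w u))
  set L' := Real.sqrt (Real.log (1 / ∑ u with dist u t ≤ ρ, w u))
  have hL : 0 ≤ L := Real.sqrt_nonneg _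
  have hL' : 0 ≤ L' := Real.sqrt_nonneg _
  have h6 : |f s - f t| ≤ |m - f s| + (6 * ρ * (1 + expEnergy w f) + 6 * (ρ * L) + 6 * (ρ * L')) +
      |m' - f t| := by
    have e1 := abs_sub_le (f s) m (f t)
    have e2 := abs_sub_le m m' (f t)
    rw [abs_sub_comm (f s) m] at e1
    nlinarith
  refine (ENNReal.ofReal_le_ofReal h6).trans ?_
  rw [ENNReal.ofReal_add (by positivity) (by positivity),
    ENNReal.ofReal_add (by positivity) (by positivity),
    ENNReal.ofReal_add (by positivity) (by positivity),
    ENNReal.ofReal_add (by positivity) (by positivity), ENNReal.ofReal_mul (p := 6) (by norm_num),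
    ENNReal.ofReal_mul (p := 6) (by norm_num)]
  calc _ ≤ (ENNReal.ofReal (8 * ρ * (1 + expEnergy w f)) + 32 * ballEntropy w Finset.univ ρ s) +
        (ENNReal.ofReal (6 * ρ * (1 + expEnergy w f)) +
          ENNReal.ofReal 6 * ballEntropy w Finset.univ ρ s +
          ENNReal.ofReal 6 * ballEntropy w Finset.univ ρ t) +
        (ENNReal.ofReal (8 * ρ * (1 + expEnergy w f)) + 32 * ballEntropy w Finset.univ ρ t) := by
        gcongr
        · exact h4 s hs
        · exact h4 t ht
    _ = (ENNReal.ofReal (8 * ρ * (1 + expEnergy w f)) +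
          ENNReal.ofReal (6 * ρ * (1 + expEnergy w f)) +
          ENNReal.ofReal (8 * ρ * (1 + expEnergy w f))) +
          38 * (ballEntropy w Finset.univ ρ s + ballEntropy w Finset.univ ρ t) := by
        simp only [ENNReal.ofReal_ofNat]
        ring
    _ = _ := by
        rw [← ENNReal.ofReal_add (by positivity) (by positivity),
          ← ENNReal.ofReal_add (by positivity) (by positivity)]
        congr 2
        ring

end Chaining

/-! ### Expected largest increment, with weights adapted to the maximizer -/

section GaussianChaining

/-- Against the density, `exp (x² / 4)` leaves the integrable `exp (-x² / 4)`; the value is `√2`.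
This is why increments are divided by twice the distance. -/
lemma lintegral_exp_sq_gaussianReal_le :
    ∫⁻ x, ENNReal.ofReal (Real.exp ((x / 2) ^ 2)) ∂(gaussianReal 0 1) ≤ 2 := by
  rw [gaussianReal_of_var_ne_zero _ one_ne_zero,
    lintegral_withDensity_eq_lintegral_mul _ (measurable_gaussianPDF 0 1) (by fun_prop)]
  have e : ∀ x : ℝ, (gaussianPDF 0 1 * fun x => ENNReal.ofReal (Real.exp ((x / 2) ^ 2))) x =
      ENNReal.ofReal ((Real.sqrt (2 * Real.pi))⁻¹ * Real.exp (-(1 / 4) * x ^ 2)) := by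
    intro x
    rw [Pi.mul_apply, gaussianPDF, ← ENNReal.ofReal_mul (gaussianPDFReal_nonneg _ _ _),
      gaussianPDFReal, mul_assoc, ← Real.exp_add]
    simp only [NNReal.coe_one, mul_one, sub_zero]
    congr 3
    ring
  simp_rw [e]
  rw [← ofReal_integral_eq_lintegral_ofReal
    ((integrable_exp_neg_mul_sq (by norm_num)).const_mul _) (ae_of_all _ fun x => by positivity),
    integral_const_mul, integral_gaussian]
  rw [show (2 : ℝ≥0∞) = ENNReal.ofReal 2 by norm_num]
  refine ENNReal.ofReal_le_ofReal ?_
  rw [inv_mul_le_iff₀ (by positivity), Real.sqrt_le_left (by positivity), mul_pow,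
    Real.sq_sqrt (by positivity)]
  nlinarith [Real.pi_pos]

section FiniteProcess

variable {V : Type*} [Fintype V] [PseudoMetricSpace V] {μ : Measure (V → ℝ)} [IsGaussian μ]

lemma lintegral_exp_increment_le (hμ : ∀ i, ∫ x : V → ℝ, x i ∂μ = 0)
    (hd : ∀ i j, ∫ x : V → ℝ, (x i - x j) ^ 2 ∂μ = dist i j ^ 2) (s t : V) :
    ∫⁻ x, ENNReal.ofReal (Real.exp (((x s - x t) / (2 * dist s t)) ^ 2)) ∂μ ≤ 2 := by
  -- At distance zero division by zero gives the integrand `exp 0 = 1`.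
  rcases eq_or_ne (dist s t) 0 with h0 | h0
  · simp [h0]
  have hm : Measurable fun y : ℝ => ENNReal.ofReal (Real.exp ((y / (2 * dist s t)) ^ 2)) := by
    fun_prop
  have h := gaussianReal_map_const_mul (μ := 0) (v := 1) (dist s t)
  have e : NNReal.mk (dist s t ^ 2) (sq_nonneg _) * 1 = (dist s t ^ 2).toNNReal := by
    rw [mul_one, Real.toNNReal_of_nonneg (sq_nonneg _)]
  rw [mul_zero, e, ← map_eval_sub_eq_gaussianReal hμ hd] at h
  have h1 : ∫⁻ x, ENNReal.ofReal (Real.exp (((x s - x t) / (2 * dist s t)) ^ 2)) ∂μ =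
      ∫⁻ y, ENNReal.ofReal (Real.exp ((y / (2 * dist s t)) ^ 2))
        ∂(μ.map fun x : V → ℝ => x s - x t) := (lintegral_map hm (by fun_prop)).symm
  rw [h1, ← h, lintegral_map hm (by fun_prop)]
  refine le_trans (le_of_eq (lintegral_congr fun y => ?_)) lintegral_exp_sq_gaussianReal_le
  rw [mul_comm 2, mul_div_mul_left _ _ h0]

lemma measurable_expEnergy (w : V → ℝ) : Measurable fun x : V → ℝ => expEnergy w x := by
  unfold expEnergy
  fun_prop

lemma lintegral_expEnergy_le (hμ : ∀ i, ∫ x : V → ℝ, x i ∂μ = 0)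
    (hd : ∀ i j, ∫ x : V → ℝ, (x i - x j) ^ 2 ∂μ = dist i j ^ 2) {w : V → ℝ}
    (hw : ∀ u, 0 ≤ w u) (hw1 : ∑ u, w u = 1) :
    ∫⁻ x, ENNReal.ofReal (expEnergy w x) ∂μ ≤ 2 := by
  have h0 : ∀ (x : V → ℝ) u v, 0 ≤ w u * w v * Real.exp (((x u - x v) / (2 * dist u v)) ^ 2) :=
    fun x u v => mul_nonneg (mul_nonneg (hw u) (hw v)) (Real.exp_pos _).le
  have e : ∀ x : V → ℝ, ENNReal.ofReal (expEnergy w x) = ∑ u, ∑ v, ENNReal.ofReal (w u) *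
      (ENNReal.ofReal (w v) * ENNReal.ofReal (Real.exp (((x u - x v) / (2 * dist u v)) ^ 2))) := by
    intro x
    rw [expEnergy, ENNReal.ofReal_sum_of_nonneg fun u _ => Finset.sum_nonneg fun v _ => h0 x u v]
    refine Finset.sum_congr rfl fun u _ => ?_
    rw [ENNReal.ofReal_sum_of_nonneg fun v _ => h0 x u v]
    refine Finset.sum_congr rfl fun v _ => ?_
    rw [ENNReal.ofReal_mul (mul_nonneg (hw u) (hw v)), ENNReal.ofReal_mul (hw u), mul_assoc]
  have hsum : ∑ u, ENNReal.ofReal (w u) = 1 := by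
    rw [← ENNReal.ofReal_sum_of_nonneg fun u _ => hw u, hw1, ENNReal.ofReal_one]
  simp_rw [e]
  rw [lintegral_finsetSum _ fun u _ => by fun_prop]
  calc _ = ∑ u, ∑ v, ENNReal.ofReal (w u) * (ENNReal.ofReal (w v) *
        ∫⁻ x, ENNReal.ofReal (Real.exp (((x u - x v) / (2 * dist u v)) ^ 2)) ∂μ) := by
        refine Finset.sum_congr rfl fun u _ => ?_
        rw [lintegral_finsetSum _ fun u _ => by fun_prop]
        refine Finset.sum_congr rfl fun v _ => ?_
        rw [lintegral_const_mul _ (by fun_prop), lintegral_const_mul _ (by fun_prop)]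
    _ ≤ ∑ u, ∑ v, ENNReal.ofReal (w u) * (ENNReal.ofReal (w v) * 2) := by
        gcongr with u _ v _
        exact lintegral_exp_increment_le hμ hd u v
    _ = 2 := by
        simp_rw [← Finset.mul_sum, ← Finset.sum_mul]
        rw [hsum, one_mul, one_mul]

lemma ae_eq_of_dist_eq_zero (hd : ∀ i j, ∫ x : V → ℝ, (x i - x j) ^ 2 ∂μ = dist i j ^ 2) :
    ∀ᵐ x ∂μ, ∀ u v, dist u v = 0 → x u = x v := by
  rw [ae_all_iff]; intro u
  rw [ae_all_iff]; intro v
  rcases eq_or_ne (dist u v) 0 with h | h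
  · have h1 := hd u v
    rw [h, zero_pow two_ne_zero, integral_eq_zero_iff_of_nonneg (fun x => sq_nonneg _)
      (IsGaussian.integrable_eval_sub_sq μ u v)] at h1
    filter_upwards [h1] with x hx _
    exact sub_eq_zero.1 (pow_eq_zero_iff two_ne_zero |>.1 hx)
  · exact ae_of_all _ fun x hx => absurd hx h

/-- Equal shares among the maximizing indices give a measurable substitute for choosing one of them.
-/
lemma exists_argmax_weights {ι α : Type*} [Fintype ι] [Nonempty ι] [MeasurableSpace α]
    {g : ι → α → ℝ≥0∞} (hg : ∀ i, Measurable (g i)) :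
    ∃ φ : ι → α → ℝ≥0∞, (∀ i, Measurable (φ i)) ∧ (∀ x, ∑ i, φ i x = 1) ∧
      ∀ x, ⨆ i, g i x = ∑ i, φ i x * g i x := by
  let A : ι → Set α := fun i => {x | g i x = ⨆ j, g j x}
  have hA : ∀ i, MeasurableSet (A i) := fun i => measurableSet_eq_fun (hg i) (.iSup hg)
  let N : α → ℝ≥0∞ := fun x => ∑ i, (A i).indicator 1 x
  have hN : Measurable N := Finset.measurable_sum _ fun i _ => measurable_one.indicator (hA i)
  have hN0 : ∀ x, N x ≠ 0 := fun x h => by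
    obtain ⟨i, hi⟩ := exists_eq_ciSup_of_finite (f := fun i => g i x)
    have := (Finset.sum_eq_zero_iff.1 h) i (Finset.mem_univ i)
    rw [Set.indicator_of_mem (show x ∈ A i from hi)] at this
    exact one_ne_zero this
  have hNtop : ∀ x, N x ≠ ∞ := fun x => ENNReal.sum_ne_top.2 fun i _ =>
    ne_top_of_le_ne_top ENNReal.one_ne_top (Set.indicator_le_self' (fun _ _ => zero_le) x)
  have h1 : ∀ x, ∑ i, (N x)⁻¹ * (A i).indicator 1 x = 1 := fun x => by
    rw [← Finset.mul_sum]
    exact ENNReal.inv_mul_cancel (hN0 x) (hNtop x)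
  refine ⟨fun i x => (N x)⁻¹ * (A i).indicator 1 x,
    fun i => hN.inv.mul (measurable_one.indicator (hA i)), h1, fun x => ?_⟩
  have h2 : ∀ i, (N x)⁻¹ * (A i).indicator 1 x * g i x =
      (N x)⁻¹ * (A i).indicator 1 x * ⨆ j, g j x := by
    intro i
    by_cases hx : x ∈ A i
    · rw [show g i x = ⨆ j, g j x from hx]
    · rw [Set.indicator_of_notMem hx, mul_zero, zero_mul, zero_mul]
  simp_rw [h2]
  rw [← Finset.sum_mul, h1, one_mul]

/-- Fernique's choice of weights. Chaining holds for any weights positive at the endpoints, so they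
may be the law of a random endpoint of the maximizing pair. Averaging the endpoint entropies over
the maximizer then integrates the entropy of `w` against `w`. The constants are `66 = 22 * (1 + 2)`,
the energy having mean at most `2`, and `76 = 2 * 38`. -/
lemma exists_weights_lintegral_iSup_le (hμ : ∀ i, ∫ x : V → ℝ, x i ∂μ = 0)
    (hd : ∀ i j, ∫ x : V → ℝ, (x i - x j) ^ 2 ∂μ = dist i j ^ 2) {J : Finset (V × V)}
    (hJ : J.Nonempty) {ρ : ℝ} (hρ : 0 < ρ) (hJρ : ∀ p ∈ J, dist p.1 p.2 ≤ ρ) :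
    ∃ w : V → ℝ, (∀ u, 0 ≤ w u) ∧ ∑ u, w u = 1 ∧
      ∫⁻ x, ⨆ p : J, ENNReal.ofReal |x p.1.1 - x p.1.2| ∂μ ≤ ENNReal.ofReal (66 * ρ) +
        76 * ∑ u, ENNReal.ofReal (w u) * ballEntropy w Finset.univ ρ u := by
  classical
  have : Nonempty J := hJ.to_subtype
  obtain ⟨φ, hφm, hφ1, hφ⟩ := exists_argmax_weights (ι := J) (α := V → ℝ)
    (g := fun p x => ENNReal.ofReal |x p.1.1 - x p.1.2|) (fun p => by fun_prop)
  let q : J → ℝ≥0∞ := fun p => ∫⁻ x, φ p x ∂μ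
  have hq1 : ∑ p, q p = 1 := by
    rw [← lintegral_finsetSum _ fun p _ => hφm p]
    simp_rw [hφ1]
    simp
  -- The pair `p` is maximal with probability `q p`; each of its endpoints receives half of that
  -- mass.
  let W : V → ℝ≥0∞ := fun u => 2⁻¹ * ∑ p : J, q p *
    ((if u = p.1.1 then 1 else 0) + (if u = p.1.2 then 1 else 0))
  have hWsum : ∀ b : V → ℝ≥0∞, 2 * ∑ u, W u * b u = ∑ p : J, q p * (b p.1.1 + b p.1.2) := by
    intro b
    calc _ = ∑ u, ∑ p : J, q p *
          ((if u = p.1.1 then b u else 0) + (if u = p.1.2 then b u else 0)) := by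
          rw [Finset.mul_sum]
          refine Finset.sum_congr rfl fun u _ => ?_
          simp only [W]
          rw [← mul_assoc, ← mul_assoc, ENNReal.mul_inv_cancel two_ne_zero ENNReal.ofNat_ne_top,
            one_mul, Finset.sum_mul]
          refine Finset.sum_congr rfl fun p _ => ?_
          rw [mul_assoc, add_mul, ite_mul, ite_mul, one_mul, zero_mul]
      _ = _ := by
          rw [Finset.sum_comm]
          refine Finset.sum_congr rfl fun p _ => ?_
          rw [← Finset.mul_sum, Finset.sum_add_distrib, Finset.sum_ite_eq', Finset.sum_ite_eq']
          simp
  have hW1 : ∑ u, W u = 1 := by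
    have h := hWsum 1
    simp only [Pi.one_apply, mul_one] at h
    rw [← Finset.sum_mul, hq1, one_mul, one_add_one_eq_two] at h
    exact (ENNReal.mul_right_inj two_ne_zero ENNReal.ofNat_ne_top).1 (h.trans (mul_one 2).symm)
  have hWtop : ∀ u, W u ≠ ∞ := fun u =>
    ne_top_of_le_ne_top ENNReal.one_ne_top (hW1 ▸ Finset.single_le_sum (f := W)
      (fun _ _ => zero_le) (Finset.mem_univ u))
  let w : V → ℝ := fun u => (W u).toReal
  have hw0 : ∀ u, 0 ≤ w u := fun u => ENNReal.toReal_nonneg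
  have hofw : ∀ u, ENNReal.ofReal (w u) = W u := fun u => ENNReal.ofReal_toReal (hWtop u)
  have hw1 : ∑ u, w u = 1 := by
    rw [← ENNReal.toReal_sum fun u _ => hWtop u, hW1, ENNReal.toReal_one]
  have hqw : ∀ p : J, q p ≠ 0 → 0 < w p.1.1 ∧ 0 < w p.1.2 := by
    intro p hp
    have : ∀ u, (u = p.1.1 ∨ u = p.1.2) → 0 < w u := by
      intro u hu
      refine ENNReal.toReal_pos (fun h => ?_) (hWtop u)
      have h1 := (mul_eq_zero.1 h).resolve_left (by simp)
      have h2 := (Finset.sum_eq_zero_iff.1 h1) p (Finset.mem_univ p)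
      rcases mul_eq_zero.1 h2 with h3 | h3
      · exact hp h3
      · rcases hu with hu | hu <;> simp [hu] at h3
    exact ⟨this _ (.inl rfl), this _ (.inr rfl)⟩
  refine ⟨w, hw0, hw1, ?_⟩
  set b := fun u => ballEntropy w Finset.univ ρ u with hb
  let R : (V → ℝ) → ℝ≥0∞ := fun x => ENNReal.ofReal (22 * ρ * (1 + expEnergy w x))
  have hRm : Measurable R := by
    have := measurable_expEnergy w
    fun_prop
  have hφR : ∀ p, Measurable fun x => φ p x * R x := fun p => (hφm p).mul hRm
  have hφX : ∀ p, Measurable fun x : V → ℝ => φ p x * ENNReal.ofReal |x p.1.1 - x p.1.2| :=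
    fun p => (hφm p).mul (by fun_prop)
  have hR : ∫⁻ x, R x ∂μ ≤ ENNReal.ofReal (66 * ρ) := by
    have e : ∀ x, R x = ENNReal.ofReal (22 * ρ) * (1 + ENNReal.ofReal (expEnergy w x)) := fun x => by
      rw [← ENNReal.ofReal_one, ← ENNReal.ofReal_add zero_le_one (expEnergy_nonneg hw0 x),
        ← ENNReal.ofReal_mul (by positivity)]
    simp_rw [e]
    rw [lintegral_const_mul' _ _ ENNReal.ofReal_ne_top, lintegral_add_left measurable_const,
      lintegral_one, measure_univ]
    calc _ ≤ ENNReal.ofReal (22 * ρ) * (1 + 2) := by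
          gcongr
          exact lintegral_expEnergy_le hμ hd hw0 hw1
      _ = _ := by
          rw [show (1 + 2 : ℝ≥0∞) = ENNReal.ofReal 3 by norm_num,
            ← ENNReal.ofReal_mul (by positivity)]
          congr 1; ring
  -- Pairs that are almost surely never maximal contribute nothing. For the others both endpoints
  -- carry positive weight, as chaining requires.
  have hp : ∀ p : J, ∫⁻ x, φ p x * ENNReal.ofReal |x p.1.1 - x p.1.2| ∂μ ≤
      ∫⁻ x, φ p x * R x ∂μ + 38 * (q p * (b p.1.1 + b p.1.2)) := by
    intro p
    rcases eq_or_ne (q p) 0 with h0 | h0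
    · have h1 := (lintegral_eq_zero_iff (hφm p)).1 h0
      rw [lintegral_congr_ae (g := 0) (by
        filter_upwards [h1] with x hx
        rw [hx]; simp)]
      simp
    · obtain ⟨h1, h2⟩ := hqw p h0
      calc _ ≤ ∫⁻ x, (φ p x * R x + φ p x * (38 * (b p.1.1 + b p.1.2))) ∂μ := by
            refine lintegral_mono_ae ?_
            filter_upwards [ae_eq_of_dist_eq_zero hd] with x hx
            rw [← mul_add]
            gcongr
            exact ofReal_abs_sub_le_ballEntropy hw0 hw1 hx h1 h2 hρ (hJρ _ p.2)
        _ = _ := by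
            rw [lintegral_add_left (hφR p), lintegral_mul_const _ (hφm p)]
            ring
  simp_rw [hφ]
  rw [lintegral_finsetSum _ fun p _ => hφX p]
  calc _ ≤ ∑ p : J, (∫⁻ x, φ p x * R x ∂μ + 38 * (q p * (b p.1.1 + b p.1.2))) :=
        Finset.sum_le_sum fun p _ => hp p
    _ = ∫⁻ x, R x ∂μ + 76 * ∑ u, W u * b u := by
        rw [Finset.sum_add_distrib, ← Finset.mul_sum, ← hWsum b,
          ← lintegral_finsetSum _ fun p _ => hφR p]
        simp_rw [← Finset.sum_mul, hφ1, one_mul]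
        rw [← mul_assoc]
        norm_num
    _ ≤ _ := by
        simp_rw [hofw]
        gcongr

end FiniteProcess

end GaussianChaining

/-! ### Discrete measures as competitors in `supMM` -/

section SupMM

variable {T : Type u} [PseudoMetricSpace T] [MeasurableSpace T]

lemma mmFunctional_mono (μ ν : Measure T) {r r' : ℝ} (h : r ≤ r') :
    mmFunctional μ ν r ≤ mmFunctional μ ν r' :=
  lintegral_mono fun _ => lintegral_mono_set (Set.Ioc_subset_Ioc_right h)

lemma supMM_mono {r r' : ℝ} (h : r ≤ r') : supMM T r ≤ supMM T r' :=
  iSup_mono fun _ => mmFunctional_mono _ _ h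

lemma mmFunctional_le_supMM (μ : Measure T) [IsProbabilityMeasure μ] (r : ℝ) :
    mmFunctional μ μ r ≤ supMM T r :=
  le_iSup (fun μ : ProbabilityMeasure T => mmFunctional (μ : Measure T) (μ : Measure T) r)
    ⟨μ, inferInstance⟩

variable [BorelSpace T]

/-- For half a unit mass at `s` and half at `t`, balls around either point of radius less than `dist
s t` have mass at most `1/2`, so the integrand is at least `1` there. This later absorbs the
additive multiple of the radius left by chaining. -/
lemma ofReal_dist_le_supMM [SecondCountableTopology T] {s t : T} {r : ℝ} (h : dist s t ≤ r) :
    ENNReal.ofReal (dist s t) ≤ supMM T r := by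
  let μ : Measure T := (2⁻¹ : ℝ≥0∞) • (Measure.dirac s + Measure.dirac t)
  have hμ : IsProbabilityMeasure μ := ⟨by
    simp only [μ, Measure.smul_apply, Measure.add_apply, measure_univ, smul_eq_mul]
    rw [one_add_one_eq_two, ENNReal.inv_mul_cancel two_ne_zero ENNReal.ofNat_ne_top]⟩
  have hhalf : (1 : ℝ≥0∞) ≤ sqrtLogInv 2⁻¹ := by
    rw [sqrtLogInv, if_neg (by simp)]
    simp
  have key : ∀ a b : T, (a = s ∧ b = t) ∨ (a = t ∧ b = s) → ENNReal.ofReal (dist s t) ≤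
      ∫⁻ ε in Set.Ioc 0 r, sqrtLogInv (μ (Metric.closedBall a ε)) := by
    intro a b hab
    have hd : dist b a = dist s t := by
      rcases hab with ⟨rfl, rfl⟩ | ⟨rfl, rfl⟩
      · exact dist_comm _ _
      · rfl
    calc ENNReal.ofReal (dist s t) = ∫⁻ _ in Set.Ioo 0 (dist s t), 1 := by
          rw [setLIntegral_one, Real.volume_Ioo, sub_zero]
      _ ≤ ∫⁻ ε in Set.Ioo 0 (dist s t), sqrtLogInv (μ (Metric.closedBall a ε)) := by
          refine setLIntegral_mono' measurableSet_Ioo fun ε hε => hhalf.trans ?_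
          refine sqrtLogInv_anti ?_ (by simp)
          have h0 : Measure.dirac b (Metric.closedBall a ε) = 0 := by
            rw [Measure.dirac_apply' _ Metric.isClosed_closedBall.measurableSet,
              Set.indicator_of_notMem]
            rw [Metric.mem_closedBall, hd]
            exact not_le.2 hε.2
          have h1 : μ (Metric.closedBall a ε) = 2⁻¹ * Measure.dirac a (Metric.closedBall a ε) := by
            simp only [μ, Measure.smul_apply, Measure.add_apply, smul_eq_mul]
            rcases hab with ⟨rfl, rfl⟩ | ⟨rfl, rfl⟩
            · rw [h0, add_zero]
            · rw [h0, zero_add]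
          rw [h1]
          exact mul_le_of_le_one_right' prob_le_one
      _ ≤ _ := lintegral_mono_set (Set.Ioo_subset_Ioc_self.trans (Set.Ioc_subset_Ioc_right h))
  refine le_trans ?_ (mmFunctional_le_supMM μ r)
  rw [mmFunctional]
  have hm := measurable_lintegral_sqrtLogInv μ (Set.Ioc 0 r)
  nth_rewrite 2 [show μ = (2⁻¹ : ℝ≥0∞) • (Measure.dirac s + Measure.dirac t) from rfl]
  rw [lintegral_smul_measure, lintegral_add_measure, lintegral_dirac' _ hm, lintegral_dirac' _ hm,
    smul_eq_mul]
  calc ENNReal.ofReal (dist s t) = 2⁻¹ * (ENNReal.ofReal (dist s t) + ENNReal.ofReal (dist s t)) := by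
        rw [← two_mul, ← mul_assoc, ENNReal.inv_mul_cancel two_ne_zero ENNReal.ofNat_ne_top,
          one_mul]
    _ ≤ _ := by
        gcongr
        · exact key s t (.inl ⟨rfl, rfl⟩)
        · exact key t s (.inr ⟨rfl, rfl⟩)

lemma sum_ballEntropy_le_supMM [SecondCountableTopology T] {S : Finset T} {w : S → ℝ}
    (hw : ∀ u, 0 ≤ w u) (hw1 : ∑ u, w u = 1) (r : ℝ) :
    ∑ u, ENNReal.ofReal (w u) * ballEntropy w Finset.univ r u ≤ supMM T r := by
  let μ : Measure T := ∑ u, ENNReal.ofReal (w u) • Measure.dirac (u : T)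
  have hμ : IsProbabilityMeasure μ := ⟨by
    simp only [μ, Measure.coe_finsetSum, Finset.sum_apply, Measure.smul_apply, measure_univ,
      smul_eq_mul, mul_one]
    rw [← ENNReal.ofReal_sum_of_nonneg fun u _ => hw u, hw1, ENNReal.ofReal_one]⟩
  have hball : ∀ (t : T) ε, μ (Metric.closedBall t ε) =
      ENNReal.ofReal (∑ u ∈ Finset.univ.filter fun u : S => dist (u : T) t ≤ ε, w u) := by
    intro t ε
    simp only [μ, Measure.coe_finsetSum, Finset.sum_apply, Measure.smul_apply, smul_eq_mul]
    rw [ENNReal.ofReal_sum_of_nonneg fun u _ => hw u, Finset.sum_filter]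
    refine Finset.sum_congr rfl fun u _ => ?_
    rw [Measure.dirac_apply' _ Metric.isClosed_closedBall.measurableSet]
    by_cases h : dist (u : T) t ≤ ε
    · rw [if_pos h, Set.indicator_of_mem (Metric.mem_closedBall.2 h), Pi.one_apply, mul_one]
    · rw [if_neg h, Set.indicator_of_notMem (fun h' => h (Metric.mem_closedBall.1 h')), mul_zero]
  refine le_trans ?_ (mmFunctional_le_supMM μ r)
  rw [mmFunctional]
  have hm := measurable_lintegral_sqrtLogInv μ (Set.Ioc 0 r)
  nth_rewrite 2 [show μ = ∑ u, ENNReal.ofReal (w u) • Measure.dirac (u : T) from rfl]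
  rw [lintegral_finsetSum_measure]
  refine Finset.sum_le_sum fun u _ => ?_
  rw [lintegral_smul_measure, lintegral_dirac' _ hm, smul_eq_mul]
  rcases (hw u).eq_or_lt with h0 | h0
  · rw [← h0, ENNReal.ofReal_zero, zero_mul, zero_mul]
  gcongr
  refine setLIntegral_mono' measurableSet_Ioc fun ε hε => ?_
  rw [hball, hw1, one_div]
  refine le_sqrtLogInv_ofReal ?_ ?_
  · exact h0.trans_le (Finset.single_le_sum (fun u _ => hw u) (by simpa using hε.1.le))
  · rw [← hw1]
    exact Finset.sum_le_sum_of_subset_of_nonneg (Finset.subset_univ _) fun u _ _ => hw u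

end SupMM

/-! ### The upper bound for the modulus -/

section UpperBound

variable {T : Type u} [PseudoMetricSpace T] {Ω : Type v} {X : T → Ω → ℝ}

/-- The pairs of points of `D` at distance at most `r`. -/
def closePairs (D : Set T) (r : ℝ) : Set (T × T) := {p | p.1 ∈ D ∧ p.2 ∈ D ∧ dist p.1 p.2 ≤ r}

/-- The oscillation of the path at scale `r` along the points of `D`. -/
noncomputable def oscillation (X : T → Ω → ℝ) (D : Set T) (r : ℝ) (ω : Ω) : ℝ≥0∞ :=
  ⨆ p : closePairs D r, ENNReal.ofReal |X p.1.1 ω - X p.1.2 ω|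

lemma countable_closePairs {D : Set T} (hD : D.Countable) (r : ℝ) : Countable (closePairs D r) :=
  ((hD.prod hD).mono (show closePairs D r ⊆ D ×ˢ D from fun _ hp => ⟨hp.1, hp.2.1⟩)).to_subtype

/-- Separability replaces `s` and `t` by points of `D` with nearly the same values. The slack `r <
r'` leaves room for moving the points, which is where `2 * δ` comes from. -/
lemma ofReal_abs_sub_le_oscillation {D : Set T} {ω : Ω}
    (h : ∀ t : T, ∀ ε > 0, X t ω ∈ closure ((fun s => X s ω) '' (D ∩ Metric.ball t ε)))
    {s t : T} {r r' : ℝ} (hst : dist s t ≤ r) (hrr : r < r') :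
    ENNReal.ofReal |X s ω - X t ω| ≤ oscillation X D r' ω := by
  refine ENNReal.le_of_forall_pos_le_add fun ε hε _ => ?_
  have hη : 0 < (r' - r) / 2 := by linarith
  obtain ⟨_, ⟨a, ⟨haD, ha⟩, rfl⟩, ha'⟩ := Metric.mem_closure_iff.1 (h s _ hη) (ε / 2) (by positivity)
  obtain ⟨_, ⟨b, ⟨hbD, hb⟩, rfl⟩, hb'⟩ := Metric.mem_closure_iff.1 (h t _ hη) (ε / 2) (by positivity)
  rw [Metric.mem_ball] at ha hb
  have hab : dist a b ≤ r' := by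
    have := dist_triangle4 a s t b
    rw [dist_comm t b] at this
    linarith
  have h1 : |X s ω - X t ω| ≤ |X a ω - X b ω| + ε := by
    rw [Real.dist_eq] at ha' hb'
    have e1 := abs_sub_le (X s ω) (X a ω) (X t ω)
    have e2 := abs_sub_le (X a ω) (X b ω) (X t ω)
    rw [abs_sub_comm (X b ω)] at e2
    linarith
  refine (ENNReal.ofReal_le_ofReal h1).trans ?_
  rw [ENNReal.ofReal_add (abs_nonneg _) ε.coe_nonneg, ENNReal.ofReal_coe_nnreal]
  gcongr
  exact le_iSup (fun p : closePairs D r' => ENNReal.ofReal |X p.1.1 ω - X p.1.2 ω|)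
    ⟨(a, b), ⟨haD, hbD, hab⟩⟩

variable [MeasurableSpace Ω] {P : Measure Ω}

lemma IsCanonicalGaussian.aemeasurable (hX : IsCanonicalGaussian P X) (t : T) :
    AEMeasurable (X t) P :=
  (hX.gaussian.hasGaussianLaw_eval t).aemeasurable

lemma aemeasurable_oscillation (hX : IsCanonicalGaussian P X) {D : Set T} (hD : D.Countable)
    (r : ℝ) : AEMeasurable (oscillation X D r) P := by
  have := countable_closePairs hD r
  exact AEMeasurable.iSup fun p =>
    ((hX.aemeasurable p.1.1).sub (hX.aemeasurable p.1.2)).norm.ennreal_ofReal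

variable [MeasurableSpace T] [BorelSpace T] [SecondCountableTopology T]

lemma lintegral_iSup_pairs_le_add (hX : IsCanonicalGaussian P X) (J : Finset (T × T)) {r : ℝ}
    (hr : 0 < r) (hJ : ∀ p ∈ J, dist p.1 p.2 ≤ r) :
    ∫⁻ ω, ⨆ p : J, ENNReal.ofReal |X p.1.1 ω - X p.1.2 ω| ∂P ≤
      ENNReal.ofReal (66 * r) + 76 * supMM T r := by
  classical
  rcases J.eq_empty_or_nonempty with rfl | hne
  · simp
  let S : Finset T := J.image Prod.fst ∪ J.image Prod.snd
  have h1 : ∀ p : J, p.1.1 ∈ S := fun p =>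
    Finset.mem_union_left _ (Finset.mem_image_of_mem _ p.2)
  have h2 : ∀ p : J, p.1.2 ∈ S := fun p =>
    Finset.mem_union_right _ (Finset.mem_image_of_mem _ p.2)
  let J' : Finset (S × S) := Finset.univ.filter fun q => ((q.1 : T), (q.2 : T)) ∈ J
  have hJ'ne : J'.Nonempty := by
    obtain ⟨p, hp⟩ := hne
    exact ⟨(⟨p.1, h1 ⟨p, hp⟩⟩, ⟨p.2, h2 ⟨p, hp⟩⟩), Finset.mem_filter.2 ⟨Finset.mem_univ _, hp⟩⟩
  have := hX.isGaussian_map S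
  obtain ⟨w, hw, hw1, hle⟩ := exists_weights_lintegral_iSup_le (hX.integral_eval_map S)
    (hX.integral_sub_sq_map S) hJ'ne hr (fun q hq => hJ _ (Finset.mem_filter.1 hq).2)
  rw [lintegral_map' (Measurable.iSup fun q => by fun_prop).aemeasurable
    (hX.aemeasurable_pi S)] at hle
  refine le_trans (lintegral_mono fun ω => iSup_le fun p => ?_)
    (hle.trans (add_le_add le_rfl (mul_le_mul_right (sum_ballEntropy_le_supMM hw hw1 r) _)))
  exact le_iSup (fun q : J' => ENNReal.ofReal |X q.1.1 ω - X q.1.2 ω|)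
    ⟨(⟨p.1.1, h1 p⟩, ⟨p.1.2, h2 p⟩), Finset.mem_filter.2 ⟨Finset.mem_univ _, p.2⟩⟩

/-- Chaining is run at the largest distance occurring in `J` instead of `r`, because that distance
is itself bounded by `supMM T r`; hence `66 + 76 = 142`. -/
lemma lintegral_iSup_pairs_le (hX : IsCanonicalGaussian P X) (J : Finset (T × T)) {r : ℝ}
    (hr : 0 < r) (hJ : ∀ p ∈ J, dist p.1 p.2 ≤ r) :
    ∫⁻ ω, ⨆ p : J, ENNReal.ofReal |X p.1.1 ω - X p.1.2 ω| ∂P ≤ 142 * supMM T r := by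
  by_cases h : ∃ p ∈ J, 0 < dist p.1 p.2
  · obtain ⟨p₀, hp₀, h0⟩ := h
    obtain ⟨p, hp, hmax⟩ := J.exists_max_image (fun p => dist p.1 p.2) ⟨p₀, hp₀⟩
    have hpos : 0 < dist p.1 p.2 := h0.trans_le (hmax p₀ hp₀)
    refine (lintegral_iSup_pairs_le_add hX J hpos hmax).trans ?_
    calc _ ≤ 66 * supMM T r + 76 * supMM T r := by
          rw [ENNReal.ofReal_mul (by norm_num)]
          simp only [ENNReal.ofReal_ofNat]
          gcongr
          · exact ofReal_dist_le_supMM (hJ p hp)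
          · exact supMM_mono (hJ p hp)
      _ = _ := by rw [← add_mul]; norm_num
  -- All distances in `J` vanish, so the radius may be taken arbitrarily small and the additive term
  -- disappears.
  · push Not at h
    refine ENNReal.le_of_forall_pos_le_add fun ε hε _ => ?_
    have hε' : (0 : ℝ) < min r (ε / 66) := lt_min hr (by positivity)
    refine (lintegral_iSup_pairs_le_add hX J hε' fun p hp => (h p hp).trans hε'.le).trans ?_
    rw [add_comm]
    refine add_le_add ?_ ?_
    · exact mul_le_mul' (by norm_num) (supMM_mono (min_le_left _ _))
    · rw [← ENNReal.ofReal_coe_nnreal]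
      refine ENNReal.ofReal_le_ofReal ?_
      linarith [min_le_right r (ε / 66 : ℝ)]

lemma lintegral_oscillation_le (hX : IsCanonicalGaussian P X) {D : Set T} (hD : D.Countable)
    {r : ℝ} (hr : 0 < r) : ∫⁻ ω, oscillation X D r ω ∂P ≤ 142 * supMM T r := by
  classical
  have := countable_closePairs hD r
  have e : ∀ ω, oscillation X D r ω = ⨆ J : Finset (closePairs D r),
      ⨆ p ∈ J, ENNReal.ofReal |X p.1.1 ω - X p.1.2 ω| := fun ω => iSup_eq_iSup_finset _
  simp_rw [e]
  rw [lintegral_iSup_directed (fun J => ?_) (Monotone.directed_le fun J J' h ω =>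
    biSup_mono (show ∀ p ∈ J, p ∈ J' from h))]
  · refine iSup_le fun J => le_trans (lintegral_mono fun ω => ?_) (lintegral_iSup_pairs_le hX
      (J.image Subtype.val) hr fun p hp => ?_)
    · exact iSup₂_le fun p hp => le_iSup
        (fun q : (J.image Subtype.val : Finset (T × T)) =>
          ENNReal.ofReal |X q.1.1 ω - X q.1.2 ω|) ⟨p.1, Finset.mem_image_of_mem _ hp⟩
    · obtain ⟨q, -, rfl⟩ := Finset.mem_image.1 hp
      exact q.2.2.2
  · exact AEMeasurable.biSup _ J.countable_toSet fun p _ =>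
      ((hX.aemeasurable p.1.1).sub (hX.aemeasurable p.1.2)).norm.ennreal_ofReal

lemma modulus_le_supMM (hX : IsCanonicalGaussian P X) (hsep : IsSeparableProcess P X) {δ : ℝ}
    (hδ : 0 < δ) : modulus P X δ ≤ 142 * supMM T (2 * δ) := by
  obtain ⟨D, hD, h⟩ := hsep
  refine le_trans (lintegral_mono_ae ?_) (lintegral_oscillation_le hX hD (by positivity))
  filter_upwards [h] with ω hω
  exact iSup_le fun s => iSup_le fun t => iSup_le fun hst =>
    ofReal_abs_sub_le_oscillation hω hst (by linarith)

end UpperBound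

/-! ### Fernique's theorem, uniformly in the dimension -/

section Integrability

/-- Fernique's theorem with a bound that only depends on the size of a ball of probability at
least `3 / 4`. -/
lemma exists_lintegral_norm_le {a : ℝ} (ha : 0 < a) : ∃ B : ℝ≥0∞, B ≠ ∞ ∧
    ∀ (ι : Type u) [Fintype ι] (μ : Measure (ι → ℝ)) [IsGaussian μ],
      (∀ i, ∫ x : ι → ℝ, x i ∂μ = 0) → ENNReal.ofReal (3 / 4) ≤ μ {x | ‖x‖ ≤ a} →
      ∫⁻ x, ENNReal.ofReal ‖x‖ ∂μ ≤ B := by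
  set c : ℝ≥0∞ := ENNReal.ofReal (3 / 4) with hc
  have hc2 : 2⁻¹ < c := by
    rw [show (2⁻¹ : ℝ≥0∞) = ENNReal.ofReal (1 / 2) by
      rw [one_div, ENNReal.ofReal_inv_of_pos two_pos]; simp, hc,
      ENNReal.ofReal_lt_ofReal_iff (by norm_num)]
    norm_num
  have hc1 : c < 1 := by
    rw [hc, ← ENNReal.ofReal_one, ENNReal.ofReal_lt_ofReal_iff one_pos]; norm_num
  have hcc : (c / (1 - c)).toReal = 3 := by
    rw [hc, ← ENNReal.ofReal_one, ← ENNReal.ofReal_sub _ (by norm_num), ENNReal.toReal_div,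
      ENNReal.toReal_ofReal (by norm_num), ENNReal.toReal_ofReal (by norm_num)]
    norm_num
  set k := Fernique.logRatio c * a⁻¹ ^ 2 with hk
  have hk0 : 0 < k := mul_pos (Fernique.logRatio_pos hc2 hc1) (by positivity)
  -- Neither `k` nor this bound involves the index type or the measure. The series converges since
  -- `c / (1 - c) = 3` has positive logarithm.
  set B₀ := ENNReal.ofReal (Real.exp (Fernique.logRatio c)) +
    ∑' n : ℕ, ENNReal.ofReal (Real.exp (-2⁻¹ * Real.log (c / (1 - c)).toReal * 2 ^ n)) with hB₀
  have hB₀top : B₀ ≠ ∞ := by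
    refine ENNReal.add_ne_top.2 ⟨ENNReal.ofReal_ne_top, ?_⟩
    refine (Summable.tsum_ofReal_lt_top (Real.summable_exp_nat_mul_of_ge ?_
      (fun i => mod_cast (Nat.lt_pow_self (by simp)).le))).ne
    rw [hcc]
    exact mul_neg_of_neg_of_pos (by simp) (Real.log_pos (by norm_num))
  refine ⟨1 + ENNReal.ofReal k⁻¹ * B₀, ENNReal.add_ne_top.2 ⟨ENNReal.one_ne_top,
    ENNReal.mul_ne_top ENNReal.ofReal_ne_top hB₀top⟩, fun ι _ μ _ hμ hle => ?_⟩
  have h1 := lintegral_exp_mul_sq_norm_le_of_map_rotation_eq_self (μ := μ)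
    (IsGaussian.map_rotation_eq_self (integral_id_eq_zero_of_forall_eval hμ) _) hle hc2
  calc ∫⁻ x, ENNReal.ofReal ‖x‖ ∂μ
      ≤ ∫⁻ x, (1 + ENNReal.ofReal k⁻¹ * ENNReal.ofReal (Real.exp (k * ‖x‖ ^ 2))) ∂μ := by
        refine lintegral_mono fun x => ?_
        rw [← ENNReal.ofReal_mul (inv_nonneg.2 hk0.le), ← ENNReal.ofReal_one,
          ← ENNReal.ofReal_add zero_le_one (by positivity)]
        refine ENNReal.ofReal_le_ofReal ?_
        have h2 := Real.add_one_le_exp (k * ‖x‖ ^ 2)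
        have h3 : ‖x‖ ^ 2 ≤ k⁻¹ * Real.exp (k * ‖x‖ ^ 2) := by
          rw [← div_eq_inv_mul, le_div_iff₀ hk0]; linarith
        nlinarith [sq_nonneg (‖x‖ - 1)]
    _ = 1 + ENNReal.ofReal k⁻¹ * ∫⁻ x, ENNReal.ofReal (Real.exp (k * ‖x‖ ^ 2)) ∂μ := by
        rw [lintegral_add_left measurable_const, lintegral_one, measure_univ,
          lintegral_const_mul' _ _ ENNReal.ofReal_ne_top]
    _ ≤ _ := by gcongr

variable {T : Type u} [PseudoMetricSpace T] {Ω : Type v} {X : T → Ω → ℝ} [MeasurableSpace Ω]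
  {P : Measure Ω}

lemma exists_isGaussian_increments (hX : IsCanonicalGaussian P X) (t₀ : T) (J : Finset T) :
    ∃ μ : Measure (J → ℝ), IsGaussian μ ∧ (∀ i, ∫ x : J → ℝ, x i ∂μ = 0) ∧
      AEMeasurable (fun ω (s : J) => X s ω - X t₀ ω) P ∧
      μ = P.map fun ω (s : J) => X s ω - X t₀ ω := by
  classical
  let S := insert t₀ J
  let i : J → S := fun s => ⟨s, Finset.mem_insert_of_mem s.2⟩
  let i₀ : S := ⟨t₀, Finset.mem_insert_self _ _⟩
  let L : (S → ℝ) →L[ℝ] (J → ℝ) := ContinuousLinearMap.pi fun s =>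
    ContinuousLinearMap.proj (R := ℝ) (φ := fun _ => ℝ) (i s) -
    ContinuousLinearMap.proj (R := ℝ) (φ := fun _ => ℝ) i₀
  have hG := hX.isGaussian_map S
  have hm := hX.aemeasurable_pi S
  have hmL : AEMeasurable (fun ω (s : J) => X s ω - X t₀ ω) P :=
    L.continuous.measurable.comp_aemeasurable hm
  have hmap : (P.map fun ω (s : S) => X s ω).map L = P.map fun ω (s : J) => X s ω - X t₀ ω :=
    AEMeasurable.map_map_of_aemeasurable L.continuous.aemeasurable hm
  refine ⟨_, isGaussian_map L, fun s => ?_, hmL, hmap⟩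
  rw [hmap, integral_map hmL (measurable_pi_apply s).aestronglyMeasurable,
    integral_sub (hX.gaussian.hasGaussianLaw_eval _).integrable
      (hX.gaussian.hasGaussianLaw_eval _).integrable, hX.centered, hX.centered, sub_zero]

/-- An almost surely finite supremum stays below some level `n` with probability above `3/4`. Every
finite subfamily inherits this, Fernique's bound is uniform over them, and monotone convergence
passes to `D`. -/
lemma lintegral_iSup_increments_ne_top [IsProbabilityMeasure P] (hX : IsCanonicalGaussian P X)
    {D : Set T} (hD : D.Countable) (t₀ : T)
    (h : ∀ᵐ ω ∂P, ⨆ t : D, ENNReal.ofReal |X t ω - X t₀ ω| < ∞) :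
    ∫⁻ ω, ⨆ t : D, ENNReal.ofReal |X t ω - X t₀ ω| ∂P ≠ ∞ := by
  classical
  have := hD.to_subtype
  set Z : Ω → ℝ≥0∞ := fun ω => ⨆ t : D, ENNReal.ofReal |X t ω - X t₀ ω| with hZ
  obtain ⟨n, hn, hn0⟩ : ∃ n : ℕ, ENNReal.ofReal (3 / 4) < P {ω | Z ω ≤ n} ∧ 0 < n := by
    have hmono : Monotone fun n : ℕ => {ω | Z ω ≤ n} := fun m n hmn ω hω =>
      show Z ω ≤ n from le_trans (show Z ω ≤ m from hω) (Nat.cast_le.2 hmn)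
    have ht := tendsto_measure_iUnion_atTop (μ := P) hmono
    have hU : P (⋃ n : ℕ, {ω | Z ω ≤ n}) = 1 := by
      rw [← measure_univ (μ := P)]
      refine measure_congr (eventuallyEq_univ.2 ?_)
      filter_upwards [h] with ω hω
      obtain ⟨n, hn⟩ := ENNReal.exists_nat_gt hω.ne
      exact Set.mem_iUnion.2 ⟨n, hn.le⟩
    rw [hU] at ht
    have h34 : ENNReal.ofReal (3 / 4) < 1 := by
      rw [← ENNReal.ofReal_one, ENNReal.ofReal_lt_ofReal_iff one_pos]; norm_num
    exact ((ht.eventually_const_lt h34).and (eventually_gt_atTop 0)).exists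
  obtain ⟨B, hB, hfer⟩ := exists_lintegral_norm_le.{u} (a := (n : ℝ)) (by exact_mod_cast hn0)
  refine ne_top_of_le_ne_top hB ?_
  have e : ∀ ω, Z ω = ⨆ J : Finset D, ⨆ t ∈ J, ENNReal.ofReal |X t ω - X t₀ ω| :=
    fun ω => iSup_eq_iSup_finset _
  change ∫⁻ ω, Z ω ∂P ≤ B
  rw [lintegral_congr e, lintegral_iSup_directed (fun J => ?_) (Monotone.directed_le fun J J' hJ ω =>
    biSup_mono (show ∀ p ∈ J, p ∈ J' from hJ))]
  · refine iSup_le fun J => ?_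
    obtain ⟨μ, hμG, hμ0, hm, rfl⟩ := exists_isGaussian_increments hX t₀ (J.image Subtype.val)
    have key := hfer _ _ hμ0 (by
      rw [Measure.map_apply_of_aemeasurable hm
        (measurableSet_le measurable_norm measurable_const)]
      refine hn.le.trans (measure_mono fun ω hω => ?_)
      refine (pi_norm_le_iff_of_nonneg (Nat.cast_nonneg n)).2 fun s => ?_
      obtain ⟨t, -, hts⟩ := Finset.mem_image.1 s.2
      have h1 := (le_iSup (fun t : D => ENNReal.ofReal |X t ω - X t₀ ω|) t).trans hω
      rw [← ENNReal.ofReal_natCast, ENNReal.ofReal_le_ofReal_iff (Nat.cast_nonneg n), hts] at h1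
      exact h1)
    rw [lintegral_map' measurable_norm.ennreal_ofReal.aemeasurable hm] at key
    refine le_trans (lintegral_mono fun ω => iSup₂_le fun t ht => ENNReal.ofReal_le_ofReal ?_) key
    exact norm_le_pi_norm (fun s : (J.image Subtype.val : Finset T) => X s ω - X t₀ ω)
      ⟨t.1, Finset.mem_image_of_mem _ ht⟩
  · exact AEMeasurable.biSup _ J.countable_toSet fun p _ =>
      ((hX.aemeasurable p.1).sub (hX.aemeasurable t₀)).norm.ennreal_ofReal

end Integrability

/-! ### The criterion for continuity of paths -/

section Continuity

variable {T : Type u} [PseudoMetricSpace T] {Ω : Type v} {X : T → Ω → ℝ}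

lemma oscillation_le_two_mul (D : Set T) (t₀ : T) (r : ℝ) (ω : Ω) :
    oscillation X D r ω ≤ 2 * ⨆ t : D, ENNReal.ofReal |X t ω - X t₀ ω| := by
  refine iSup_le fun p => ?_
  have h1 : |X p.1.1 ω - X p.1.2 ω| ≤ |X p.1.1 ω - X t₀ ω| + |X p.1.2 ω - X t₀ ω| := by
    have := abs_sub_le (X p.1.1 ω) (X t₀ ω) (X p.1.2 ω)
    rwa [abs_sub_comm (X t₀ ω)] at this
  refine (ENNReal.ofReal_le_ofReal h1).trans ?_
  rw [ENNReal.ofReal_add (abs_nonneg _) (abs_nonneg _), two_mul]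
  exact add_le_add (le_iSup (fun t : D => ENNReal.ofReal |X t ω - X t₀ ω|) ⟨p.1.1, p.2.1⟩)
    (le_iSup (fun t : D => ENNReal.ofReal |X t ω - X t₀ ω|) ⟨p.1.2, p.2.2.1⟩)

lemma continuous_of_tendsto_oscillation {D : Set T} {ω : Ω}
    (h : ∀ t : T, ∀ ε > 0, X t ω ∈ closure ((fun s => X s ω) '' (D ∩ Metric.ball t ε)))
    (h0 : ∀ ε > 0, ∃ r > 0, oscillation X D r ω < ε) : Continuous fun t => X t ω := by
  refine Metric.continuous_iff.2 fun t ε hε => ?_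
  obtain ⟨r, hr, hosc⟩ := h0 (ENNReal.ofReal ε) (ENNReal.ofReal_pos.2 hε)
  refine ⟨r / 2, half_pos hr, fun s hs => ?_⟩
  have h1 := (ofReal_abs_sub_le_oscillation h hs.le (half_lt_self hr)).trans_lt hosc
  exact (ENNReal.ofReal_lt_ofReal_iff hε).1 h1

lemma tendsto_oscillation [CompactSpace T] (D : Set T) {ω : Ω} (h : Continuous fun t => X t ω) :
    Tendsto (fun n : ℕ => oscillation X D (1 / ((n : ℝ) + 1)) ω) atTop (𝓝 0) := by
  refine ENNReal.tendsto_nhds_zero.2 fun ε hε => ?_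
  rcases eq_or_ne ε ∞ with rfl | hεtop
  · exact Eventually.of_forall fun _ => le_top
  have hu := Metric.uniformContinuous_iff.1 (CompactSpace.uniformContinuous_of_continuous h)
    ε.toReal (ENNReal.toReal_pos hε.ne' hεtop)
  obtain ⟨δ, hδ, hd⟩ := hu
  filter_upwards [tendsto_one_div_add_atTop_nhds_zero_nat.eventually_lt_const hδ] with n hn
  refine iSup_le fun p => ?_
  rw [← ENNReal.ofReal_toReal hεtop]
  exact ENNReal.ofReal_le_ofReal (hd (p.2.2.2.trans_lt hn)).le

variable [MeasurableSpace Ω] {P : Measure Ω} [MeasurableSpace T] [BorelSpace T] [CompactSpace T]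

lemma ae_continuous_of_tendsto_supMM (hX : IsCanonicalGaussian P X)
    (hsep : IsSeparableProcess P X)
    (h : Tendsto (fun δ : ℝ => supMM T δ) (𝓝[>] 0) (𝓝 0)) :
    ∀ᵐ ω ∂P, Continuous fun t => X t ω := by
  obtain ⟨D, hD, hsep⟩ := hsep
  have hseq : Tendsto (fun n : ℕ => 1 / ((n : ℝ) + 1)) atTop (𝓝[>] 0) :=
    tendsto_nhdsWithin_iff.2 ⟨tendsto_one_div_add_atTop_nhds_zero_nat,
      Eventually.of_forall fun n => Set.mem_Ioi.2 (by positivity)⟩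
  have h1 : Tendsto (fun n : ℕ => 142 * supMM T (1 / ((n : ℝ) + 1))) atTop (𝓝 0) := by
    have := ENNReal.Tendsto.const_mul (h.comp hseq) (a := 142) (.inr (by norm_num))
    rwa [mul_zero] at this
  -- The integral of the infimum is below each mean oscillation. So the infimum over scales vanishes
  -- almost surely, which suffices for continuity.
  have h2 : ∫⁻ ω, ⨅ n : ℕ, oscillation X D (1 / ((n : ℝ) + 1)) ω ∂P = 0 := by
    refine le_antisymm (ge_of_tendsto' h1 fun n => ?_) zero_le
    exact (lintegral_mono fun ω => iInf_le _ n).trans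
      (lintegral_oscillation_le hX hD (by positivity))
  rw [lintegral_eq_zero_iff' (.iInf fun n => aemeasurable_oscillation hX hD _)] at h2
  filter_upwards [h2, hsep] with ω hω hs
  refine continuous_of_tendsto_oscillation hs fun ε hε => ?_
  rw [Pi.zero_apply] at hω
  obtain ⟨n, hn⟩ := iInf_lt_iff.1 (hω ▸ hε)
  exact ⟨_, by positivity, hn⟩

lemma tendsto_supMM_of_ae_continuous [IsProbabilityMeasure P] (hX : IsCanonicalGaussian P X)
    (hsep : IsSeparableProcess P X) (h : ∀ᵐ ω ∂P, Continuous fun t => X t ω) :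
    Tendsto (fun δ : ℝ => supMM T δ) (𝓝[>] 0) (𝓝 0) := by
  rcases isEmpty_or_nonempty T with hT | ⟨⟨t₀⟩⟩
  · have : ∀ δ, supMM T δ = 0 := fun δ => by simp [supMM, mmFunctional]
    simp_rw [this]
    exact tendsto_const_nhds
  obtain ⟨D, hD, hsep⟩ := hsep
  have hZ : ∫⁻ ω, 2 * ⨆ t : D, ENNReal.ofReal |X t ω - X t₀ ω| ∂P ≠ ∞ := by
    rw [lintegral_const_mul' _ _ (by norm_num)]
    refine ENNReal.mul_ne_top (by norm_num) (lintegral_iSup_increments_ne_top hX hD t₀ ?_)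
    filter_upwards [h] with ω hω
    obtain ⟨M, hM⟩ := (isCompact_range hω).isBounded.exists_norm_le
    refine lt_of_le_of_lt (iSup_le fun t => ENNReal.ofReal_le_ofReal ?_)
      (ENNReal.ofReal_lt_top (r := M + M))
    have e1 := hM _ ⟨(t : T), rfl⟩
    have e2 := hM _ ⟨t₀, rfl⟩
    exact (abs_sub _ _).trans (add_le_add e1 e2)
  -- Uniform continuity of paths gives pointwise convergence; twice the largest increment from `t₀`
  -- dominates all scales.
  have hosc : Tendsto (fun n : ℕ => ∫⁻ ω, oscillation X D (1 / ((n : ℝ) + 1)) ω ∂P) atTop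
      (𝓝 0) := by
    have := tendsto_lintegral_of_dominated_convergence' (μ := P) (f := fun _ => 0)
      (F := fun n : ℕ => oscillation X D (1 / ((n : ℝ) + 1)))
      (fun ω => 2 * ⨆ t : D, ENNReal.ofReal |X t ω - X t₀ ω|)
      (fun n => aemeasurable_oscillation hX hD _)
      (fun n => ae_of_all _ fun ω => oscillation_le_two_mul D t₀ _ ω) hZ (by
        filter_upwards [h] with ω hω
        exact tendsto_oscillation D hω)
    rwa [lintegral_zero] at this
  refine ENNReal.tendsto_nhds_zero.2 fun ε hε => ?_
  have h1 : Tendsto (fun n : ℕ => 44000 * ∫⁻ ω, oscillation X D (1 / ((n : ℝ) + 1)) ω ∂P) atTop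
      (𝓝 0) := by
    have := ENNReal.Tendsto.const_mul hosc (a := 44000) (.inr (by norm_num))
    rwa [mul_zero] at this
  obtain ⟨n, hn⟩ := (ENNReal.tendsto_nhds_zero.1 h1 (ε / 2) (ENNReal.half_pos hε.ne')).exists
  set r := 1 / ((n : ℝ) + 1) with hr
  have hr0 : 0 < r := by positivity
  -- Half the radius provides the strict inequality that separability needs.
  have hmod : modulus P X (r / 2) ≤ ∫⁻ ω, oscillation X D r ω ∂P := by
    refine lintegral_mono_ae ?_
    filter_upwards [hsep] with ω hω
    exact iSup_le fun s => iSup_le fun t => iSup_le fun hst =>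
      ofReal_abs_sub_le_oscillation hω hst (half_lt_self hr0)
  -- The scale `r / 2` is now fixed, hence so is the covering number; only `c` tends to `0`, which
  -- kills the covering term.
  have h2 : Tendsto (fun c : ℝ => ENNReal.ofReal (c * sqrtLogCovering T (r / 2))) (𝓝[>] 0)
      (𝓝 0) := by
    have : Tendsto (fun c : ℝ => ENNReal.ofReal (c * sqrtLogCovering T (r / 2))) (𝓝 0)
        (𝓝 (ENNReal.ofReal (0 * sqrtLogCovering T (r / 2)))) :=
      ENNReal.tendsto_ofReal (tendsto_id.mul_const _)
    rw [zero_mul, ENNReal.ofReal_zero] at this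
    exact this.mono_left nhdsWithin_le_nhds
  filter_upwards [ENNReal.tendsto_nhds_zero.1 h2 (ε / 2) (ENNReal.half_pos hε.ne'),
    self_mem_nhdsWithin] with c hc hc0
  refine iSup_le fun μ => (mmFunctional_le_add hX (μ : Measure T) (half_pos hr0) hc0).trans ?_
  rw [← ENNReal.add_halves ε]
  exact add_le_add hc ((mul_le_mul_right hmod _).trans hn)

end Continuity

end GaussianModulus

/-! ### The two-sided bound and the continuity criterion -/

theorem theorem1p6 :
    ∃ K : ℝ≥0, 0 < K ∧
      ∀ (T : Type u) [PseudoMetricSpace T] [CompactSpace T] [Nonempty T]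
        [MeasurableSpace T] [BorelSpace T]
        (Ω : Type v) [MeasurableSpace Ω] (P : Measure Ω) [IsProbabilityMeasure P]
        (X : T → Ω → ℝ),
        GaussianModulus.IsCanonicalGaussian P X →
        GaussianModulus.IsSeparableProcess P X →
        (∀ δ : ℝ, 0 < δ →
          (K : ℝ≥0∞)⁻¹ * GaussianModulus.lowerBoundMM T δ ≤ GaussianModulus.modulus P X δ ∧
          GaussianModulus.modulus P X δ ≤ (K : ℝ≥0∞) * GaussianModulus.supMM T (2 * δ)) ∧
        ((∀ᵐ ω ∂P, Continuous fun t => X t ω) ↔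
          Tendsto (fun δ : ℝ => GaussianModulus.supMM T δ) (𝓝[>] 0) (𝓝 0)) := by
  -- The larger of the constants `44000` of the lower bound and `142` of the upper bound.
  refine ⟨44000, by norm_num, ?_⟩
  intro T _ _ _ _ _ Ω _ P _ X hX hsep
  refine ⟨fun δ hδ => ⟨?_, ?_⟩, GaussianModulus.tendsto_supMM_of_ae_continuous hX hsep,
    GaussianModulus.ae_continuous_of_tendsto_supMM hX hsep⟩
  · refine (mul_le_mul_right (GaussianModulus.lowerBoundMM_le hX hδ) _).trans (le_of_eq ?_)
    rw [← mul_assoc, show ((44000 : ℝ≥0) : ℝ≥0∞) = 44000 from rfl,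
      ENNReal.inv_mul_cancel (by norm_num) (by norm_num), one_mul]
  · refine (GaussianModulus.modulus_le_supMM hX hsep hδ).trans (mul_le_mul' ?_ le_rfl)
    rw [show ((44000 : ℝ≥0) : ℝ≥0∞) = 44000 from rfl]
    norm_num
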